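/- Let $n\ge 2$ be an integer and let $S(x,y)=\sum_{k=1}^{n-1}a_kx^{n-k}y^k$ be a real homogeneous polynomial whose mixed Hessian has the form $$S''_{xy}(x,y)=c\prod_{l=1}^{s}(y-\alpha_l x)^{m_l}\prod_{l=1}^{r}Q_l(x,y)$$ with $c\ne0$, distinct nonzero real $\alpha_l$, integers $m_l\ge1$, and positive definite quadratic forms $Q_l$ (either product may be empty). Let $0<\mu<1$ and let $K(x,y)$ be a complex-valued function that is $C^2$ off the diagonal $x=y$ and satisfies $$|K(x,y)|\le E|x-y|^{-\mu},\qquad |\partial_y^iK(x,y)|\le E|x-y|^{-\mu-i}\quad(i=1,2);$$ nothing is assumed on the $x$-derivatives of $K$ beyond their continuity off the diagonal. Fix $\psi\in C_0^\infty(\mathbb R^2)$; fix $\phi\in C_0^\infty(\mathbb R)$ with $\phi(t)=0$ for $|t|\ge1$ and $\phi(t)=1$ for $|t|\le\frac12$; and fix $\Psi\in C_0^\infty(\mathbb R)$ with $\operatorname{supp}\Psi\subset[\frac12,2]$ and $\sum_{l\in\mathbb Z}\Psi(2^lt)=1$ for $t>0$. Call a real number $\mathcal K>2$ admissible for $S$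 if in the first quadrant the pure powers dominate the Hessian on the following two sectors: $$|S''_{xy}(x,y)-S''_{xy}(x,0)|\le\tfrac12|S''_{xy}(x,0)|\ \text{ for } x>0,\ 0\le y\le 2^{2-\mathcal K}x,$$ $$|S''_{xy}(x,y)-S''_{xy}(0,y)|\le\tfrac12|S''_{xy}(0,y)|\ \text{ for } y>0,\ 0\le x\le 2^{2-\mathcal K}y.$$ For $\lambda\ge 2$, $z\in\mathbb C$ and $j,k\in\mathbb Z$ put $$D_{j,k}f(x)=\int_{\mathbb R}e^{i\lambda S(x,y)}K(x,y)\,|S''_{xy}(x,y)|^{z}\left[1-\phi\left((x-y)\lambda^{1/n}\right)\right]\Psi(2^jx)\Psi(2^ky)\psi(x,y)f(y)\,dy,$$ $$T_X^zf=\sum_{j<k-\mathcal K}D_{j,k}f,\qquad T_Y^zf=\sum_{j>k+\mathcal K}D_{j,k}f .$$ Then: (i) for every such $S$, all sufficiently large $\mathcal K$ are admissible; (ii) if $\operatorname{Re}z=\frac12$ and $\mathcal K$ is admissible for $S$, then for every $\lambda\ge2$ and every $f\in L^2(\mathbb R)$ the integrals defining $D_{j,k}f(x)$ and the sums defining $T_X^zf(x)$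 and $T_Y^zf(x)$ converge absolutely for every $x$, the functions $T_X^zf$ and $T_Y^zf$ belong to $L^2(\mathbb R)$, and $$\|T_Y^zf\|_{L^2}\le C\lambda^{\frac{\mu}{n}-\frac12}\log(\lambda)\,\|f\|_{L^2},\qquad \|T_X^zf\|_{L^2}\le C\lambda^{\frac{\mu}{n}-\frac12}\log(\lambda)\,\|f\|_{L^2},$$ with a constant $C$ that depends only on $E$, $\mathcal K$, $\psi$, $n$, $z$ and on the fixed cut-offs $\phi$, $\Psi$ (in particular not on $\lambda$, $f$, $\mu$, $K$, nor on $S$ except through $\mathcal K$). -/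

import Mathlib

open MeasureTheory
open scoped ContDiff

noncomputable section

namespace DampedOsc

/-- The homogeneous phase `S(x,y) = ∑_{k=1}^{n-1} a_k x^{n-k} y^k` of degree `n`. -/
def phase (n : ℕ) (a : ℕ → ℝ) (x y : ℝ) : ℝ :=
  ∑ k ∈ Finset.Icc 1 (n - 1), a k * x ^ (n - k) * y ^ k

/-- The mixed second derivative `S''_{xy}`. -/
def mixedHessian (S : ℝ → ℝ → ℝ) (x y : ℝ) : ℝ :=
  deriv (fun v => deriv (fun u => S u v) x) y

/-- `H(x,y) = c ∏_l (y - α_l x)^{m_l} ∏_l Q_l(x,y)` with `c ≠ 0`, distinct nonzero real `α_l`,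
multiplicities `m_l ≥ 1`, and positive definite quadratic forms
`Q_l(x,y) = p_l x² + q_l x y + w_l y²` (either product may be empty). -/
def HasHessianForm (H : ℝ → ℝ → ℝ) : Prop :=
  ∃ (c : ℝ) (s r : ℕ) (α : Fin s → ℝ) (m : Fin s → ℕ) (p q w : Fin r → ℝ),
    c ≠ 0 ∧ Function.Injective α ∧ (∀ l, α l ≠ 0) ∧ (∀ l, 1 ≤ m l) ∧
    (∀ l x y, (x, y) ≠ ((0 : ℝ), (0 : ℝ)) →
      0 < p l * x ^ 2 + q l * (x * y) + w l * y ^ 2) ∧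
    ∀ x y, H x y = c * (∏ l, (y - α l * x) ^ m l) *
      ∏ l, (p l * x ^ 2 + q l * (x * y) + w l * y ^ 2)

/-- The separation constant `κ` is large enough for the Hessian `H`: on the closed sector
`{0 ≤ y ≤ 2^{2-κ} x}` of the first quadrant, which contains the supports of all the products
`Ψ(2^j x) Ψ(2^k y)` with `j < k - κ`, the pure `x`-part `H(x,0)` dominates `H(x,y)`, and
symmetrically the pure `y`-part dominates on the sector `{0 ≤ x ≤ 2^{2-κ} y}`. The requirement
`2 < κ` says that these sectors stay away from the diagonal, where the kernel is singular. -/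
def IsDominating (H : ℝ → ℝ → ℝ) (κ : ℝ) : Prop :=
  2 < κ ∧
  (∀ x y : ℝ, 0 < x → 0 ≤ y → y ≤ (2 : ℝ) ^ (2 - κ) * x →
    |H x y - H x 0| ≤ |H x 0| / 2) ∧
  (∀ x y : ℝ, 0 < y → 0 ≤ x → x ≤ (2 : ℝ) ^ (2 - κ) * y →
    |H x y - H 0 y| ≤ |H 0 y| / 2)

/-- `K` is `C²` off the diagonal with `|∂_y^i K(x,y)| ≤ E |x-y|^{-μ-i}` for `i = 0, 1, 2`.
Nothing is assumed on the `x`-derivatives. -/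
structure IsSingularKernel (K : ℝ × ℝ → ℂ) (E μ : ℝ) : Prop where
  contDiffOn : ContDiffOn ℝ 2 K {p | p.1 ≠ p.2}
  bound : ∀ i : ℕ, i ≤ 2 → ∀ x y : ℝ, x ≠ y →
    ‖iteratedDeriv i (fun v => K (x, v)) y‖ ≤ E * |x - y| ^ (-μ - (i : ℝ))

/-- The cut-off `φ` to the neighbourhood of the diagonal. -/
structure IsDiagonalCutoff (φ : ℝ → ℝ) : Prop where
  smooth : ContDiff ℝ ∞ φ
  eq_zero : ∀ t, 1 ≤ |t| → φ t = 0
  eq_one : ∀ t, |t| ≤ 1 / 2 → φ t = 1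

/-- The generator `Ψ` of a dyadic partition of unity on the positive half-line. -/
structure IsDyadicCutoff (Ψ : ℝ → ℝ) : Prop where
  smooth : ContDiff ℝ ∞ Ψ
  support : tsupport Ψ ⊆ Set.Icc (1 / 2) 2
  sum_eq_one : ∀ t, 0 < t → HasSum (fun l : ℤ => Ψ ((2 : ℝ) ^ l * t)) 1

/-- The kernel of the `(j,k)`-th dyadic piece of the damped operator:
`e^{iλS(x,y)} K(x,y) |S''_{xy}|^z [1 - φ((x-y)λ^{1/n})] Ψ(2^j x) Ψ(2^k y) ψ(x,y)`. -/
def pieceKernel (n : ℕ) (a : ℕ → ℝ) (K : ℝ × ℝ → ℂ) (φ Ψ : ℝ → ℝ) (ψ : ℝ × ℝ → ℂ)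
    (lam : ℝ) (z : ℂ) (j k : ℤ) (x y : ℝ) : ℂ :=
  Complex.exp (Complex.I * ((lam * phase n a x y : ℝ) : ℂ)) * K (x, y) *
    ((|mixedHessian (phase n a) x y| : ℝ) : ℂ) ^ z *
    ((1 - φ ((x - y) * lam ^ (1 / (n : ℝ))) : ℝ) : ℂ) *
    ((Ψ ((2 : ℝ) ^ j * x) * Ψ ((2 : ℝ) ^ k * y) : ℝ) : ℂ) * ψ (x, y)

/-- The `(j,k)`-th dyadic piece of the damped operator. -/
def piece (n : ℕ) (a : ℕ → ℝ) (K : ℝ × ℝ → ℂ) (φ Ψ : ℝ → ℝ) (ψ : ℝ × ℝ → ℂ)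
    (lam : ℝ) (z : ℂ) (j k : ℤ) (f : ℝ → ℂ) (x : ℝ) : ℂ :=
  ∫ y, pieceKernel n a K φ Ψ ψ lam z j k x y * f y

/-- The pairs `(j,k)` with `j ≪ k`, that is `j < k - κ`. -/
def indexX (κ : ℝ) : Set (ℤ × ℤ) := {p | (p.1 : ℝ) < (p.2 : ℝ) - κ}

/-- The pairs `(j,k)` with `j ≫ k`, that is `j > k + κ`. -/
def indexY (κ : ℝ) : Set (ℤ × ℤ) := {p | (p.1 : ℝ) > (p.2 : ℝ) + κ}

/-- The damped operator `T_X^z`: the sum of the pieces with `j ≪ k`. -/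
def dampedX (n : ℕ) (a : ℕ → ℝ) (K : ℝ × ℝ → ℂ) (φ Ψ : ℝ → ℝ) (ψ : ℝ × ℝ → ℂ)
    (lam κ : ℝ) (z : ℂ) (f : ℝ → ℂ) (x : ℝ) : ℂ :=
  ∑' p : indexX κ, piece n a K φ Ψ ψ lam z p.1.1 p.1.2 f x

/-- The damped operator `T_Y^z`: the sum of the pieces with `j ≫ k`. -/
def dampedY (n : ℕ) (a : ℕ → ℝ) (K : ℝ × ℝ → ℂ) (φ Ψ : ℝ → ℝ) (ψ : ℝ × ℝ → ℂ)
    (lam κ : ℝ) (z : ℂ) (f : ℝ → ℂ) (x : ℝ) : ℂ :=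
  ∑' p : indexY κ, piece n a K φ Ψ ψ lam z p.1.1 p.1.2 f x

end DampedOsc

end

open DampedOsc

/-! In `T_X` the variable `y` is much smaller than `x`, so for fixed `j` everything lives at the
single scale `r = 2⁻ʲ`: `x ∼ r`, `|x - y| ∼ r`, and the Hessian, a form of degree `N = n - 2` with
coefficients `b_l`, has size `A = |b₀| rᴺ`, each `y`-derivative costing a factor `1/r`. The sum over
`k` is carried out first: it merges the cut-offs `Ψ(2ᵏy)` into one cut-off `χ(2ʲy)`
(`IsDyadicCutoff.exists_tail`). In `T_Y` the roles of the variables are exchanged, with `r = 2⁻ᵏ`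
and `A = |b_N| rᴺ`.

At one scale the `TT*` method applies. The kernel of `TT*` is an integral in `y` with phase
`λ(S(x,y) - S(x',y))`. By the mean value theorem in `x`, the `y`-derivative of this phase is `λ
S''_{xy}(ξ,y)(x - x')`, of size `λA|x - x'|`. Two integrations by parts give the decay `(λAr|x -
x'|)⁻²`, which is integrable in `x'`, and Schur's test yields the norm `B (λA)^{-1/2}` for an
amplitude of size `B` (`exists_oscillatory_operator_bound`). The amplitude is differentiated only in
`y`, so no `x`-regularity of `K` is needed. For `Re z = 1/2` the amplitude has size `E A^{1/2}
r^{-μ}`: the damping cancels `A`, and each scale contributes `E r^{-μ} λ^{-1/2}`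
(`exists_scale_bound`).

The factor `1 - φ` removes the scales `r ≪ λ^{-1/n}` and the support of `ψ` removes the large ones.
Hence `r^{-μ} ≲ λ^{μ/n}`, only `O(log λ)` scales remain (`exists_scales`), and the triangle
inequality finishes.

Uniformity in `S`: admissibility bounds `S''_{xy}(1,t)` by `(3/2)|b₀|` on an interval whose length
depends only on `κ`, and the coefficients of a polynomial are controlled by its supremum there
(`exists_coeff_bound`). All size ratios therefore depend on `N` and `κ` alone. Existence of
admissible `κ` needs only that the two extreme coefficients of the Hessian are nonzero. -/

/-! ### Calculus of functions with derivative bounds at a scale `r`. -/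

/-- `f` is twice continuously differentiable on `J` and its derivatives of order `i ≤ 2` are at most
`B r⁻ⁱ` there. -/
def ControlledOn (J : Set ℝ) (B r : ℝ) (f : ℝ → ℂ) : Prop :=
  ∃ f₁ f₂ : ℝ → ℂ, (∀ y ∈ J, HasDerivAt f (f₁ y) y) ∧ (∀ y ∈ J, HasDerivAt f₁ (f₂ y) y) ∧
    ContinuousOn f₂ J ∧ (∀ y ∈ J, ‖f y‖ ≤ B) ∧ (∀ y ∈ J, ‖f₁ y‖ ≤ B / r) ∧
    ∀ y ∈ J, ‖f₂ y‖ ≤ B / r ^ 2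

namespace ControlledOn

variable {J : Set ℝ} {B B' r : ℝ} {f g : ℝ → ℂ}

theorem continuousOn (hf : ControlledOn J B r f) : ContinuousOn f J := by
  obtain ⟨f₁, f₂, h, -⟩ := hf
  exact fun y hy => (h y hy).continuousAt.continuousWithinAt

theorem norm_le (hf : ControlledOn J B r f) {y : ℝ} (hy : y ∈ J) : ‖f y‖ ≤ B := by
  obtain ⟨f₁, f₂, -, -, -, h, -⟩ := hf
  exact h y hy

theorem mono (hr : 0 < r) (h : B ≤ B') (hf : ControlledOn J B r f) : ControlledOn J B' r f := by
  obtain ⟨f₁, f₂, h0, h1, h2, h3, h4, h5⟩ := hf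
  refine ⟨f₁, f₂, h0, h1, h2, fun y hy => (h3 y hy).trans h, fun y hy => (h4 y hy).trans ?_,
    fun y hy => (h5 y hy).trans ?_⟩ <;> gcongr

/-- The Leibniz expansions of orders 0, 1, 2 have 1, 2, 4 terms, each at most `B B' r⁻ⁱ`; hence the
factor 4. -/
theorem mul (hr : 0 < r) (hB : 0 ≤ B) (hf : ControlledOn J B r f) (hg : ControlledOn J B' r g) :
    ControlledOn J (4 * B * B') r (fun y => f y * g y) := by
  obtain ⟨f₁, f₂, hf0, hf1, hf2, hf3, hf4, hf5⟩ := hf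
  obtain ⟨g₁, g₂, hg0, hg1, hg2, hg3, hg4, hg5⟩ := hg
  have cf : ContinuousOn f J := fun y hy => (hf0 y hy).continuousAt.continuousWithinAt
  have cg : ContinuousOn g J := fun y hy => (hg0 y hy).continuousAt.continuousWithinAt
  have cf1 : ContinuousOn f₁ J := fun y hy => (hf1 y hy).continuousAt.continuousWithinAt
  have cg1 : ContinuousOn g₁ J := fun y hy => (hg1 y hy).continuousAt.continuousWithinAt
  refine ⟨fun y => f₁ y * g y + f y * g₁ y,
    fun y => (f₂ y * g y + f₁ y * g₁ y) + (f₁ y * g₁ y + f y * g₂ y),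
    fun y hy => (hf0 y hy).mul (hg0 y hy),
    fun y hy => ((hf1 y hy).mul (hg0 y hy)).add ((hf0 y hy).mul (hg1 y hy)),
    ((hf2.mul cg).add (cf1.mul cg1)).add ((cf1.mul cg1).add (cf.mul hg2)), ?_, ?_, ?_⟩
  · intro y hy
    have hB' : 0 ≤ B' := (norm_nonneg _).trans (hg3 y hy)
    rw [norm_mul]
    have := mul_le_mul (hf3 y hy) (hg3 y hy) (norm_nonneg _) hB
    nlinarith [mul_nonneg hB hB']
  · intro y hy
    have hB' : 0 ≤ B' := (norm_nonneg _).trans (hg3 y hy)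
    refine (norm_add_le _ _).trans ?_
    rw [norm_mul, norm_mul]
    have h1 := mul_le_mul (hf4 y hy) (hg3 y hy) (norm_nonneg _) (by positivity)
    have h2 := mul_le_mul (hf3 y hy) (hg4 y hy) (norm_nonneg _) hB
    have h3 : 0 ≤ B * B' / r := by positivity
    have e1 : B / r * B' = B * B' / r := by ring
    have e2 : B * (B' / r) = B * B' / r := by ring
    have e3 : 4 * B * B' / r = 4 * (B * B' / r) := by ring
    linarith
  · intro y hy
    have hB' : 0 ≤ B' := (norm_nonneg _).trans (hg3 y hy)
    refine (norm_add_le _ _).trans ((add_le_add (norm_add_le _ _) (norm_add_le _ _)).trans ?_)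
    rw [norm_mul, norm_mul, norm_mul]
    have h1 := mul_le_mul (hf5 y hy) (hg3 y hy) (norm_nonneg _) (by positivity)
    have h2 := mul_le_mul (hf4 y hy) (hg4 y hy) (norm_nonneg _) (by positivity)
    have h3 := mul_le_mul (hf3 y hy) (hg5 y hy) (norm_nonneg _) hB
    have e1 : B / r ^ 2 * B' = B * B' / r ^ 2 := by ring
    have e2 : B * (B' / r ^ 2) = B * B' / r ^ 2 := by ring
    have e4 : B / r * (B' / r) = B * B' / r ^ 2 := by field_simp
    have e3 : 4 * B * B' / r ^ 2 = 4 * (B * B' / r ^ 2) := by ring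
    linarith

theorem const_mul (c : ℂ) (hf : ControlledOn J B r f) :
    ControlledOn J (‖c‖ * B) r (fun y => c * f y) := by
  obtain ⟨f₁, f₂, h0, h1, h2, h3, h4, h5⟩ := hf
  refine ⟨fun y => c * f₁ y, fun y => c * f₂ y, fun y hy => (h0 y hy).const_mul c,
    fun y hy => (h1 y hy).const_mul c, continuousOn_const.mul h2, fun y hy => ?_, fun y hy => ?_,
    fun y hy => ?_⟩
  · rw [norm_mul]; exact mul_le_mul_of_nonneg_left (h3 y hy) (norm_nonneg _)
  · rw [norm_mul, mul_div_assoc]; exact mul_le_mul_of_nonneg_left (h4 y hy) (norm_nonneg _)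
  · rw [norm_mul, mul_div_assoc]; exact mul_le_mul_of_nonneg_left (h5 y hy) (norm_nonneg _)

theorem conj (hf : ControlledOn J B r f) :
    ControlledOn J B r (fun y => (starRingEnd ℂ) (f y)) := by
  obtain ⟨f₁, f₂, h0, h1, h2, h3, h4, h5⟩ := hf
  refine ⟨fun y => (starRingEnd ℂ) (f₁ y), fun y => (starRingEnd ℂ) (f₂ y),
    fun y hy => (h0 y hy).star_conj, fun y hy => (h1 y hy).star_conj,
    Complex.continuous_conj.comp_continuousOn h2, ?_, ?_, ?_⟩ <;>
  simpa only [RCLike.norm_conj]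

/-- A real function with the corresponding bounds on its derivatives. -/
theorem of_real {f f₁ f₂ : ℝ → ℝ} (h0 : ∀ y ∈ J, HasDerivAt f (f₁ y) y)
    (h1 : ∀ y ∈ J, HasDerivAt f₁ (f₂ y) y) (h2 : ContinuousOn f₂ J) (h3 : ∀ y ∈ J, |f y| ≤ B)
    (h4 : ∀ y ∈ J, |f₁ y| ≤ B / r) (h5 : ∀ y ∈ J, |f₂ y| ≤ B / r ^ 2) :
    ControlledOn J B r (fun y => (f y : ℂ)) :=
  ⟨fun y => (f₁ y : ℂ), fun y => (f₂ y : ℂ), fun y hy => (h0 y hy).ofReal_comp,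
    fun y hy => (h1 y hy).ofReal_comp, Complex.continuous_ofReal.comp_continuousOn h2,
    fun y hy => by simpa using h3 y hy, fun y hy => by simpa using h4 y hy,
    fun y hy => by simpa using h5 y hy⟩

end ControlledOn

/-! ### Nonstationary phase in one variable. -/

/-- A two-sided derivative is determined by the one-sided one. With its mirror image this kills the
boundary terms of the second integration by parts, where a derivative of the amplitude sits at the
endpoints. -/
theorem HasDerivAt.eq_zero_of_eqOn_Iic {f : ℝ → ℂ} {f' : ℂ} {c : ℝ} (h : HasDerivAt f f' c)
    (h0 : ∀ y ≤ c, f y = 0) : f' = 0 := by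
  have h1 : HasDerivWithinAt f 0 (Set.Iic c) c :=
    (hasDerivWithinAt_const c (Set.Iic c) (0 : ℂ)).congr h0 (h0 c le_rfl)
  exact (uniqueDiffWithinAt_Iic c).eq_deriv _ h.hasDerivWithinAt h1

theorem HasDerivAt.eq_zero_of_eqOn_Ici {f : ℝ → ℂ} {f' : ℂ} {c : ℝ} (h : HasDerivAt f f' c)
    (h0 : ∀ y ≥ c, f y = 0) : f' = 0 := by
  have h1 : HasDerivWithinAt f 0 (Set.Ici c) c :=
    (hasDerivWithinAt_const c (Set.Ici c) (0 : ℂ)).congr h0 (h0 c le_rfl)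
  exact (uniqueDiffWithinAt_Ici c).eq_deriv _ h.hasDerivWithinAt h1

/-- One integration by parts in an oscillatory integral without boundary terms. -/
theorem integral_exp_mul_eq_of_phase_ne_zero {c d : ℝ} (hcd : c ≤ d) {P P₁ P₂ : ℝ → ℝ}
    {u u₁ : ℝ → ℂ}
    (hP : ∀ y ∈ Set.Icc c d, HasDerivAt P (P₁ y) y)
    (hP₁ : ∀ y ∈ Set.Icc c d, HasDerivAt P₁ (P₂ y) y) (hP₂ : ContinuousOn P₂ (Set.Icc c d))
    (hne : ∀ y ∈ Set.Icc c d, P₁ y ≠ 0) (hu : ∀ y ∈ Set.Icc c d, HasDerivAt u (u₁ y) y)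
    (hu₁ : ContinuousOn u₁ (Set.Icc c d)) (huc : u c = 0) (hud : u d = 0) :
    ∫ y in c..d, Complex.exp (Complex.I * P y) * u y =
      Complex.I * ∫ y in c..d, Complex.exp (Complex.I * P y) *
        (u₁ y * ((P₁ y)⁻¹ : ℝ) + u y * ((-P₂ y / P₁ y ^ 2 : ℝ) : ℂ)) := by
  have cP : ContinuousOn P (Set.Icc c d) :=
    fun y hy => (hP y hy).continuousAt.continuousWithinAt
  have cP₁ : ContinuousOn P₁ (Set.Icc c d) :=
    fun y hy => (hP₁ y hy).continuousAt.continuousWithinAt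
  have cu : ContinuousOn u (Set.Icc c d) :=
    fun y hy => (hu y hy).continuousAt.continuousWithinAt
  have hE : ∀ y ∈ Set.uIcc c d, HasDerivAt (fun y => Complex.exp (Complex.I * P y))
      (Complex.exp (Complex.I * P y) * (Complex.I * P₁ y)) y := by
    intro y hy
    rw [Set.uIcc_of_le hcd] at hy
    exact ((hP y hy).ofReal_comp.const_mul Complex.I).cexp
  have cE : ContinuousOn (fun y => Complex.exp (Complex.I * P y)) (Set.Icc c d) := by
    rw [← Set.uIcc_of_le hcd]
    exact fun y hy => (hE y hy).continuousAt.continuousWithinAt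
  have hv : ∀ y ∈ Set.uIcc c d, HasDerivAt (fun y => u y * ((P₁ y)⁻¹ : ℝ))
      (u₁ y * ((P₁ y)⁻¹ : ℝ) + u y * ((-P₂ y / P₁ y ^ 2 : ℝ) : ℂ)) y := by
    intro y hy
    rw [Set.uIcc_of_le hcd] at hy
    exact (hu y hy).mul ((hP₁ y hy).inv (hne y hy)).ofReal_comp
  have key := intervalIntegral.integral_mul_deriv_eq_deriv_mul hv hE ?_ ?_
  · simp only [huc, hud, zero_mul, sub_self, zero_sub] at key
    -- Insert `e^{iP} = -i (e^{iP})' / P₁`, so that the derivative can be moved onto `u / P₁`.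
    have h1 : ∫ y in c..d, Complex.exp (Complex.I * P y) * u y =
        -Complex.I * ∫ y in c..d, u y * ((P₁ y)⁻¹ : ℝ) *
          (Complex.exp (Complex.I * P y) * (Complex.I * P₁ y)) := by
      rw [← intervalIntegral.integral_const_mul]
      refine intervalIntegral.integral_congr fun y hy => ?_
      rw [Set.uIcc_of_le hcd] at hy
      have : (P₁ y : ℂ) ≠ 0 := by exact_mod_cast hne y hy
      push_cast
      field_simp
      rw [Complex.I_sq]; ring
    rw [h1, key]
    rw [neg_mul_neg]
    congr 1
    exact intervalIntegral.integral_congr fun y _ => mul_comm _ _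
  · refine ContinuousOn.intervalIntegrable ?_
    rw [Set.uIcc_of_le hcd]
    refine (hu₁.mul (Complex.continuous_ofReal.comp_continuousOn (cP₁.inv₀ hne))).add
      (cu.mul (Complex.continuous_ofReal.comp_continuousOn ?_))
    exact hP₂.neg.div (cP₁.pow 2) fun y hy => pow_ne_zero 2 (hne y hy)
  · refine ContinuousOn.intervalIntegrable ?_
    rw [Set.uIcc_of_le hcd]
    exact cE.mul (continuousOn_const.mul (Complex.continuous_ofReal.comp_continuousOn cP₁))

/-- Second order decay of a nonstationary oscillatory integral at scale `r`. -/
theorem norm_integral_exp_mul_le_of_nonstationary {c d : ℝ} (hcd : c ≤ d) {r m M B : ℝ} (hr : 0 < r)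
    (hm : 0 < m) (hM : 0 ≤ M) (hB : 0 ≤ B) {P P₁ P₂ P₃ : ℝ → ℝ} {b : ℝ → ℂ}
    (hP : ∀ y ∈ Set.Icc c d, HasDerivAt P (P₁ y) y)
    (hP₁ : ∀ y ∈ Set.Icc c d, HasDerivAt P₁ (P₂ y) y)
    (hP₂ : ∀ y ∈ Set.Icc c d, HasDerivAt P₂ (P₃ y) y) (hP₃ : ContinuousOn P₃ (Set.Icc c d))
    (h1 : ∀ y ∈ Set.Icc c d, m ≤ |P₁ y|) (h2 : ∀ y ∈ Set.Icc c d, |P₂ y| ≤ M * m / r)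
    (h3 : ∀ y ∈ Set.Icc c d, |P₃ y| ≤ M * m / r ^ 2)
    (hb : ControlledOn (Set.Icc c d) B r b) (hb0 : ∀ y, y ∉ Set.Ioo c d → b y = 0) :
    ‖∫ y in c..d, Complex.exp (Complex.I * P y) * b y‖ ≤
      8 * (1 + M + 2 * M ^ 2) ^ 2 * B * (d - c) / (m * r) ^ 2 := by
  have hne : ∀ y ∈ Set.Icc c d, P₁ y ≠ 0 := fun y hy h => by
    have := h1 y hy
    rw [h, abs_zero] at this
    linarith
  have cP₁ : ContinuousOn P₁ (Set.Icc c d) :=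
    fun y hy => (hP₁ y hy).continuousAt.continuousWithinAt
  have cP₂ : ContinuousOn P₂ (Set.Icc c d) :=
    fun y hy => (hP₂ y hy).continuousAt.continuousWithinAt
  -- One constant serving `1/P₁` and its two derivatives, whose bounds carry the factors `1`, `M`
  -- and `M + 2M²`.
  set D := 1 + M + 2 * M ^ 2 with hD
  have hD0 : 0 < D := by positivity
  have hq0 : ∀ y ∈ Set.Icc c d, |(P₁ y)⁻¹| ≤ D / m := by
    intro y hy
    rw [abs_inv, div_eq_mul_inv]
    calc |P₁ y|⁻¹ ≤ m⁻¹ := inv_anti₀ hm (h1 y hy)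
      _ ≤ D * m⁻¹ := le_mul_of_one_le_left (by positivity) (by rw [hD]; nlinarith [sq_nonneg M])
  have hq1 : ∀ y ∈ Set.Icc c d, |-P₂ y / P₁ y ^ 2| ≤ D / m / r := by
    intro y hy
    rw [abs_div, abs_neg, abs_pow]
    calc |P₂ y| / |P₁ y| ^ 2 ≤ (M * m / r) / m ^ 2 := by
          gcongr
          · exact h2 y hy
          · exact h1 y hy
      _ = M / m / r := by field_simp
      _ ≤ D / m / r := by gcongr; rw [hD]; nlinarith [sq_nonneg M]
  have hQ : ControlledOn (Set.Icc c d) (D / m) r (fun y => (((P₁ y)⁻¹ : ℝ) : ℂ)) := by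
    refine ControlledOn.of_real (f₁ := fun y => -P₂ y / P₁ y ^ 2)
      (f₂ := fun y => (-P₃ y * P₁ y ^ 2 - -P₂ y * (2 * P₁ y ^ 1 * P₂ y)) / (P₁ y ^ 2) ^ 2)
      (fun y hy => (hP₁ y hy).inv (hne y hy)) ?_ ?_ hq0 hq1 ?_
    · intro y hy
      have := (hP₂ y hy).neg.div ((hP₁ y hy).pow 2) (pow_ne_zero 2 (hne y hy))
      exact this
    · refine ContinuousOn.div ?_ ((cP₁.pow 2).pow 2)
        fun y hy => pow_ne_zero 2 (pow_ne_zero 2 (hne y hy))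
      exact (hP₃.neg.mul (cP₁.pow 2)).sub (cP₂.neg.mul ((continuousOn_const.mul
          (cP₁.pow 1)).mul cP₂))
    · intro y hy
      have hn := hne y hy
      have e : (-P₃ y * P₁ y ^ 2 - -P₂ y * (2 * P₁ y ^ 1 * P₂ y)) / (P₁ y ^ 2) ^ 2 =
          -P₃ y / P₁ y ^ 2 + 2 * P₂ y ^ 2 / P₁ y ^ 3 := by
        field_simp
        ring
      rw [e]
      refine (abs_add_le _ _).trans ?_
      rw [abs_div, abs_div, abs_neg, abs_pow, abs_mul, abs_pow, abs_pow, abs_two]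
      calc |P₃ y| / |P₁ y| ^ 2 + 2 * |P₂ y| ^ 2 / |P₁ y| ^ 3
          ≤ (M * m / r ^ 2) / m ^ 2 + 2 * (M * m / r) ^ 2 / m ^ 3 := by
            gcongr
            · exact h3 y hy
            · exact h1 y hy
            · exact h2 y hy
            · exact h1 y hy
        _ = (M + 2 * M ^ 2) / m / r ^ 2 := by field_simp
        _ ≤ D / m / r ^ 2 := by gcongr; rw [hD]; linarith
  have hbQ := hb.mul hr hB hQ
  set C := 4 * B * (D / m) with hC
  have hC0 : 0 ≤ C := by positivity
  obtain ⟨b₁, b₂, hb1, -⟩ := hb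
  obtain ⟨q, q', hq, hq', cq', -, bq, bq'⟩ := hbQ
  have hcmem : c ∈ Set.Icc c d := ⟨le_rfl, hcd⟩
  have hdmem : d ∈ Set.Icc c d := ⟨hcd, le_rfl⟩
  have cb : ContinuousOn b (Set.Icc c d) :=
    fun y hy => (hb1 y hy).continuousAt.continuousWithinAt
  have cq : ContinuousOn q (Set.Icc c d) :=
    fun y hy => (hq' y hy).continuousAt.continuousWithinAt
  have hbl : ∀ y ≤ c, b y = 0 := fun y hy => hb0 y fun h => absurd h.1 (not_lt.2 hy)
  have hbr : ∀ y ≥ d, b y = 0 := fun y hy => hb0 y fun h => absurd h.2 (not_lt.2 hy)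
  -- Here `q = (b / P₁)'`. It vanishes at both endpoints because `b` is zero beyond them and
  -- differentiable there.
  have hqc : q c = 0 := (hq c hcmem).eq_zero_of_eqOn_Iic fun y hy => by simp [hbl y hy]
  have hqd : q d = 0 := (hq d hdmem).eq_zero_of_eqOn_Ici fun y hy => by simp [hbr y hy]
  have hqeq : ∀ y ∈ Set.Icc c d,
      b₁ y * ((P₁ y)⁻¹ : ℝ) + b y * ((-P₂ y / P₁ y ^ 2 : ℝ) : ℂ) = q y := fun y hy =>
    ((hb1 y hy).mul ((hP₁ y hy).inv (hne y hy)).ofReal_comp).unique (hq y hy)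
  -- Continuity of `b₁` is recovered from that of `q` by solving `q = b₁ / P₁ - b P₂ / P₁²` for
  -- `b₁`.
  have hb1' : ∀ y ∈ Set.Icc c d, b₁ y =
      (q y - b y * ((-P₂ y / P₁ y ^ 2 : ℝ) : ℂ)) * P₁ y := by
    intro y hy
    have hn : (P₁ y : ℂ) ≠ 0 := by exact_mod_cast hne y hy
    rw [← hqeq y hy]
    push_cast
    field_simp
    ring
  have cR : ContinuousOn (fun y => ((-P₂ y / P₁ y ^ 2 : ℝ) : ℂ)) (Set.Icc c d) :=
    Complex.continuous_ofReal.comp_continuousOn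
      (cP₂.neg.div (cP₁.pow 2) fun y hy => pow_ne_zero 2 (hne y hy))
  have cb1 : ContinuousOn b₁ (Set.Icc c d) :=
    ((cq.sub (cb.mul cR)).mul (Complex.continuous_ofReal.comp_continuousOn cP₁)).congr hb1'
  rw [integral_exp_mul_eq_of_phase_ne_zero hcd hP hP₁ cP₂ hne hb1 cb1 (hbl c le_rfl) (hbr d le_rfl)]
  rw [intervalIntegral.integral_congr (g := fun y => Complex.exp (Complex.I * P y) * q y)
    (fun y hy => by rw [Set.uIcc_of_le hcd] at hy; simp only [hqeq y hy])]
  -- The second integration by parts, with `q` in the place of `b`.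
  rw [integral_exp_mul_eq_of_phase_ne_zero hcd hP hP₁ cP₂ hne hq' cq' hqc hqd]
  rw [norm_mul, norm_mul, Complex.norm_I, one_mul, one_mul]
  have hfin : ∀ y ∈ Set.uIoc c d, ‖Complex.exp (Complex.I * P y) *
      (q' y * ((P₁ y)⁻¹ : ℝ) + q y * ((-P₂ y / P₁ y ^ 2 : ℝ) : ℂ))‖ ≤
      8 * D ^ 2 * B / (m * r) ^ 2 := by
    intro y hy
    rw [Set.uIoc_of_le hcd] at hy
    have hy' : y ∈ Set.Icc c d := ⟨hy.1.le, hy.2⟩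
    rw [norm_mul, mul_comm Complex.I, Complex.norm_exp_ofReal_mul_I, one_mul]
    refine (norm_add_le _ _).trans ?_
    rw [norm_mul, norm_mul, Complex.norm_real, Complex.norm_real, Real.norm_eq_abs,
      Real.norm_eq_abs]
    calc ‖q' y‖ * |(P₁ y)⁻¹| + ‖q y‖ * |-P₂ y / P₁ y ^ 2|
        ≤ C / r ^ 2 * (D / m) + C / r * (D / m / r) := by
          gcongr
          · exact bq' y hy'
          · exact hq0 y hy'
          · exact bq y hy'
          · exact hq1 y hy'
      _ = 8 * D ^ 2 * B / (m * r) ^ 2 := by rw [hC]; field_simp; ring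
  refine (intervalIntegral.norm_integral_le_of_norm_le_const hfin).trans (le_of_eq ?_)
  rw [abs_of_nonneg (sub_nonneg.2 hcd)]
  ring

/-! ### Schur's test for `TT*` on `L²`. -/

theorem sq_integral_mul_le {α : Type*} [MeasurableSpace α] {ν : Measure α} {u v : α → ℝ}
    (hu0 : ∀ x, 0 ≤ u x) (hv0 : ∀ x, 0 ≤ v x) (hu : MemLp u 2 ν) (hv : MemLp v 2 ν) :
    (∫ x, u x * v x ∂ν) ^ 2 ≤ (∫ x, u x ^ 2 ∂ν) * ∫ x, v x ^ 2 ∂ν := by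
  have h := integral_mul_le_Lp_mul_Lq_of_nonneg (μ := ν) Real.HolderConjugate.two_two
    (Filter.Eventually.of_forall hu0) (Filter.Eventually.of_forall hv0) (by simpa using hu)
    (by simpa using hv)
  simp only [Real.rpow_two, ← Real.sqrt_eq_rpow] at h
  have h0 : 0 ≤ ∫ x, u x * v x ∂ν := integral_nonneg fun x => mul_nonneg (hu0 x) (hv0 x)
  have hU : 0 ≤ ∫ x, u x ^ 2 ∂ν := integral_nonneg fun x => sq_nonneg _
  have hV : 0 ≤ ∫ x, v x ^ 2 ∂ν := integral_nonneg fun x => sq_nonneg _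
  calc (∫ x, u x * v x ∂ν) ^ 2 ≤ (√(∫ x, u x ^ 2 ∂ν) * √(∫ x, v x ^ 2 ∂ν)) ^ 2 := by gcongr
    _ = _ := by rw [mul_pow, Real.sq_sqrt hU, Real.sq_sqrt hV]

/-- Schur's test for the kernel of `T T*`. -/
theorem integral_norm_sq_le_of_schur {μ ν : Measure ℝ} [IsFiniteMeasure μ] [IsFiniteMeasure ν]
    {k : ℝ → ℝ → ℂ} {B W : ℝ} (hk : Measurable (Function.uncurry k)) (hB : ∀ x y, ‖k x y‖ ≤ B)
    (hW : ∀ x, ∫ x', ‖∫ y, k x y * (starRingEnd ℂ) (k x' y) ∂ν‖ ∂μ ≤ W)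
    {f : ℝ → ℂ} (hf : MemLp f 2 ν) :
    MemLp (fun x => ∫ y, k x y * f y ∂ν) 2 μ ∧
      ∫ x, ‖∫ y, k x y * f y ∂ν‖ ^ 2 ∂μ ≤ W * ∫ y, ‖f y‖ ^ 2 ∂ν := by
  have hB0 : 0 ≤ B := (norm_nonneg _).trans (hB 0 0)
  have hfi : Integrable f ν := hf.integrable (by norm_num)
  set g : ℝ → ℂ := fun x => ∫ y, k x y * f y ∂ν with hgdef
  have hkx : ∀ x, Measurable (k x) := fun x => hk.comp measurable_prodMk_left
  have hbound : ∀ (ρ : Measure ℝ) (u v : ℝ → ℂ), Integrable v ρ → (∀ x, ‖u x‖ ≤ B) →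
      ‖∫ x, u x * v x ∂ρ‖ ≤ B * ∫ x, ‖v x‖ ∂ρ := by
    intro ρ u v hv hu
    rw [← integral_const_mul]
    refine norm_integral_le_of_norm_le (hv.norm.const_mul B) (Filter.Eventually.of_forall ?_)
    intro x
    rw [norm_mul]
    exact mul_le_mul_of_nonneg_right (hu x) (norm_nonneg _)
  have hgm : AEStronglyMeasurable g μ :=
    (hk.aestronglyMeasurable.mul (hf.1.comp_snd (μ := μ))).integral_prod_right'
  have hg2 : MemLp g 2 μ :=
    MemLp.of_bound hgm (B * ∫ y, ‖f y‖ ∂ν)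
      (Filter.Eventually.of_forall fun x => hbound ν (k x) f hfi (hB x))
  have hgi : Integrable g μ := hg2.integrable (by norm_num)
  have hgc : Integrable (fun x => (starRingEnd ℂ) (g x)) μ := by
    refine (hgi.norm).mono' (Complex.continuous_conj.comp_aestronglyMeasurable hgm) ?_
    exact Filter.Eventually.of_forall fun x => by simp
  -- With `g = Tf`, this `h` is the complex conjugate of `T*g`.
  set h : ℝ → ℂ := fun y => ∫ x, k x y * (starRingEnd ℂ) (g x) ∂μ with hhdef
  have hhm : AEStronglyMeasurable h ν := by
    have : Measurable (Function.uncurry fun y x => k x y) := hk.comp measurable_swap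
    exact (this.aestronglyMeasurable.mul (hgc.1.comp_snd (μ := ν))).integral_prod_right'
  have hh2 : MemLp h 2 ν :=
    MemLp.of_bound hhm (B * ∫ x, ‖(starRingEnd ℂ) (g x)‖ ∂μ)
      (Filter.Eventually.of_forall fun y => hbound μ (fun x => k x y) _ hgc fun x => hB x y)
  have hhi : Integrable h ν := hh2.integrable (by norm_num)
  have hhc : Integrable (fun x => (starRingEnd ℂ) (h x)) ν := by
    refine (hhi.norm).mono' (Complex.continuous_conj.comp_aestronglyMeasurable hhm) ?_
    exact Filter.Eventually.of_forall fun x => by simp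
  have swap : ∀ (u v : ℝ → ℂ), Integrable u μ → Integrable v ν →
      ∫ x, u x * ∫ y, k x y * v y ∂ν ∂μ = ∫ y, v y * ∫ x, k x y * u x ∂μ ∂ν := by
    intro u v hu hv
    have hint : Integrable (Function.uncurry fun x y => k x y * (u x * v y)) (μ.prod ν) :=
      (hu.mul_prod hv).bdd_mul hk.aestronglyMeasurable
        (Filter.Eventually.of_forall fun p => hB p.1 p.2)
    have := integral_integral_swap hint
    simp only [← integral_const_mul]
    refine Eq.trans ?_ (this.trans ?_)
    · exact integral_congr_ae (Filter.Eventually.of_forall fun x =>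
        integral_congr_ae (Filter.Eventually.of_forall fun y => by simp only []; ring))
    · exact integral_congr_ae (Filter.Eventually.of_forall fun x =>
        integral_congr_ae (Filter.Eventually.of_forall fun y => by simp only []; ring))
  -- The kernel of `TT*` is Hermitian, so the one-sided Schur bound `hW` also gives the bound in the
  -- other variable.
  have hLsymm : ∀ x x', ‖∫ y, k x y * (starRingEnd ℂ) (k x' y) ∂ν‖ =
      ‖∫ y, k x' y * (starRingEnd ℂ) (k x y) ∂ν‖ := by
    intro x x'
    rw [← RCLike.norm_conj, ← integral_conj]
    congr 1
    refine integral_congr_ae (Filter.Eventually.of_forall fun y => ?_)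
    simp only [map_mul, Complex.conj_conj]
    ring
  set L : ℝ → ℝ → ℂ := fun x x' => ∫ y, k x y * (starRingEnd ℂ) (k x' y) ∂ν with hLdef
  have hLm : StronglyMeasurable (Function.uncurry L) := by
    have : StronglyMeasurable (Function.uncurry fun (p : ℝ × ℝ) (y : ℝ) =>
        k p.1 y * (starRingEnd ℂ) (k p.2 y)) := by
      refine Measurable.stronglyMeasurable ?_
      refine Measurable.mul (hk.comp (by fun_prop : Measurable fun q : (ℝ × ℝ) × ℝ => (q.1.1, q.2)))
        (Complex.continuous_conj.measurable.comp
          (hk.comp (by fun_prop : Measurable fun q : (ℝ × ℝ) × ℝ => (q.1.2, q.2))))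
    exact this.integral_prod_right
  have hLB : ∀ x x', ‖L x x'‖ ≤ B * (B * ν.real Set.univ) := by
    intro x x'
    have hki : Integrable (fun y => (starRingEnd ℂ) (k x' y)) ν :=
      Integrable.of_bound (Complex.continuous_conj.measurable.comp (hkx x')).aestronglyMeasurable B
        (Filter.Eventually.of_forall fun y => by simpa using hB x' y)
    refine (hbound ν (k x) _ hki (hB x)).trans ?_
    refine mul_le_mul_of_nonneg_left ?_ hB0
    calc ∫ y, ‖(starRingEnd ℂ) (k x' y)‖ ∂ν ≤ ∫ _, B ∂ν :=
          integral_mono hki.norm (integrable_const B) fun y => by simpa using hB x' y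
      _ = B * ν.real Set.univ := by rw [integral_const, smul_eq_mul, mul_comm]
  -- the three estimates
  have hG : (∫ x, ‖g x‖ ^ 2 ∂μ : ℝ) ≤ ∫ y, ‖f y‖ * ‖h y‖ ∂ν := by
    have e : ((∫ x, ‖g x‖ ^ 2 ∂μ : ℝ) : ℂ) = ∫ y, f y * h y ∂ν := by
      rw [← swap _ f hgc hfi, ← integral_complex_ofReal]
      refine integral_congr_ae (Filter.Eventually.of_forall fun x => ?_)
      simp only []
      change _ = (starRingEnd ℂ) (g x) * g x
      rw [Complex.conj_mul']
      push_cast; rfl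
    have h0 : 0 ≤ ∫ x, ‖g x‖ ^ 2 ∂μ := integral_nonneg fun x => sq_nonneg _
    calc ∫ x, ‖g x‖ ^ 2 ∂μ = ‖((∫ x, ‖g x‖ ^ 2 ∂μ : ℝ) : ℂ)‖ := by
          rw [Complex.norm_real, Real.norm_of_nonneg h0]
      _ ≤ ∫ y, ‖f y * h y‖ ∂ν := by rw [e]; exact norm_integral_le_integral_norm _
      _ = _ := by simp only [norm_mul]
  -- `‖T*g‖² = ⟨TT*g, g⟩`, and `|g(x) g(x')| ≤ (|g(x)|² + |g(x')|²)/2` splits the double integral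
  -- into two halves, each at most `W‖g‖²/2`.
  have hH : ∫ y, ‖h y‖ ^ 2 ∂ν ≤ W * ∫ x, ‖g x‖ ^ 2 ∂μ := by
    have e1 : ∀ x, ∫ y, k x y * (starRingEnd ℂ) (h y) ∂ν = ∫ x', g x' * L x x' ∂μ := by
      intro x
      have hint : Integrable (Function.uncurry fun y x' =>
          (starRingEnd ℂ) (k x' y) * (k x y * g x')) (ν.prod μ) := by
        refine Integrable.bdd_mul (c := B) ?_ ?_ ?_
        · refine Integrable.mul_prod ?_ hgi
          exact Integrable.of_bound (hkx x).aestronglyMeasurable B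
            (Filter.Eventually.of_forall (hB x))
        · exact (Complex.continuous_conj.measurable.comp
            (hk.comp measurable_swap)).aestronglyMeasurable
        · exact Filter.Eventually.of_forall fun p => by simpa using hB p.2 p.1
      have := integral_integral_swap hint
      simp only [hLdef, ← integral_const_mul]
      refine Eq.trans ?_ (this.trans ?_)
      · refine integral_congr_ae (Filter.Eventually.of_forall fun y => ?_)
        simp only [hhdef]
        rw [← integral_conj, ← integral_const_mul]
        refine integral_congr_ae (Filter.Eventually.of_forall fun x' => ?_)
        simp only [map_mul, Complex.conj_conj]
        ring
      · exact integral_congr_ae (Filter.Eventually.of_forall fun x' =>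
          integral_congr_ae (Filter.Eventually.of_forall fun y => by simp only []; ring))
    have e : ((∫ y, ‖h y‖ ^ 2 ∂ν : ℝ) : ℂ) =
        ∫ x, (starRingEnd ℂ) (g x) * ∫ x', g x' * L x x' ∂μ ∂μ := by
      have := swap _ _ hgc hhc
      simp only [e1] at this
      rw [this, ← integral_complex_ofReal]
      refine integral_congr_ae (Filter.Eventually.of_forall fun y => ?_)
      simp only []
      change _ = (starRingEnd ℂ) (h y) * h y
      rw [Complex.conj_mul']
      push_cast; rfl
    have hg2i : Integrable (fun x => ‖g x‖ ^ 2) μ := hg2.integrable_norm_pow (by norm_num)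
    have hLi : ∀ x, Integrable (fun x' => L x x') μ := fun x =>
      Integrable.of_bound (hLm.comp_measurable measurable_prodMk_left).aestronglyMeasurable _
        (Filter.Eventually.of_forall (hLB x))
    have hI1 : Integrable (Function.uncurry fun x x' => ‖L x x'‖ * (‖g x‖ ^ 2 / 2)) (μ.prod μ) := by
      refine Integrable.bdd_mul (c := B * (B * ν.real Set.univ)) ?_
        hLm.norm.aestronglyMeasurable ?_
      · exact (hg2i.div_const 2).comp_fst μ
      · exact Filter.Eventually.of_forall fun p => by simpa using hLB p.1 p.2
    have hI2 : Integrable (Function.uncurry fun x x' => ‖L x x'‖ * (‖g x'‖ ^ 2 / 2))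
        (μ.prod μ) := by
      refine Integrable.bdd_mul (c := B * (B * ν.real Set.univ)) ?_
        hLm.norm.aestronglyMeasurable ?_
      · exact (hg2i.div_const 2).comp_snd μ
      · exact Filter.Eventually.of_forall fun p => by simpa using hLB p.1 p.2
    have h0 : 0 ≤ ∫ y, ‖h y‖ ^ 2 ∂ν := integral_nonneg fun x => sq_nonneg _
    have hhalf : ∫ x, ∫ x', ‖L x x'‖ * (‖g x‖ ^ 2 / 2) ∂μ ∂μ ≤ W * (∫ x, ‖g x‖ ^ 2 ∂μ) / 2 := by
      rw [mul_div_assoc, ← integral_div, ← integral_const_mul]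
      refine integral_mono hI1.integral_prod_left ((hg2i.div_const 2).const_mul W) fun x => ?_
      simp only [integral_mul_const]
      exact mul_le_mul_of_nonneg_right (hW x) (by positivity)
    have hhalf' : ∫ x, ∫ x', ‖L x x'‖ * (‖g x'‖ ^ 2 / 2) ∂μ ∂μ ≤
        W * (∫ x, ‖g x‖ ^ 2 ∂μ) / 2 := by
      rw [integral_integral_swap hI2]
      refine le_trans (le_of_eq ?_) hhalf
      refine integral_congr_ae (Filter.Eventually.of_forall fun x => ?_)
      refine integral_congr_ae (Filter.Eventually.of_forall fun x' => ?_)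
      simp only []
      rw [show ‖L x' x‖ = ‖L x x'‖ from hLsymm x' x]
    calc ∫ y, ‖h y‖ ^ 2 ∂ν = ‖((∫ y, ‖h y‖ ^ 2 ∂ν : ℝ) : ℂ)‖ := by
          rw [Complex.norm_real, Real.norm_of_nonneg h0]
      _ ≤ ∫ x, ∫ x', (‖L x x'‖ * (‖g x‖ ^ 2 / 2) + ‖L x x'‖ * (‖g x'‖ ^ 2 / 2)) ∂μ ∂μ := by
          rw [e]
          refine norm_integral_le_of_norm_le (hI1.add hI2).integral_prod_left
            (Filter.Eventually.of_forall fun x => ?_)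
          rw [← integral_const_mul]
          have hA : Integrable (fun x' => ‖L x x'‖ * (‖g x‖ ^ 2 / 2)) μ :=
            (hLi x).norm.mul_const _
          have hA' : Integrable (fun x' => ‖L x x'‖ * (‖g x'‖ ^ 2 / 2)) μ :=
            (hg2i.div_const 2).bdd_mul (hLi x).norm.1
              (Filter.Eventually.of_forall fun x' => by simpa using hLB x x')
          refine norm_integral_le_of_norm_le (hA.add hA')
            (Filter.Eventually.of_forall fun x' => ?_)
          simp only [norm_mul, RCLike.norm_conj]
          nlinarith [mul_nonneg (norm_nonneg (L x x')) (sq_nonneg (‖g x‖ - ‖g x'‖))]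
      _ = (∫ x, ∫ x', ‖L x x'‖ * (‖g x‖ ^ 2 / 2) ∂μ ∂μ) +
          ∫ x, ∫ x', ‖L x x'‖ * (‖g x'‖ ^ 2 / 2) ∂μ ∂μ := integral_integral_add hI1 hI2
      _ ≤ W * ∫ x, ‖g x‖ ^ 2 ∂μ := by linarith
  refine ⟨hg2, ?_⟩
  have hCS := sq_integral_mul_le (fun y => norm_nonneg (f y)) (fun y => norm_nonneg (h y))
    hf.norm hh2.norm
  set G := ∫ x, ‖g x‖ ^ 2 ∂μ
  have hG0 : 0 ≤ G := integral_nonneg fun x => sq_nonneg _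
  have hF0 : 0 ≤ ∫ y, ‖f y‖ ^ 2 ∂ν := integral_nonneg fun x => sq_nonneg _
  have hW0 : 0 ≤ W := (integral_nonneg fun x => norm_nonneg _).trans (hW 0)
  -- Duality and Cauchy–Schwarz give `G² ≤ ‖f‖² · W G`; it remains to cancel `G`, unless it
  -- vanishes.
  rcases hG0.eq_or_lt with h0 | h0
  · rw [← h0]; positivity
  · have : G ^ 2 ≤ (∫ y, ‖f y‖ ^ 2 ∂ν) * (W * G) :=
      (pow_le_pow_left₀ hG0 hG 2).trans (hCS.trans (mul_le_mul_of_nonneg_left hH hF0))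
    nlinarith

theorem MeasureTheory.MemLp.eLpNorm_two_le {μ ν : Measure ℝ} {f g : ℝ → ℂ} (hf : MemLp f 2 ν)
    (hg : MemLp g 2 μ) {W : ℝ} (hW : 0 ≤ W) (h : ∫ x, ‖g x‖ ^ 2 ∂μ ≤ W * ∫ y, ‖f y‖ ^ 2 ∂ν) :
    eLpNorm g 2 μ ≤ ENNReal.ofReal (√W) * eLpNorm f 2 ν := by
  rw [hg.eLpNorm_eq_integral_rpow_norm (by norm_num) (by norm_num),
    hf.eLpNorm_eq_integral_rpow_norm (by norm_num) (by norm_num),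
    ← ENNReal.ofReal_mul (Real.sqrt_nonneg _)]
  refine ENNReal.ofReal_le_ofReal ?_
  simp only [ENNReal.toReal_ofNat, Real.rpow_two]
  rw [Real.sqrt_eq_rpow, ← one_div, ← Real.mul_rpow hW (integral_nonneg fun x => sq_nonneg _)]
  exact Real.rpow_le_rpow (integral_nonneg fun x => sq_nonneg _) h (by norm_num)

/-! ### The phase and its mixed Hessian as explicit forms. -/

noncomputable section

/-- The `i`-th `y`-derivative of `∑_{l ≤ N} b_l x^{N-l} y^l`. -/
def formDeriv (N : ℕ) (b : ℕ → ℝ) (i : ℕ) (x y : ℝ) : ℝ :=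
  ∑ l ∈ Finset.range (N + 1), b l * (l.descFactorial i : ℝ) * x ^ (N - l) * y ^ (l - i)

/-- The coefficients of the mixed Hessian of `phase (N + 2) a`. -/
def hessCoeff (N : ℕ) (a : ℕ → ℝ) (l : ℕ) : ℝ := a (l + 1) * (l + 1 : ℕ) * (N + 1 - l : ℕ)

/-- The `i`-th `y`-derivative of `phase (N + 2) a`. -/
def phaseDeriv (N : ℕ) (a : ℕ → ℝ) (i : ℕ) (x y : ℝ) : ℝ :=
  ∑ l ∈ Finset.range (N + 1),
    a (l + 1) * ((l + 1).descFactorial i : ℝ) * x ^ (N + 1 - l) * y ^ (l + 1 - i)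

end

theorem phase_eq_phaseDeriv (N : ℕ) (a : ℕ → ℝ) (x y : ℝ) :
    phase (N + 2) a x y = phaseDeriv N a 0 x y := by
  unfold phase phaseDeriv
  rw [show N + 2 - 1 = N + 1 from rfl, ← Finset.Ico_add_one_right_eq_Icc,
    Finset.sum_Ico_eq_sum_range]
  refine Finset.sum_congr (by simp) fun l hl => ?_
  rw [add_comm 1 l, Nat.descFactorial_zero]
  have : N + 2 - (l + 1) = N + 1 - l := by omega
  rw [this]
  simp

theorem HasDerivAt.of_eq {f g : ℝ → ℝ} {f' g' x : ℝ} (h : HasDerivAt f f' x)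
    (hfg : ∀ y, g y = f y) (h' : g' = f') : HasDerivAt g g' x := by
  rw [h', funext hfg]
  exact h

/-- The descending factorial vanishes for `i > l`, so the truncated exponent `l - i` is harmless and
no case distinction is needed. -/
theorem hasDerivAt_descFactorial_mul_pow (l i : ℕ) (y : ℝ) :
    HasDerivAt (fun y : ℝ => (l.descFactorial i : ℝ) * y ^ (l - i))
      ((l.descFactorial (i + 1) : ℝ) * y ^ (l - (i + 1))) y := by
  have h := (hasDerivAt_pow (l - i) y).const_mul (l.descFactorial i : ℝ)
  rw [Nat.descFactorial_succ, Nat.sub_add_eq]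
  refine h.of_eq (fun _ => rfl) ?_
  push_cast
  ring

theorem hasDerivAt_formDeriv (N : ℕ) (b : ℕ → ℝ) (i : ℕ) (x y : ℝ) :
    HasDerivAt (formDeriv N b i x) (formDeriv N b (i + 1) x y) y := by
  unfold formDeriv
  refine HasDerivAt.fun_sum fun l _ => ?_
  have h := (hasDerivAt_descFactorial_mul_pow l i y).const_mul (b l * x ^ (N - l))
  exact h.of_eq (fun y => by ring) (by ring)

theorem hasDerivAt_phaseDeriv (N : ℕ) (a : ℕ → ℝ) (i : ℕ) (x y : ℝ) :
    HasDerivAt (phaseDeriv N a i x) (phaseDeriv N a (i + 1) x y) y := by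
  unfold phaseDeriv
  refine HasDerivAt.fun_sum fun l _ => ?_
  have h := (hasDerivAt_descFactorial_mul_pow (l + 1) i y).const_mul (a (l + 1) * x ^ (N + 1 - l))
  exact h.of_eq (fun y => by ring) (by ring)

/-- This identity `∂_x ∂_y^{i+1} S = ∂_y^i S''_{xy}` lets the mean value theorem turn differences of
phase derivatives at `x` and `x'` into values of the Hessian and its `y`-derivatives. -/
theorem hasDerivAt_phaseDeriv_left (N : ℕ) (a : ℕ → ℝ) (i : ℕ) (x y : ℝ) :
    HasDerivAt (fun u => phaseDeriv N a (i + 1) u y) (formDeriv N (hessCoeff N a) i x y) x := by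
  unfold phaseDeriv formDeriv hessCoeff
  refine HasDerivAt.fun_sum fun l _ => ?_
  have h := (hasDerivAt_pow (N + 1 - l) x).const_mul
    (a (l + 1) * ((l + 1).descFactorial (i + 1) : ℝ) * y ^ (l + 1 - (i + 1)))
  refine h.of_eq (fun y => by ring) ?_
  · rw [Nat.succ_descFactorial_succ, show N + 1 - l - 1 = N - l by omega,
      show l + 1 - (i + 1) = l - i by omega]
    push_cast
    ring

theorem mixedHessian_phase (N : ℕ) (a : ℕ → ℝ) (x y : ℝ) :
    mixedHessian (phase (N + 2) a) x y = formDeriv N (hessCoeff N a) 0 x y := by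
  have h1 : ∀ v, deriv (fun u => phase (N + 2) a u v) x = ∑ l ∈ Finset.range (N + 1),
      a (l + 1) * ((N + 1 - l : ℕ) * x ^ (N - l)) * v ^ (l + 1) := by
    intro v
    simp only [phase_eq_phaseDeriv, phaseDeriv]
    refine HasDerivAt.deriv (HasDerivAt.fun_sum fun l _ => ?_)
    have h := (hasDerivAt_pow (N + 1 - l) x).const_mul (a (l + 1) * v ^ (l + 1))
    refine h.of_eq (fun y => by simp; ring) ?_
    · rw [show N + 1 - l - 1 = N - l by omega]
      ring
  unfold mixedHessian
  simp only [h1]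
  refine HasDerivAt.deriv (HasDerivAt.fun_sum fun l _ => ?_)
  have h := (hasDerivAt_pow (l + 1) y).const_mul (a (l + 1) * ((N + 1 - l : ℕ) * x ^ (N - l)))
  refine h.of_eq (fun _ => rfl) ?_
  unfold hessCoeff
  simp only [Nat.descFactorial_zero, Nat.sub_zero, Nat.add_sub_cancel]
  push_cast
  ring

theorem formDeriv_zero_right (N : ℕ) (b : ℕ → ℝ) (x : ℝ) :
    formDeriv N b 0 x 0 = b 0 * x ^ N := by
  unfold formDeriv
  rw [Finset.sum_range_succ']
  simp

/-- Exchanging the variables reverses the coefficients; facts about the sector at one axis are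
thereby carried over to the other. -/
theorem formDeriv_reflect (N : ℕ) (b : ℕ → ℝ) (x y : ℝ) :
    formDeriv N b 0 x y = formDeriv N (fun l => b (N - l)) 0 y x := by
  unfold formDeriv
  rw [← Finset.sum_range_reflect]
  refine Finset.sum_congr rfl fun l hl => ?_
  have hl' : l ≤ N := by simpa [Nat.lt_succ_iff] using hl
  rw [show N + 1 - 1 - l = N - l by omega, show N - (N - l) = l by omega]
  simp
  ring

theorem formDeriv_zero_left (N : ℕ) (b : ℕ → ℝ) (y : ℝ) :
    formDeriv N b 0 0 y = b N * y ^ N := by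
  rw [formDeriv_reflect, formDeriv_zero_right]
  simp

/-! ### Coefficient bounds and the existence of admissible constants. -/

/-- Bounds for a form in terms of its coefficients. -/
theorem abs_formDeriv_le {N : ℕ} {b : ℕ → ℝ} {D ρ x y : ℝ} (hD : 0 ≤ D) (hb : ∀ l ≤ N, |b l| ≤ D)
    (hx : |x| ≤ ρ) (hy : |y| ≤ ρ) (i : ℕ) :
    |formDeriv N b i x y| * ρ ^ i ≤ (N + 1 : ℝ) ^ (i + 1) * D * ρ ^ N := by
  have hρ : 0 ≤ ρ := (abs_nonneg x).trans hx
  have hterm : ∀ l ∈ Finset.range (N + 1),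
      |b l * (l.descFactorial i : ℝ) * x ^ (N - l) * y ^ (l - i)| * ρ ^ i ≤
        (N + 1 : ℝ) ^ i * D * ρ ^ N := by
    intro l hl
    have hl' : l ≤ N := by simpa [Nat.lt_succ_iff] using hl
    by_cases hil : i ≤ l
    · have hdf : (l.descFactorial i : ℝ) ≤ (N + 1 : ℝ) ^ i := by
        have h1 : l.descFactorial i ≤ (N + 1) ^ i :=
          (Nat.descFactorial_le_pow l i).trans (Nat.pow_le_pow_left (by omega) i)
        exact_mod_cast h1
      rw [abs_mul, abs_mul, abs_mul, abs_pow, abs_pow, Nat.abs_cast]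
      calc |b l| * (l.descFactorial i : ℝ) * |x| ^ (N - l) * |y| ^ (l - i) * ρ ^ i
          ≤ D * (N + 1 : ℝ) ^ i * ρ ^ (N - l) * ρ ^ (l - i) * ρ ^ i := by
            gcongr
            exact hb l hl'
        _ = (N + 1 : ℝ) ^ i * D * (ρ ^ (N - l) * ρ ^ (l - i) * ρ ^ i) := by ring
        _ = _ := by rw [← pow_add, ← pow_add, show N - l + (l - i) + i = N by omega]
    · rw [Nat.descFactorial_of_lt (by omega)]
      simp
      positivity
  calc |formDeriv N b i x y| * ρ ^ i
      ≤ (∑ l ∈ Finset.range (N + 1),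
          |b l * (l.descFactorial i : ℝ) * x ^ (N - l) * y ^ (l - i)|) * ρ ^ i := by
        gcongr
        exact Finset.abs_sum_le_sum_abs _ _
    _ ≤ ∑ l ∈ Finset.range (N + 1), (N + 1 : ℝ) ^ i * D * ρ ^ N := by
        rw [Finset.sum_mul]
        exact Finset.sum_le_sum hterm
    _ = _ := by
        rw [Finset.sum_const, Finset.card_range, nsmul_eq_mul]
        push_cast
        ring

/-- On a thin sector a form is close to its pure power. -/
theorem abs_formDeriv_sub_le {N : ℕ} {b : ℕ → ℝ} {D τ x y : ℝ} (hD : 0 ≤ D)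
    (hb : ∀ l ≤ N, |b l| ≤ D) (hx : 0 < x) (hτ : τ ≤ 1) (hy : |y| ≤ τ * x) :
    |formDeriv N b 0 x y - formDeriv N b 0 x 0| ≤ N * D * τ * x ^ N := by
  rw [formDeriv_zero_right]
  have hτ0 : 0 ≤ τ := by
    by_contra h
    have := (abs_nonneg y).trans hy
    nlinarith
  unfold formDeriv
  -- Split off the term `l = 0`, which is the pure power. Each of the `N` others contains a factor
  -- `y`, hence a factor `τ`.
  rw [Finset.sum_range_succ']
  simp only [Nat.descFactorial_zero, Nat.cast_one, mul_one, Nat.sub_zero, pow_zero,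
    add_sub_cancel_right]
  refine (Finset.abs_sum_le_sum_abs _ _).trans ?_
  calc ∑ l ∈ Finset.range N, |b (l + 1) * x ^ (N - (l + 1)) * y ^ (l + 1)|
      ≤ ∑ _l ∈ Finset.range N, D * τ * x ^ N := by
        refine Finset.sum_le_sum fun l hl => ?_
        have hl' : l + 1 ≤ N := by simpa using hl
        rw [abs_mul, abs_mul, abs_pow, abs_pow, abs_of_pos hx]
        calc |b (l + 1)| * x ^ (N - (l + 1)) * |y| ^ (l + 1)
            ≤ D * x ^ (N - (l + 1)) * (τ * x) ^ (l + 1) := by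
              gcongr
              exact hb _ hl'
          _ = D * τ ^ (l + 1) * (x ^ (N - (l + 1)) * x ^ (l + 1)) := by rw [mul_pow]; ring
          _ = D * τ ^ (l + 1) * x ^ N := by rw [← pow_add, show N - (l + 1) + (l + 1) = N by omega]
          _ ≤ D * τ * x ^ N := by
              gcongr
              exact pow_le_of_le_one hτ0 hτ (by omega)
    _ = _ := by rw [Finset.sum_const, Finset.card_range, nsmul_eq_mul]; ring

/-- The coefficients of a polynomial are controlled by its supremum on an interval. -/
theorem exists_coeff_bound (N : ℕ) {δ : ℝ} (hδ : 0 < δ) :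
    ∃ C : ℝ, 1 ≤ C ∧ ∀ (b : ℕ → ℝ) (M : ℝ),
      (∀ t, 0 ≤ t → t ≤ δ → |∑ l ∈ Finset.range (N + 1), b l * t ^ l| ≤ M) →
        ∀ l ≤ N, |b l| ≤ C * M := by
  -- Evaluation at `N + 1` distinct points of `[0, δ]` is an injective linear map in finite
  -- dimension, hence bounded below. The constant depends only on `N` and `δ`, which is the source
  -- of the uniformity in the phase.
  let v : Fin (N + 1) → ℝ := fun i => δ * (i : ℕ) / (N + 1)
  have hvinj : Function.Injective v := by
    intro i j hij
    simp only [v] at hij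
    have hN : (N + 1 : ℝ) ≠ 0 := by positivity
    have h1 : δ * ((i : ℕ) : ℝ) = δ * ((j : ℕ) : ℝ) := by
      field_simp at hij
      rw [hij]
    exact Fin.ext (by exact_mod_cast mul_left_cancel₀ hδ.ne' h1)
  let T : (Fin (N + 1) → ℝ) →ₗ[ℝ] (Fin (N + 1) → ℝ) := (Matrix.vandermonde v).mulVecLin
  have hT : LinearMap.ker T = ⊥ := by
    rw [LinearMap.ker_eq_bot']
    intro w hw
    exact Matrix.eq_zero_of_mulVec_eq_zero (Matrix.det_vandermonde_ne_zero_iff.2 hvinj) hw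
  obtain ⟨C, -, hC⟩ := T.exists_antilipschitzWith hT
  refine ⟨max C 1, le_max_right _ _, fun b M hM l hl => ?_⟩
  have hM0 : 0 ≤ M := (abs_nonneg _).trans (hM 0 le_rfl hδ.le)
  have h1 := hC.le_mul_dist (fun i : Fin (N + 1) => b i) 0
  rw [map_zero, dist_zero_right, dist_zero_right] at h1
  have h2 : ‖T fun i : Fin (N + 1) => b i‖ ≤ M := by
    rw [pi_norm_le_iff_of_nonneg hM0]
    intro i
    have e : T (fun i : Fin (N + 1) => b i) i = ∑ l ∈ Finset.range (N + 1), b l * v i ^ l := by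
      simp only [T, Matrix.mulVecLin_apply, Matrix.mulVec, dotProduct, Matrix.vandermonde_apply]
      rw [Finset.sum_range]
      exact Finset.sum_congr rfl fun _ _ => mul_comm _ _
    rw [e, Real.norm_eq_abs]
    refine hM _ (by positivity) ?_
    simp only [v]
    rw [div_le_iff₀ (by positivity)]
    have : ((i : ℕ) : ℝ) ≤ N + 1 := by exact_mod_cast i.2.le
    gcongr
  calc |b l| = ‖(fun i : Fin (N + 1) => b i) ⟨l, by omega⟩‖ := rfl
    _ ≤ ‖fun i : Fin (N + 1) => b i‖ := norm_le_pi_norm (fun i : Fin (N + 1) => b i) _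
    _ ≤ C * M := h1.trans (by gcongr)
    _ ≤ max C 1 * M := by gcongr; exact le_max_left _ _

/-- The extreme coefficients are the values at `(1,0)` and `(0,1)`. No linear factor vanishes there,
since `α_l ≠ 0` handles the first point, and the quadratic factors vanish only at the origin.
Nothing else about the factorization enters the proof. -/
theorem DampedOsc.HasHessianForm.coeff_ne_zero {N : ℕ} {b : ℕ → ℝ} (h : HasHessianForm
    (formDeriv N b 0)) :
    b 0 ≠ 0 ∧ b N ≠ 0 := by
  obtain ⟨c, s, r, α, m, p, q, w, hc, -, hα, -, hQ, hH⟩ := h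
  have h1 := hH 1 0
  have h2 := hH 0 1
  rw [formDeriv_zero_right, one_pow, mul_one] at h1
  rw [formDeriv_zero_left, one_pow, mul_one] at h2
  rw [h1, h2]
  constructor
  · refine mul_ne_zero (mul_ne_zero hc (Finset.prod_ne_zero_iff.2 fun l _ => pow_ne_zero _ ?_))
      (Finset.prod_ne_zero_iff.2 fun l _ => (hQ l 1 0 (by simp)).ne')
    simpa using hα l
  · refine mul_ne_zero (mul_ne_zero hc (Finset.prod_ne_zero_iff.2 fun l _ => pow_ne_zero _ ?_))
      (Finset.prod_ne_zero_iff.2 fun l _ => (hQ l 0 1 (by simp)).ne')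
    simp

/-- On a sector of slope `τ = 2^{2-κ}` the form deviates from its pure power by at most `N D τ`
times that power of the variable, and `τ → 0` as `κ → ∞`. -/
theorem exists_isDominating {N : ℕ} {b : ℕ → ℝ} (h0 : b 0 ≠ 0) (hN : b N ≠ 0) :
    ∃ κ₀ : ℝ, ∀ κ : ℝ, κ₀ ≤ κ → IsDominating (formDeriv N b 0) κ := by
  set D := ∑ l ∈ Finset.range (N + 1), |b l| with hD
  have hD0 : 0 ≤ D := Finset.sum_nonneg fun l _ => abs_nonneg _
  have hbD : ∀ l ≤ N, |b l| ≤ D := fun l hl =>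
    Finset.single_le_sum (f := fun l => |b l|) (fun l _ => abs_nonneg _) (by simp; omega)
  have hlim : Filter.Tendsto (fun κ : ℝ => (2 : ℝ) ^ (2 - κ)) Filter.atTop (nhds 0) := by
    have h1 : Filter.Tendsto (fun κ : ℝ => (2 : ℝ) ^ (-κ)) Filter.atTop (nhds 0) := by
      have := tendsto_rpow_atBot_of_base_gt_one 2 (by norm_num)
      exact this.comp Filter.tendsto_neg_atTop_atBot
    have h2 := h1.const_mul ((2 : ℝ) ^ (2 : ℝ))
    rw [mul_zero] at h2
    refine h2.congr fun κ => ?_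
    rw [sub_eq_add_neg, Real.rpow_add (by norm_num)]
  -- Chosen so that `N D ε` is at most half of the smaller extreme coefficient; the `+ 1` guards
  -- against a zero denominator.
  set ε := min 1 (min (|b 0|) (|b N|) / (2 * (N * D + 1))) with hε
  have hε0 : 0 < ε := lt_min one_pos
    (div_pos (lt_min (abs_pos.2 h0) (abs_pos.2 hN)) (by positivity))
  have hev := (hlim.eventually (gt_mem_nhds hε0)).and (Filter.eventually_gt_atTop (2 : ℝ))
  obtain ⟨κ₀, hκ⟩ := Filter.eventually_atTop.1 hev
  refine ⟨κ₀, fun κ h => ?_⟩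
  obtain ⟨h1, h2⟩ := hκ κ h
  set τ := (2 : ℝ) ^ (2 - κ) with hτ
  have hτ0 : 0 ≤ τ := by positivity
  have hτ1 : τ ≤ 1 := h1.le.trans (min_le_left _ _)
  have hτ2 : N * D * τ ≤ min (|b 0|) (|b N|) / 2 := by
    have h3 : τ ≤ min (|b 0|) (|b N|) / (2 * (N * D + 1)) := h1.le.trans (min_le_right _ _)
    rw [le_div_iff₀ (by positivity)] at h3
    nlinarith
  refine ⟨h2, fun x y hx hy hyx => ?_, fun x y hy hx hxy => ?_⟩
  · refine (abs_formDeriv_sub_le hD0 hbD hx hτ1 (by rwa [abs_of_nonneg hy])).trans ?_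
    rw [formDeriv_zero_right, abs_mul, abs_of_pos (pow_pos hx N), mul_div_right_comm]
    gcongr
    exact hτ2.trans (by gcongr; exact min_le_left _ _)
  · rw [formDeriv_reflect, formDeriv_reflect N b 0 y]
    refine (abs_formDeriv_sub_le hD0 (fun l _ => hbD _ (Nat.sub_le _ _)) hy hτ1
      (by rwa [abs_of_nonneg hx])).trans ?_
    rw [formDeriv_zero_right, abs_mul, abs_of_pos (pow_pos hy N), mul_div_right_comm, Nat.sub_zero]
    gcongr
    exact hτ2.trans (by gcongr; exact min_le_right _ _)

/-! ### Size of the Hessian on the two sectors, uniformly in the phase. -/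

/-- Two-sided control of the form and its first two `y`-derivatives on a rectangle at scale `r`. -/
def FormControlled (N : ℕ) (b : ℕ → ℝ) (I J : Set ℝ) (c C A r : ℝ) : Prop :=
  ∀ x ∈ I, ∀ y ∈ J, c * A ≤ |formDeriv N b 0 x y| ∧
    ∀ i ≤ 2, |formDeriv N b i x y| ≤ C * A / r ^ i

theorem abs_formDeriv_le_scale {N : ℕ} {b : ℕ → ℝ} {D A r x y : ℝ} (hr : 0 < r) (hD : 0 ≤ D)
    (hA : 0 ≤ A) (hb : ∀ l ≤ N, |b l| ≤ D * A)
    (hx : |x| ≤ 2 * r) (hy : |y| ≤ 2 * r) (i : ℕ) (hi : i ≤ 2) :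
    |formDeriv N b i x y| ≤ ((N + 1 : ℝ) ^ 3 * 2 ^ N * D) * (A * r ^ N) / r ^ i := by
  have h := abs_formDeriv_le (mul_nonneg hD hA) hb hx hy i
  rw [le_div_iff₀ (by positivity)]
  have hN1 : (1 : ℝ) ≤ N + 1 := by simp
  calc |formDeriv N b i x y| * r ^ i ≤ |formDeriv N b i x y| * (2 * r) ^ i := by
        gcongr; linarith
    _ ≤ (N + 1 : ℝ) ^ (i + 1) * (D * A) * (2 * r) ^ N := h
    _ ≤ (N + 1 : ℝ) ^ 3 * (D * A) * (2 * r) ^ N := by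
        gcongr
        omega
    _ = _ := by rw [mul_pow]; ring

/-- The sector near the `x`-axis, extended slightly to negative `y`. -/
theorem DampedOsc.IsDominating.exists_formControlled_right (N : ℕ) {κ : ℝ} (hκ : 2 < κ) :
    ∃ c C δ : ℝ, 0 < c ∧ 0 < C ∧ 0 < δ ∧ δ ≤ 1 ∧ ∀ b : ℕ → ℝ,
      IsDominating (formDeriv N b 0) κ → ∀ r : ℝ, 0 < r →
        FormControlled N b (Set.Icc (r / 2) (2 * r)) (Set.Icc (-δ * r) ((2 : ℝ) ^ (1 - κ) * r)) c C
          (|b 0| * r ^ N) r := by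
  obtain ⟨D, hD1, hD⟩ := exists_coeff_bound N (δ := (2 : ℝ) ^ (2 - κ)) (by positivity)
  have hD0 : 0 < D := by linarith
  -- The lower constant loses `1/2` to domination and `2⁻ᴺ` to `x ≥ r/2`. The width `δ` is such that
  -- the deviation `N · (3/2) D |b₀| · 2δ` on the negative side is at most `|b₀|/2`.
  refine ⟨(1 / 2) ^ (N + 1), (N + 1 : ℝ) ^ 3 * 2 ^ N * (D * (3 / 2)),
    1 / (6 * (N + 1) * D), by positivity, by positivity, by positivity, ?_, ?_⟩
  · rw [div_le_one (by positivity)]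
    have : (0 : ℝ) ≤ N := by positivity
    nlinarith
  intro b hb r hr
  set δ := 1 / (6 * (N + 1) * D) with hδ
  -- On the line `x = 1` domination gives `|H(1,t)| ≤ (3/2)|b₀|`, which bounds all coefficients by a
  -- multiple of `|b₀|`.
  have hbl : ∀ l ≤ N, |b l| ≤ D * (3 / 2) * |b 0| := by
    intro l hl
    rw [mul_assoc]
    refine hD b _ (fun t ht ht' => ?_) l hl
    have h1 := hb.2.1 1 t one_pos ht (by simpa using ht')
    rw [formDeriv_zero_right, one_pow, mul_one] at h1
    have e : formDeriv N b 0 1 t = ∑ l ∈ Finset.range (N + 1), b l * t ^ l := by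
      simp [formDeriv]
    rw [e] at h1
    have h2 := abs_sub_abs_le_abs_sub (∑ l ∈ Finset.range (N + 1), b l * t ^ l) (b 0)
    linarith
  have hκ1 : (2 : ℝ) ^ (1 - κ) ≤ 1 :=
      Real.rpow_le_one_of_one_le_of_nonpos (by norm_num) (by linarith)
  have hδ1 : δ ≤ 1 := by
    rw [hδ, div_le_one (by positivity)]
    have : (0 : ℝ) ≤ N := by positivity
    nlinarith
  intro x hx y hy
  have hx0 : 0 < x := by linarith [hx.1]
  have hya : |y| ≤ r := by
    rw [abs_le]
    constructor <;> nlinarith [hy.1, hy.2]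
  refine ⟨?_, fun i hi => abs_formDeriv_le_scale hr (by positivity) (abs_nonneg _) hbl
    (by rw [abs_of_pos hx0]; exact hx.2) (by linarith) i hi⟩
  have hclose : |formDeriv N b 0 x y - formDeriv N b 0 x 0| ≤ |formDeriv N b 0 x 0| / 2 := by
    rcases le_total 0 y with h0 | h0
    · refine hb.2.1 x y hx0 h0 (hy.2.trans ?_)
      have e : (2 : ℝ) ^ (2 - κ) = 2 * (2 : ℝ) ^ (1 - κ) := by
        rw [show 2 - κ = 1 + (1 - κ) by ring, Real.rpow_add (by norm_num), Real.rpow_one]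
      rw [e]
      have : 0 < (2 : ℝ) ^ (1 - κ) := by positivity
      nlinarith [hx.1]
    -- Domination says nothing for `y < 0`. There `|y| ≤ δr ≤ 2δx`, and the coefficient bound
    -- replaces it.
    · have h2δ : 2 * δ ≤ 1 := by
        rw [hδ, ← mul_div_assoc, div_le_one (by positivity)]
        have : (0 : ℝ) ≤ N := by positivity
        nlinarith
      refine (abs_formDeriv_sub_le (by positivity) hbl hx0 h2δ ?_).trans ?_
      · rw [abs_of_nonpos h0]
        have : 0 < δ := by positivity
        nlinarith [hy.1, hx.1]
      · rw [formDeriv_zero_right, abs_mul, abs_of_pos (pow_pos hx0 N), mul_div_right_comm]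
        gcongr
        rw [hδ]
        have : (N : ℝ) * (D * (3 / 2) * |b 0|) * (2 * (1 / (6 * (N + 1) * D))) =
          |b 0| / 2 * (N / (N + 1)) := by field_simp; ring
        rw [this]
        exact mul_le_of_le_one_right (by positivity) ((div_le_one (by positivity)).2 (by linarith))
  have h2 := abs_sub_abs_le_abs_sub (formDeriv N b 0 x 0) (formDeriv N b 0 x y)
  rw [abs_sub_comm] at h2
  have h3 : |formDeriv N b 0 x 0| / 2 ≤ |formDeriv N b 0 x y| := by linarith
  refine le_trans ?_ h3
  rw [formDeriv_zero_right, abs_mul, abs_pow, abs_of_pos hx0]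
  calc (1 / 2) ^ (N + 1) * (|b 0| * r ^ N) = |b 0| * (r / 2) ^ N / 2 := by
        rw [pow_succ, div_pow, div_pow]; ring
    _ ≤ |b 0| * x ^ N / 2 := by
        gcongr
        exact hx.1

/-- The sector near the `y`-axis. -/
theorem DampedOsc.IsDominating.exists_formControlled_left (N : ℕ) {κ : ℝ} (hκ : 2 < κ) :
    ∃ c C : ℝ, 0 < c ∧ 0 < C ∧ ∀ b : ℕ → ℝ,
      IsDominating (formDeriv N b 0) κ → ∀ r : ℝ, 0 < r →
        FormControlled N b (Set.Icc 0 ((2 : ℝ) ^ (1 - κ) * r)) (Set.Icc (r / 2) (2 * r)) c C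
          (|b N| * r ^ N) r := by
  obtain ⟨D, hD1, hD⟩ := exists_coeff_bound N (δ := (2 : ℝ) ^ (2 - κ)) (by positivity)
  have hD0 : 0 < D := by linarith
  refine ⟨(1 / 2) ^ (N + 1), (N + 1 : ℝ) ^ 3 * 2 ^ N * (D * (3 / 2)), by positivity,
    by positivity, ?_⟩
  intro b hb r hr
  -- The polynomial `t ↦ H(t,1)` has the coefficients of `H` in reverse order.
  have hbl' : ∀ l ≤ N, |b (N - l)| ≤ D * (3 / 2) * |b N| := by
    intro l hl
    rw [mul_assoc]
    refine hD (fun l => b (N - l)) _ (fun t ht ht' => ?_) l hl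
    have h1 := hb.2.2 t 1 one_pos ht (by simpa using ht')
    rw [formDeriv_zero_left, one_pow, mul_one] at h1
    have e : formDeriv N b 0 t 1 = ∑ l ∈ Finset.range (N + 1), b (N - l) * t ^ l := by
      rw [formDeriv_reflect]
      simp [formDeriv]
    rw [e] at h1
    have h2 := abs_sub_abs_le_abs_sub (∑ l ∈ Finset.range (N + 1), b (N - l) * t ^ l) (b N)
    linarith
  have hbl : ∀ l ≤ N, |b l| ≤ D * (3 / 2) * |b N| := by
    intro l hl
    have := hbl' (N - l) (Nat.sub_le _ _)
    rwa [Nat.sub_sub_self hl] at this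
  have hκ1 : (2 : ℝ) ^ (1 - κ) ≤ 1 :=
      Real.rpow_le_one_of_one_le_of_nonpos (by norm_num) (by linarith)
  intro x hx y hy
  have hy0 : 0 < y := by linarith [hy.1]
  have hxa : |x| ≤ r := by
    rw [abs_of_nonneg hx.1]
    nlinarith [hx.2]
  refine ⟨?_, fun i hi => abs_formDeriv_le_scale hr (by positivity) (abs_nonneg _) hbl
    (by linarith) (by rw [abs_of_pos hy0]; exact hy.2) i hi⟩
  have hclose : |formDeriv N b 0 x y - formDeriv N b 0 0 y| ≤ |formDeriv N b 0 0 y| / 2 := by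
    refine hb.2.2 x y hy0 hx.1 (hx.2.trans ?_)
    have e : (2 : ℝ) ^ (2 - κ) = 2 * (2 : ℝ) ^ (1 - κ) := by
      rw [show 2 - κ = 1 + (1 - κ) by ring, Real.rpow_add (by norm_num), Real.rpow_one]
    rw [e]
    have : 0 < (2 : ℝ) ^ (1 - κ) := by positivity
    nlinarith [hy.1]
  have h2 := abs_sub_abs_le_abs_sub (formDeriv N b 0 0 y) (formDeriv N b 0 x y)
  rw [abs_sub_comm] at h2
  have h3 : |formDeriv N b 0 0 y| / 2 ≤ |formDeriv N b 0 x y| := by linarith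
  refine le_trans ?_ h3
  rw [formDeriv_zero_left, abs_mul, abs_pow, abs_of_pos hy0]
  calc (1 / 2) ^ (N + 1) * (|b N| * r ^ N) = |b N| * (r / 2) ^ N / 2 := by
        rw [pow_succ, div_pow, div_pow]; ring
    _ ≤ |b N| * y ^ N / 2 := by
        gcongr
        exact hy.1

/-! ### The operator estimate at one scale. -/

/-- The `L²` bound for an oscillatory integral operator on a rectangle at scale `r` on which the
mixed Hessian has size `A`. -/
theorem exists_oscillatory_operator_bound (N : ℕ) {c C : ℝ} (hc : 0 < c) (hC : 0 < C) :
    ∃ K₀ : ℝ, 0 < K₀ ∧ ∀ (a : ℕ → ℝ) (A r lam B i₀ i₁ j₀ j₁ : ℝ) (α : ℝ → ℝ → ℂ),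
      0 < A → 0 < r → 0 < lam → 0 ≤ B → j₀ ≤ j₁ → j₁ - j₀ ≤ 4 * r →
      FormControlled N (hessCoeff N a) (Set.Icc i₀ i₁) (Set.Icc j₀ j₁) c C A r →
      Measurable (Function.uncurry α) →
      (∀ x ∈ Set.Icc i₀ i₁, ControlledOn (Set.Icc j₀ j₁) B r (α x)) →
      (∀ x ∈ Set.Icc i₀ i₁, ∀ y ∉ Set.Ioo j₀ j₁, α x y = 0) →
      (∀ x ∉ Set.Icc i₀ i₁, ∀ y, α x y = 0) →
      ∀ f : ℝ → ℂ, MemLp f 2 volume →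
        MemLp (fun x => ∫ y, Complex.exp (Complex.I * ((lam * phaseDeriv N a 0 x y : ℝ) : ℂ)) *
          α x y * f y) 2 volume ∧
        eLpNorm (fun x => ∫ y, Complex.exp (Complex.I * ((lam * phaseDeriv N a 0 x y : ℝ) : ℂ)) *
          α x y * f y) 2 volume ≤
          ENNReal.ofReal (K₀ * (B / √(lam * A))) * eLpNorm f 2 volume := by
  set M := C / c with hM
  have hM0 : 0 < M := by positivity
  set D := 1 + M + 2 * M ^ 2 with hD
  have hD1 : 1 ≤ D := by rw [hD]; nlinarith [sq_nonneg M]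
  refine ⟨16 * D * √(Real.pi / c), by have := Real.pi_pos; positivity, ?_⟩
  intro a A r lam B i₀ i₁ j₀ j₁ α hA hr hlam hB hj hjr hF hαm hαc hα0 hαx f hf
  set I := Set.Icc i₀ i₁ with hI
  set J := Set.Icc j₀ j₁ with hJ
  set k : ℝ → ℝ → ℂ := fun x y =>
    Complex.exp (Complex.I * ((lam * phaseDeriv N a 0 x y : ℝ) : ℂ)) * α x y with hk
  have hkm : Measurable (Function.uncurry k) := by
    refine Measurable.mul ?_ hαm
    have : Continuous fun p : ℝ × ℝ => phaseDeriv N a 0 p.1 p.2 := by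
      unfold phaseDeriv; fun_prop
    exact Continuous.measurable (by fun_prop)
  have hnk : ∀ x y, ‖k x y‖ = ‖α x y‖ := by
    intro x y
    simp only [hk, norm_mul]
    rw [mul_comm Complex.I, Complex.norm_exp_ofReal_mul_I, one_mul]
  have hkB : ∀ x y, ‖k x y‖ ≤ B := by
    intro x y
    rw [hnk]
    by_cases hx : x ∈ I
    · by_cases hy : y ∈ Set.Ioo j₀ j₁
      · exact (hαc x hx).norm_le ⟨hy.1.le, hy.2.le⟩
      · rw [hα0 x hx y hy, norm_zero]; exact hB
    · rw [hαx x hx, norm_zero]; exact hB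
  have hkJ : ∀ x, ∀ y ∉ J, k x y = 0 := by
    intro x y hy
    rw [← norm_eq_zero, hnk, norm_eq_zero]
    by_cases hx : x ∈ I
    · exact hα0 x hx y fun h => hy ⟨h.1.le, h.2.le⟩
    · exact hαx x hx y
  have hkI : ∀ x ∉ I, ∀ y, k x y = 0 := by
    intro x hx y
    rw [← norm_eq_zero, hnk, norm_eq_zero]
    exact hαx x hx y
  set q := lam * c * A * r with hq
  have hq0 : 0 < q := by positivity
  -- The factor is `256 = 8 · 4 · 4 · 2`: nonstationary phase, the product of two amplitudes, the
  -- length `4r`, and `1 + s² ≤ 2s²`.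
  set W₀ := 256 * D ^ 2 * B ^ 2 * r with hW₀
  have hW₀0 : 0 ≤ W₀ := by positivity
  have hL : ∀ x x', ‖∫ y in J, k x y * (starRingEnd ℂ) (k x' y)‖ ≤
      W₀ * (1 + (q * (x - x')) ^ 2)⁻¹ := by
    intro x x'
    by_cases hx : x ∈ I
    swap
    · simp only [hkI x hx, zero_mul, integral_zero, norm_zero]; positivity
    by_cases hx' : x' ∈ I
    swap
    · simp only [hkI x' hx', map_zero, mul_zero, integral_zero, norm_zero]; positivity
    have htriv : ‖∫ y in J, k x y * (starRingEnd ℂ) (k x' y)‖ ≤ 4 * B ^ 2 * r := by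
      have := norm_setIntegral_le_of_norm_le_const (μ := volume) (s := J) (C := B * B)
        (f := fun y => k x y * (starRingEnd ℂ) (k x' y)) (by simp [hJ])
        (fun y _ => by
          rw [norm_mul, RCLike.norm_conj]
          exact mul_le_mul (hkB _ _) (hkB _ _) (norm_nonneg _) hB)
      refine this.trans ?_
      rw [hJ, Real.volume_real_Icc_of_le hj]
      nlinarith [mul_nonneg hB hB]
    set s := q * (x - x') with hs
    have hs2 : 0 < 1 + s ^ 2 := by positivity
    rw [← div_eq_mul_inv, le_div_iff₀ hs2]
    -- Near the diagonal of `TT*` the trivial size bound suffices; away from it the phase is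
    -- nonstationary.
    rcases le_total (s ^ 2) 1 with h1 | h1
    · calc _ ≤ 4 * B ^ 2 * r * 2 := by gcongr; linarith
        _ ≤ W₀ := by
          rw [hW₀]
          have : (1 : ℝ) ≤ D ^ 2 := one_le_pow₀ hD1
          nlinarith [mul_nonneg (sq_nonneg B) hr.le]
    · have hxx : x ≠ x' := by
        rintro rfl
        simp [hs] at h1
        linarith
      have hd : 0 < |x - x'| := abs_pos.2 (sub_ne_zero.2 hxx)
      set P : ℕ → ℝ → ℝ := fun i y => lam * (phaseDeriv N a i x y - phaseDeriv N a i x' y) with hP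
      have hPd : ∀ i y, HasDerivAt (P i) (P (i + 1) y) y := fun i y =>
        ((hasDerivAt_phaseDeriv N a i x y).sub (hasDerivAt_phaseDeriv N a i x' y)).const_mul lam
      -- The point `ξ` depends on `i` and `y`, which does no harm: the bounds for the Hessian hold
      -- on all of `I × J`.
      have hmv : ∀ i y, ∃ ξ ∈ I, P (i + 1) y =
          lam * (formDeriv N (hessCoeff N a) i ξ y * (x - x')) := by
        intro i y
        have hmem : Set.uIcc x' x ⊆ I := by
          rw [hI]; exact Set.uIcc_subset_Icc hx' hx
        rcases lt_or_gt_of_ne hxx with hlt | hlt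
        · obtain ⟨ξ, hξ, he⟩ := exists_hasDerivAt_eq_slope (fun u => phaseDeriv N a (i + 1) u y) _
            hlt (fun u _ => (hasDerivAt_phaseDeriv_left N a i u y).continuousAt.continuousWithinAt)
            (fun u _ => hasDerivAt_phaseDeriv_left N a i u y)
          refine ⟨ξ, ⟨hx.1.trans hξ.1.le, hξ.2.le.trans hx'.2⟩, ?_⟩
          have h0 : x' - x ≠ 0 := (sub_pos.2 hlt).ne'
          simp only [hP, he]
          field_simp
          ring
        · obtain ⟨ξ, hξ, he⟩ := exists_hasDerivAt_eq_slope (fun u => phaseDeriv N a (i + 1) u y) _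
            hlt (fun u _ => (hasDerivAt_phaseDeriv_left N a i u y).continuousAt.continuousWithinAt)
            (fun u _ => hasDerivAt_phaseDeriv_left N a i u y)
          refine ⟨ξ, ⟨hx'.1.trans hξ.1.le, hξ.2.le.trans hx.2⟩, ?_⟩
          have h0 : x - x' ≠ 0 := (sub_pos.2 hlt).ne'
          simp only [hP, he]
          field_simp
      have hupper : ∀ i ≤ 2, ∀ y ∈ J, |P (i + 1) y| ≤ M * (lam * c * A * |x - x'|) / r ^ i := by
        intro i hi y hy
        obtain ⟨ξ, hξ, he⟩ := hmv i y
        rw [he, abs_mul, abs_mul, abs_of_pos hlam]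
        calc lam * (|formDeriv N (hessCoeff N a) i ξ y| * |x - x'|)
            ≤ lam * (C * A / r ^ i * |x - x'|) := by
              gcongr
              exact (hF ξ hξ y hy).2 i hi
          _ = _ := by rw [hM]; field_simp
      have hb := (hαc x hx).mul hr hB (hαc x' hx').conj
      have hosc := norm_integral_exp_mul_le_of_nonstationary hj hr
        (m := lam * c * A * |x - x'|) (M := M) (B := 4 * B * B) (by positivity) hM0.le
        (by positivity) (fun y _ => hPd 0 y) (fun y _ => hPd 1 y) (fun y _ => hPd 2 y)
        (fun y _ => (hPd 3 y).continuousAt.continuousWithinAt)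
        (fun y hy => by
          obtain ⟨ξ, hξ, he⟩ := hmv 0 y
          rw [he, abs_mul, abs_mul, abs_of_pos hlam, mul_assoc lam, mul_assoc lam]
          gcongr
          exact (hF ξ hξ y hy).1)
        (fun y hy => by simpa using hupper 1 (by norm_num) y hy)
        (fun y hy => by simpa using hupper 2 (by norm_num) y hy) hb
        (fun y hy => by simp [hα0 x hx y hy])
      have heq : ∫ y in J, k x y * (starRingEnd ℂ) (k x' y) = ∫ y in j₀..j₁,
          Complex.exp (Complex.I * P 0 y) * (α x y * (starRingEnd ℂ) (α x' y)) := by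
        rw [hJ, integral_Icc_eq_integral_Ioc, intervalIntegral.integral_of_le hj]
        refine integral_congr_ae (Filter.Eventually.of_forall fun y => ?_)
        simp only [hk, hP, map_mul, ← Complex.exp_conj, Complex.conj_I, Complex.conj_ofReal]
        rw [mul_mul_mul_comm, ← Complex.exp_add]
        congr 2
        push_cast
        ring
      rw [heq]
      have hmr : (lam * c * A * |x - x'| * r) ^ 2 = s ^ 2 := by
        rw [hs, hq, ← sq_abs (lam * c * A * r * (x - x')), abs_mul,
          abs_of_pos (by positivity : 0 < lam * c * A * r)]
        ring
      rw [hmr] at hosc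
      have hs0 : 0 < s ^ 2 := by linarith
      calc _ ≤ 8 * D ^ 2 * (4 * B * B) * (j₁ - j₀) / s ^ 2 * (1 + s ^ 2) := by gcongr
        _ ≤ 8 * D ^ 2 * (4 * B * B) * (4 * r) / s ^ 2 * (2 * s ^ 2) := by
          have : 0 ≤ j₁ - j₀ := by linarith
          gcongr
          linarith
        _ = W₀ := by
          rw [hW₀, mul_comm 2 (s ^ 2), ← mul_assoc, div_mul_cancel₀ _ hs0.ne']
          ring
  have hint : Integrable (fun x : ℝ => (1 + x ^ 2)⁻¹) := integrable_inv_one_add_sq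
  have hschur : ∀ x, ∫ x' in I, ‖∫ y in J, k x y * (starRingEnd ℂ) (k x' y)‖ ≤
      W₀ * (Real.pi / q) := by
    intro x
    have h1 : Integrable (fun x' => W₀ * (1 + (q * (x - x')) ^ 2)⁻¹) := by
      refine Integrable.const_mul ?_ _
      exact (hint.comp_mul_left' hq0.ne').comp_sub_left x
    have h2 : ∫ x', W₀ * (1 + (q * (x - x')) ^ 2)⁻¹ = W₀ * (Real.pi / q) := by
      rw [integral_const_mul, integral_sub_left_eq_self (fun u => (1 + (q * u) ^ 2)⁻¹) volume x,
        Measure.integral_comp_mul_left (fun u => (1 + u ^ 2)⁻¹) q, integral_univ_inv_one_add_sq,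
        abs_of_pos (inv_pos.2 hq0), smul_eq_mul]
      ring
    rw [← h2]
    refine le_trans (integral_mono_of_nonneg (Filter.Eventually.of_forall fun _ => norm_nonneg _)
      h1.integrableOn (Filter.Eventually.of_forall fun x' => hL x x')) ?_
    exact setIntegral_le_integral h1 (Filter.Eventually.of_forall fun x' => by
      simp only [Pi.zero_apply]; positivity)
  have : IsFiniteMeasure (volume.restrict I) := ⟨by simp [hI]⟩
  have : IsFiniteMeasure (volume.restrict J) := ⟨by simp [hJ]⟩
  obtain ⟨hg, hle⟩ := integral_norm_sq_le_of_schur hkm hkB hschur (hf.restrict J)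
  have hgeq : (fun x => ∫ y, k x y * f y) = I.indicator fun x => ∫ y in J, k x y * f y := by
    ext x
    by_cases hx : x ∈ I
    · rw [Set.indicator_of_mem hx]
      exact (setIntegral_eq_integral_of_forall_compl_eq_zero fun y hy => by
        rw [hkJ x y hy, zero_mul]).symm
    · rw [Set.indicator_of_notMem hx]
      simp [hkI x hx]
  change MemLp (fun x => ∫ y, k x y * f y) 2 volume ∧ eLpNorm (fun x => ∫ y,
      k x y * f y) 2 volume ≤ _
  have hIm : MeasurableSet I := measurableSet_Icc
  rw [hgeq, memLp_indicator_iff_restrict hIm, eLpNorm_indicator_eq_eLpNorm_restrict hIm]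
  refine ⟨hg, ?_⟩
  have hWq : 0 ≤ W₀ * (Real.pi / q) := mul_nonneg hW₀0 (div_nonneg Real.pi_pos.le hq0.le)
  refine ((hf.restrict J).eLpNorm_two_le hg hWq hle).trans ?_
  -- The length `r` of the `y`-interval, a factor of `W₀`, cancels against the `r` in `q`; only `λA`
  -- survives.
  have hsq : √(W₀ * (Real.pi / q)) = 16 * D * √(Real.pi / c) * (B / √(lam * A)) := by
    have e : W₀ * (Real.pi / q) = (16 * D * B) ^ 2 * ((Real.pi / c) / (lam * A)) := by
      rw [hW₀, hq]; field_simp; ring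
    rw [e, Real.sqrt_mul (by positivity), Real.sqrt_sq (by positivity),
        Real.sqrt_div' _ (by positivity)]
    ring
  rw [hsq]
  gcongr
  exact Measure.restrict_le_self

/-! ### Scale bounds for the factors of the amplitude. -/

theorem exists_deriv_bound {f : ℝ → ℝ} (hf : ContDiff ℝ ∞ f) (hs : HasCompactSupport f) :
    ∃ M : ℝ, 0 ≤ M ∧ ∀ t, |f t| ≤ M ∧ |deriv f t| ≤ M ∧ |deriv (deriv f) t| ≤ M := by
  have h1 : ContDiff ℝ ∞ (deriv f) := (contDiff_infty_iff_deriv.1 hf).2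
  have h2 : ContDiff ℝ ∞ (deriv (deriv f)) := (contDiff_infty_iff_deriv.1 h1).2
  obtain ⟨M0, hM0⟩ := hs.exists_bound_of_continuous hf.continuous
  obtain ⟨M1, hM1⟩ := hs.deriv.exists_bound_of_continuous h1.continuous
  obtain ⟨M2, hM2⟩ := hs.deriv.deriv.exists_bound_of_continuous h2.continuous
  refine ⟨max M0 (max M1 M2), (norm_nonneg _).trans ((hM0 0).trans (le_max_left _ _)), fun t => ?_⟩
  exact ⟨(hM0 t).trans (le_max_left _ _),
    (hM1 t).trans ((le_max_left _ _).trans (le_max_right _ _)),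
    (hM2 t).trans ((le_max_right _ _).trans (le_max_right _ _))⟩

theorem ContDiff.hasDerivAt_deriv_deriv {f : ℝ → ℝ} (hf : ContDiff ℝ ∞ f) :
    (∀ t, HasDerivAt f (deriv f t) t) ∧ (∀ t, HasDerivAt (deriv f) (deriv (deriv f) t) t) ∧
      Continuous (deriv (deriv f)) := by
  have h1 := contDiff_infty_iff_deriv.1 hf
  have h2 := contDiff_infty_iff_deriv.1 h1.2
  exact ⟨fun t => (h1.1 t).hasDerivAt, fun t => (h2.1 t).hasDerivAt, h2.2.continuous⟩

/-- A smooth bump rescaled to the scale `r`. -/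
theorem controlledOn_comp_mul {f : ℝ → ℝ} (hf : ContDiff ℝ ∞ f) {M s r : ℝ} (hr : 0 < r)
    (hs : s * r = 1) (hM : ∀ t, |f t| ≤ M ∧ |deriv f t| ≤ M ∧ |deriv (deriv f) t| ≤ M)
    (J : Set ℝ) : ControlledOn J M r (fun y => (f (s * y) : ℂ)) := by
  obtain ⟨h0, h1, h2⟩ := hf.hasDerivAt_deriv_deriv
  have hse : s = 1 / r := by field_simp; linarith
  refine ControlledOn.of_real (f₁ := fun y => deriv f (s * y) * s)
    (f₂ := fun y => deriv (deriv f) (s * y) * s * s) ?_ ?_ ?_ ?_ ?_ ?_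
  · intro y _
    exact ((h0 (s * y)).comp y ((hasDerivAt_id y).const_mul s)).of_eq (fun _ => rfl) (by simp)
  · intro y _
    exact (((h1 (s * y)).comp y ((hasDerivAt_id y).const_mul s)).mul_const s).of_eq
      (fun _ => rfl) (by simp)
  · exact Continuous.continuousOn (by fun_prop)
  · exact fun y _ => (hM _).1
  · intro y _
    rw [abs_mul, hse, abs_of_pos (by positivity : 0 < 1 / r), mul_one_div]
    gcongr
    exact (hM _).2.1
  · intro y _
    rw [abs_mul, abs_mul, hse, abs_of_pos (by positivity : 0 < 1 / r), mul_assoc,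
      show 1 / r * (1 / r) = 1 / r ^ 2 by field_simp, mul_one_div]
    gcongr
    exact (hM _).2.2

/-- The cut-off away from the diagonal is controlled at any scale comparable to the distance. -/
theorem DampedOsc.IsDiagonalCutoff.controlledOn {φ : ℝ → ℝ}
    (hφ : IsDiagonalCutoff φ) {M c r Λ x : ℝ}
    (hr : 0 < r) (hc : 0 < c) (hc1 : c ≤ 1) (hΛ : 0 < Λ) (hM0 : 0 ≤ M)
    (hM : ∀ t, |φ t| ≤ M ∧ |deriv φ t| ≤ M ∧ |deriv (deriv φ) t| ≤ M)
    {J : Set ℝ} (hJ : ∀ y ∈ J, c * r ≤ |x - y|) :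
    ControlledOn J ((1 + M) / c ^ 2) r (fun y => ((1 - φ ((x - y) * Λ) : ℝ) : ℂ)) := by
  obtain ⟨h0, h1, h2⟩ := hφ.smooth.hasDerivAt_deriv_deriv
  have hlin : ∀ y, HasDerivAt (fun y => (x - y) * Λ) (-Λ) y := fun y => by
    simpa using ((hasDerivAt_id y).const_sub x).mul_const Λ
  have hfar : ∀ t, 1 < |t| → φ =ᶠ[nhds t] fun _ => 0 := fun t ht =>
    Filter.eventually_of_mem ((isOpen_lt continuous_const continuous_abs).mem_nhds ht)
      fun s (hs : 1 < |s|) => hφ.eq_zero s hs.le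
  have hd1 : ∀ t, 1 < |t| → deriv φ t = 0 := fun t ht => by
    rw [(hfar t ht).deriv_eq]; simp
  have hd2 : ∀ t, 1 < |t| → deriv (deriv φ) t = 0 := fun t ht => by
    rw [(hfar t ht).deriv.deriv_eq]; simp
  -- Derivatives of `φ` are present only where `|x - y| Λ ≤ 1`. Since `|x - y| ≥ cr`, each factor
  -- `Λ` produced by differentiation then costs at most `1/(cr)`, so the bound is free of `Λ`.
  have hsmall : ∀ y ∈ J, |(x - y) * Λ| ≤ 1 → Λ ≤ 1 / (c * r) := by
    intro y hy h
    rw [abs_mul, abs_of_pos hΛ] at h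
    rw [le_div_iff₀ (by positivity)]
    nlinarith [hJ y hy]
  refine ControlledOn.of_real (f₁ := fun y => deriv φ ((x - y) * Λ) * Λ)
    (f₂ := fun y => deriv (deriv φ) ((x - y) * Λ) * -Λ * Λ) ?_ ?_ ?_ ?_ ?_ ?_
  · intro y _
    exact (((h0 ((x - y) * Λ)).comp y (hlin y)).const_sub 1).of_eq (fun _ => rfl) (by ring)
  · intro y _
    exact ((h1 ((x - y) * Λ)).comp y (hlin y)).mul_const Λ
  · exact Continuous.continuousOn (by fun_prop)
  · intro y _
    have h3 := (hM ((x - y) * Λ)).1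
    have h4 : |1 - φ ((x - y) * Λ)| ≤ 1 + M := by
      refine (abs_sub _ _).trans ?_
      simpa using h3
    refine h4.trans (le_div_self (by positivity) (by positivity) (pow_le_one₀ hc.le hc1))
  · intro y hy
    by_cases h : |(x - y) * Λ| ≤ 1
    · rw [abs_mul, abs_of_pos hΛ]
      calc |deriv φ ((x - y) * Λ)| * Λ ≤ M * (1 / (c * r)) := by
            gcongr
            · exact (hM _).2.1
            · exact hsmall y hy h
        _ = M * c / c ^ 2 / r := by field_simp
        _ ≤ (1 + M) / c ^ 2 / r := by
            gcongr
            nlinarith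
    · rw [hd1 _ (not_le.1 h), zero_mul, abs_zero]
      positivity
  · intro y hy
    by_cases h : |(x - y) * Λ| ≤ 1
    · rw [abs_mul, abs_mul, abs_neg, abs_of_pos hΛ, mul_assoc]
      calc |deriv (deriv φ) ((x - y) * Λ)| * (Λ * Λ) ≤ M * (1 / (c * r) * (1 / (c * r))) := by
            gcongr
            · exact (hM _).2.2
            · exact hsmall y hy h
            · exact hsmall y hy h
        _ = M / c ^ 2 / r ^ 2 := by field_simp
        _ ≤ (1 + M) / c ^ 2 / r ^ 2 := by
            gcongr
            linarith
    · rw [hd2 _ (not_le.1 h), zero_mul, zero_mul, abs_zero]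
      positivity

theorem DampedOsc.IsSingularKernel.const_nonneg {K : ℝ × ℝ → ℂ} {E μ : ℝ}
    (hK : IsSingularKernel K E μ) :
    0 ≤ E := by
  have h := hK.bound 0 (by norm_num) 1 0 (by norm_num)
  simp only [sub_zero, abs_one, Real.one_rpow, mul_one] at h
  exact (norm_nonneg _).trans h

/-- The exponents `-μ - i` are negative, so the worst case is the smallest distance `cr`. The
exponent 3 exceeds `μ + i` for `μ < 1` and `i ≤ 2`, which makes the constant independent of `μ`. -/
theorem DampedOsc.IsSingularKernel.controlledOn {K : ℝ × ℝ → ℂ} {E μ : ℝ}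
    (hK : IsSingularKernel K E μ)
    (hμ : 0 < μ) (hμ1 : μ < 1) {c r x : ℝ} (hr : 0 < r) (hc : 0 < c) (hc1 : c ≤ 1)
    {J : Set ℝ} (hJ : ∀ y ∈ J, c * r ≤ |x - y|) :
    ControlledOn J (E * (1 / c) ^ 3 * r ^ (-μ)) r (fun y => K (x, y)) := by
  have hne : ∀ y ∈ J, x ≠ y := fun y hy h => by
    have := hJ y hy
    rw [h, sub_self, abs_zero] at this
    nlinarith
  have hE := hK.const_nonneg
  have hcd : ∀ y, x ≠ y → ContDiffAt ℝ 2 (fun v => K (x, v)) y := by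
    intro y hy
    have hopen : IsOpen {p : ℝ × ℝ | p.1 ≠ p.2} := isOpen_ne_fun continuous_fst continuous_snd
    have h1 : ContDiffAt ℝ 2 K (x, y) := hK.contDiffOn.contDiffAt (hopen.mem_nhds hy)
    exact h1.comp y (contDiffAt_const.prodMk contDiffAt_id)
  have hbd : ∀ i ≤ 2, ∀ y ∈ J, ‖iteratedDeriv i (fun v => K (x, v)) y‖ ≤
      E * (1 / c) ^ 3 * r ^ (-μ) / r ^ i := by
    intro i hi y hy
    refine (hK.bound i hi x y (hne y hy)).trans ?_
    have hi' : (i : ℝ) ≤ 2 := by exact_mod_cast hi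
    calc E * |x - y| ^ (-μ - (i : ℝ)) ≤ E * (c * r) ^ (-μ - (i : ℝ)) := by
          refine mul_le_mul_of_nonneg_left ?_ hE
          refine Real.rpow_le_rpow_of_nonpos (by positivity) (hJ y hy) ?_
          have : (0 : ℝ) ≤ i := by positivity
          linarith
      _ = E * (1 / c) ^ (μ + (i : ℝ)) * r ^ (-μ) / r ^ i := by
          rw [Real.mul_rpow hc.le hr.le, one_div, Real.inv_rpow hc.le, ← Real.rpow_neg hc.le,
            neg_add', Real.rpow_sub hr, Real.rpow_natCast]
          ring
      _ ≤ E * (1 / c) ^ (3 : ℝ) * r ^ (-μ) / r ^ i := by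
          gcongr
          · rw [le_div_iff₀ hc]; linarith
          · linarith
      _ = _ := by norm_cast
  have e₂ : iteratedDeriv 2 (fun v => K (x, v)) = deriv (deriv fun v => K (x, v)) := by
    rw [iteratedDeriv_succ, iteratedDeriv_one]
  refine ⟨iteratedDeriv 1 fun v => K (x, v), iteratedDeriv 2 fun v => K (x, v), ?_, ?_, ?_, ?_,
    ?_, ?_⟩
  · intro y hy
    rw [iteratedDeriv_one]
    exact ((hcd y (hne y hy)).differentiableAt (by norm_num)).hasDerivAt
  · intro y hy
    rw [e₂, iteratedDeriv_one]
    have h1 : ContDiffAt ℝ 1 (deriv fun v => K (x, v)) y :=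
      (hcd y (hne y hy)).derivWithin (by norm_num)
    exact (h1.differentiableAt (by norm_num)).hasDerivAt
  · intro y hy
    refine ContinuousAt.continuousWithinAt ?_
    rw [e₂]
    have h1 : ContDiffAt ℝ 1 (deriv fun v => K (x, v)) y :=
      (hcd y (hne y hy)).derivWithin (by norm_num)
    have h2 : ContDiffAt ℝ 0 (deriv (deriv fun v => K (x, v))) y := h1.derivWithin (by norm_num)
    exact h2.continuousAt
  · intro y hy
    simpa using hbd 0 (by norm_num) y hy
  · intro y hy
    simpa using hbd 1 (by norm_num) y hy
  · intro y hy
    simpa using hbd 2 (by norm_num) y hy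

/-- The logarithmic derivative `h₁/h` is at most `(C/c)/r`, and differentiating `F = |h|^z`
multiplies it by `z h₁/h`. The size `√A` comes from `Re z = 1/2`; the imaginary part of `z` enters
only through the constant. -/
theorem controlledOn_abs_cpow {z : ℂ} (hz : z.re = 1 / 2) {J : Set ℝ} {h h₁ h₂ : ℝ → ℝ}
    {c C A r : ℝ} (hc : 0 < c) (hC : 0 < C) (hA : 0 < A) (hr : 0 < r)
    (hd : ∀ y, HasDerivAt h (h₁ y) y) (hd₁ : ∀ y, HasDerivAt h₁ (h₂ y) y) (hc₂ : Continuous h₂)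
    (hlow : ∀ y ∈ J, c * A ≤ |h y|) (hup : ∀ y ∈ J, |h y| ≤ C * A)
    (hup₁ : ∀ y ∈ J, |h₁ y| ≤ C * A / r) (hup₂ : ∀ y ∈ J, |h₂ y| ≤ C * A / r ^ 2) :
    ControlledOn J ((1 + ‖z‖ * (C / c + (C / c) ^ 2) + ‖z‖ ^ 2 * (C / c) ^ 2) * √C * √A) r
      (fun y => ((|h y| : ℝ) : ℂ) ^ z) := by
  set ρ := C / c with hρ
  have hρ0 : 0 < ρ := by positivity
  have hne : ∀ y ∈ J, h y ≠ 0 := fun y hy h0 => by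
    have := hlow y hy
    rw [h0, abs_zero] at this
    nlinarith [mul_pos hc hA]
  have ch : Continuous h := continuous_iff_continuousAt.2 fun y => (hd y).continuousAt
  have ch1 : Continuous h₁ := continuous_iff_continuousAt.2 fun y => (hd₁ y).continuousAt
  set F : ℝ → ℂ := fun y => ((|h y| : ℝ) : ℂ) ^ z with hF
  -- `Real.log` is the logarithm of the absolute value, so both signs of `h` are treated at once.
  have hFexp : ∀ y, h y ≠ 0 → F y = Complex.exp ((Real.log (h y) : ℂ) * z) := by
    intro y hy
    have : ((|h y| : ℝ) : ℂ) ≠ 0 := by exact_mod_cast abs_ne_zero.2 hy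
    rw [hF]
    simp only
    rw [Complex.cpow_def_of_ne_zero this, ← Complex.ofReal_log (abs_nonneg _), Real.log_abs]
  have hFd : ∀ y ∈ J, HasDerivAt F (((h₁ y / h y : ℝ) : ℂ) * z * F y) y := by
    intro y hy
    have hev : ∀ᶠ v in nhds y, h v ≠ 0 := ch.continuousAt.eventually_ne (hne y hy)
    have h1 : HasDerivAt (fun v => Complex.exp ((Real.log (h v) : ℂ) * z))
        (Complex.exp ((Real.log (h y) : ℂ) * z) * (((h₁ y / h y : ℝ) : ℂ) * z)) y :=
      ((((hd y).log (hne y hy)).ofReal_comp).mul_const z).cexp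
    rw [hFexp y (hne y hy), mul_comm]
    exact h1.congr_of_eventuallyEq (hev.mono fun v hv => hFexp v hv)
  have hFn : ∀ y ∈ J, ‖F y‖ ≤ √C * √A := by
    intro y hy
    rw [hF]
    simp only
    rw [Complex.norm_cpow_eq_rpow_re_of_pos (abs_pos.2 (hne y hy)), hz, ← Real.sqrt_eq_rpow,
      ← Real.sqrt_mul hC.le]
    exact Real.sqrt_le_sqrt (hup y hy)
  have hq1 : ∀ y ∈ J, |h₁ y / h y| ≤ ρ / r := by
    intro y hy
    rw [abs_div]
    calc |h₁ y| / |h y| ≤ (C * A / r) / (c * A) := by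
          gcongr
          · exact hup₁ y hy
          · exact hlow y hy
      _ = ρ / r := by rw [hρ]; field_simp
  have hq2 : ∀ y ∈ J, |(h₂ y * h y - h₁ y * h₁ y) / h y ^ 2| ≤ (ρ + ρ ^ 2) / r ^ 2 := by
    intro y hy
    have hn := hne y hy
    have e : (h₂ y * h y - h₁ y * h₁ y) / h y ^ 2 = h₂ y / h y - (h₁ y / h y) ^ 2 := by
      field_simp
    rw [e]
    refine (abs_sub _ _).trans ?_
    rw [abs_pow]
    have h3 : |h₂ y / h y| ≤ ρ / r ^ 2 := by
      rw [abs_div]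
      calc |h₂ y| / |h y| ≤ (C * A / r ^ 2) / (c * A) := by
            gcongr
            · exact hup₂ y hy
            · exact hlow y hy
        _ = ρ / r ^ 2 := by rw [hρ]; field_simp
    calc _ ≤ ρ / r ^ 2 + (ρ / r) ^ 2 := by
          gcongr
          exact hq1 y hy
      _ = _ := by rw [div_pow]; ring
  set T := √C * √A with hT
  have hT0 : 0 ≤ T := by positivity
  have hFcont : ContinuousOn F J := fun y hy => (hFd y hy).continuousAt.continuousWithinAt
  have cq : ContinuousOn (fun y => h₁ y / h y) J :=
    ch1.continuousOn.div ch.continuousOn hne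
  have hF1 : ∀ y ∈ J, ‖((h₁ y / h y : ℝ) : ℂ) * z * F y‖ ≤ ρ / r * ‖z‖ * T := by
    intro y hy
    rw [norm_mul, norm_mul, Complex.norm_real, Real.norm_eq_abs]
    gcongr
    · exact hq1 y hy
    · exact hFn y hy
  refine ⟨fun y => ((h₁ y / h y : ℝ) : ℂ) * z * F y,
    fun y => (((h₂ y * h y - h₁ y * h₁ y) / h y ^ 2 : ℝ) : ℂ) * z * F y +
      ((h₁ y / h y : ℝ) : ℂ) * z * (((h₁ y / h y : ℝ) : ℂ) * z * F y), hFd, ?_, ?_, ?_, ?_, ?_⟩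
  · intro y hy
    exact ((((hd₁ y).div (hd y) (hne y hy)).ofReal_comp).mul_const z).mul (hFd y hy)
  · have c1 : ContinuousOn (fun y => ((h₁ y / h y : ℝ) : ℂ) * z) J :=
      (Complex.continuous_ofReal.comp_continuousOn cq).mul continuousOn_const
    refine ContinuousOn.add (ContinuousOn.mul (ContinuousOn.mul
      (Complex.continuous_ofReal.comp_continuousOn ?_) continuousOn_const) hFcont)
      (c1.mul (c1.mul hFcont))
    exact ContinuousOn.div (by fun_prop) (by fun_prop) fun y hy => pow_ne_zero 2 (hne y hy)
  · intro y hy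
    refine (hFn y hy).trans ?_
    rw [mul_assoc]
    refine le_mul_of_one_le_left hT0 ?_
    have : 0 ≤ ‖z‖ * (ρ + ρ ^ 2) + ‖z‖ ^ 2 * ρ ^ 2 := by positivity
    linarith
  · intro y hy
    refine (hF1 y hy).trans ?_
    rw [mul_assoc _ (√C), ← hT]
    calc ρ / r * ‖z‖ * T = ‖z‖ * ρ * T / r := by ring
      _ ≤ _ := by
        gcongr
        have : 0 ≤ 1 + ‖z‖ * ρ ^ 2 + ‖z‖ ^ 2 * ρ ^ 2 := by positivity
        linarith
  · intro y hy
    rw [mul_assoc _ (√C), ← hT]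
    refine (norm_add_le _ _).trans ?_
    rw [norm_mul, norm_mul, norm_mul (_ * z), norm_mul _ z, Complex.norm_real, Complex.norm_real,
      Real.norm_eq_abs, Real.norm_eq_abs]
    calc _ ≤ (ρ + ρ ^ 2) / r ^ 2 * ‖z‖ * T + ρ / r * ‖z‖ * (ρ / r * ‖z‖ * T) := by
          gcongr
          · exact hq2 y hy
          · exact hFn y hy
          · exact hq1 y hy
          · exact hF1 y hy
      _ = (‖z‖ * (ρ + ρ ^ 2) + ‖z‖ ^ 2 * ρ ^ 2) * T / r ^ 2 := by field_simp
      _ ≤ _ := by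
        gcongr
        linarith

/-- A fixed smooth compactly supported function is controlled at every scale `r ≤ R`, because a
bounded `i`-th derivative is at most a multiple of `Rⁱ/rⁱ`. -/
theorem exists_controlledOn_snd {ψ : ℝ × ℝ → ℂ} (hψ : ContDiff ℝ ∞ ψ) (hs : HasCompactSupport ψ)
    {R : ℝ} (hR : 1 ≤ R) : ∃ M : ℝ, 0 ≤ M ∧ ∀ (x r : ℝ) (J : Set ℝ), 0 < r → r ≤ R →
      ControlledOn J M r (fun y => ψ (x, y)) := by
  have hd : ∀ g : ℝ × ℝ → ℂ, ContDiff ℝ ∞ g → HasCompactSupport g →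
      ContDiff ℝ ∞ (fun p => fderiv ℝ g p (0, 1)) ∧
      HasCompactSupport (fun p => fderiv ℝ g p (0, 1)) ∧
      ∀ x y, HasDerivAt (fun v => g (x, v)) (fderiv ℝ g (x, y) (0, 1)) y := by
    intro g hg hgs
    refine ⟨(hg.fderiv_right (by simp)).clm_apply contDiff_const, hgs.fderiv_apply ℝ (0, 1),
      fun x y => ?_⟩
    have h1 : HasFDerivAt g (fderiv ℝ g (x, y)) (x, y) :=
      (hg.differentiable (by simp) _).hasFDerivAt
    exact h1.comp_hasDerivAt y ((hasDerivAt_const y x).prodMk (hasDerivAt_id y))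
  obtain ⟨c1, s1, d1⟩ := hd ψ hψ hs
  obtain ⟨c2, s2, d2⟩ := hd _ c1 s1
  obtain ⟨M0, hM0⟩ := hs.exists_bound_of_continuous hψ.continuous
  obtain ⟨M1, hM1⟩ := s1.exists_bound_of_continuous c1.continuous
  obtain ⟨M2, hM2⟩ := s2.exists_bound_of_continuous c2.continuous
  have n0 : 0 ≤ M0 := (norm_nonneg _).trans (hM0 0)
  have n1 : 0 ≤ M1 := (norm_nonneg _).trans (hM1 0)
  have n2 : 0 ≤ M2 := (norm_nonneg _).trans (hM2 0)
  have hR0 : 0 < R := by linarith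
  refine ⟨(M0 + M1 + M2) * R ^ 2, by positivity, fun x r J hr hrR =>
    ⟨_, _, fun y _ => d1 x y, fun y _ => d2 x y, ?_, fun y _ => (hM0 _).trans ?_,
    fun y _ => (hM1 _).trans ?_, fun y _ => (hM2 _).trans ?_⟩⟩
  · exact (c2.continuous.comp (by fun_prop : Continuous fun y : ℝ => (x, y))).continuousOn
  · nlinarith [one_le_pow₀ (n := 2) hR]
  · rw [le_div_iff₀ hr]
    have : r ≤ R ^ 2 := by nlinarith
    nlinarith [mul_nonneg n0 hr.le, mul_nonneg n2 hr.le]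
  · rw [le_div_iff₀ (by positivity)]
    have : r ^ 2 ≤ R ^ 2 := by gcongr
    nlinarith [mul_nonneg n0 (sq_nonneg r), mul_nonneg n1 (sq_nonneg r)]

/-! ### The dyadic partition and its partial sums. -/

/-- The set where `Ψ ≠ 0` is open, hence inside the interior of `[1/2, 2]`; so `Ψ` vanishes at the
endpoints as well, as the integration by parts requires. -/
theorem DampedOsc.IsDyadicCutoff.eq_zero {Ψ : ℝ → ℝ} (h : IsDyadicCutoff Ψ) {t : ℝ}
    (ht : t ∉ Set.Ioo (1 / 2 : ℝ) 2) : Ψ t = 0 := by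
  by_contra h0
  have h1 : Function.support Ψ ⊆ interior (Set.Icc (1 / 2 : ℝ) 2) :=
    interior_maximal ((subset_tsupport Ψ).trans h.support)
      (isOpen_ne_fun h.smooth.continuous continuous_const)
  rw [interior_Icc] at h1
  exact ht (h1 h0)

theorem DampedOsc.IsDyadicCutoff.hasCompactSupport {Ψ : ℝ → ℝ} (h : IsDyadicCutoff Ψ) :
    HasCompactSupport Ψ :=
  isCompact_Icc.of_isClosed_subset (isClosed_tsupport Ψ) h.support

theorem DampedOsc.IsDiagonalCutoff.hasCompactSupport {φ : ℝ → ℝ} (h : IsDiagonalCutoff φ) :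
    HasCompactSupport φ := by
  refine HasCompactSupport.intro (isCompact_Icc (a := -1) (b := 1)) fun t ht => h.eq_zero t ?_
  by_contra h1
  exact ht (abs_le.1 (not_le.1 h1).le)

/-- The endpoints of `(1/2, 2)` have ratio 4, so two contributing exponents differ by at most one,
and a window of three around any of them catches all. -/
theorem DampedOsc.IsDyadicCutoff.exists_finset {Ψ : ℝ → ℝ} (h : IsDyadicCutoff Ψ) (t : ℝ) :
    ∃ F : Finset ℤ, F.card = 3 ∧ ∀ m, Ψ ((2 : ℝ) ^ m * t) ≠ 0 → m ∈ F := by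
  by_cases h0 : ∃ m : ℤ, Ψ ((2 : ℝ) ^ m * t) ≠ 0
  swap
  · push Not at h0
    exact ⟨Finset.Icc 0 2, rfl, fun m hm => absurd (h0 m) hm⟩
  obtain ⟨m₀, hm₀⟩ := h0
  refine ⟨Finset.Icc (m₀ - 1) (m₀ + 1), by simp; omega, fun m hm => ?_⟩
  have hI : ∀ m : ℤ, Ψ ((2 : ℝ) ^ m * t) ≠ 0 → (2 : ℝ) ^ m * t ∈ Set.Ioo (1 / 2 : ℝ) 2 :=
    fun m hm => by
      by_contra h1
      exact hm (h.eq_zero h1)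
  have key : ∀ m m' : ℤ, Ψ ((2 : ℝ) ^ m * t) ≠ 0 → Ψ ((2 : ℝ) ^ m' * t) ≠ 0 → m' ≤ m + 1 := by
    intro m m' hm hm'
    by_contra hlt
    have h1 : (2 : ℝ) ^ (m + 2) ≤ (2 : ℝ) ^ m' := zpow_le_zpow_right₀ (by norm_num) (by omega)
    rw [zpow_add₀ (by norm_num)] at h1
    have h2 := hI m hm
    have h3 := hI m' hm'
    have hp : (0 : ℝ) < 2 ^ m := by positivity
    have ht : 0 < t := by
      by_contra h4
      nlinarith [h2.1]
    have : (2 : ℝ) ^ m * 2 ^ (2 : ℤ) * t ≤ 2 ^ m' * t := by gcongr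
    norm_num at this
    linarith [h2.1, h3.2]
  have := key m₀ m hm₀ hm
  have := key m m₀ hm hm₀
  simp
  omega

/-- A smooth function which on the positive half-line is the tail of the dyadic partition of unity
and which vanishes on the negative half-line outside a prescribed interval. -/
theorem DampedOsc.IsDyadicCutoff.exists_tail {Ψ : ℝ → ℝ} (h : IsDyadicCutoff Ψ) {κ δ : ℝ}
    (hκ : 2 < κ) (hδ : 0 < δ) : ∃ χ : ℝ → ℝ, ContDiff ℝ ∞ χ ∧ HasCompactSupport χ ∧
      (∀ t, t ∉ Set.Ioo (-δ) ((2 : ℝ) ^ (1 - κ)) → χ t = 0) ∧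
      ∀ t, 0 < t → HasSum (fun m : ℤ => if κ < m then Ψ ((2 : ℝ) ^ m * t) else 0) (χ t) := by
  have hκ1 : (2 : ℝ) ^ (1 - κ) ≤ 1 :=
      Real.rpow_le_one_of_one_le_of_nonpos (by norm_num) (by linarith)
  -- For `0 < t < 2` the terms with `m ≤ -2` vanish, so the complement of the tail is a finite sum
  -- and `G` is a smooth expression for the tail.
  set G : ℝ → ℝ := fun t => 1 - ∑ m ∈ Finset.Icc (-1 : ℤ) ⌊κ⌋, Ψ ((2 : ℝ) ^ m * t) with hG
  -- The first transition is 1 on `t ≥ 0` and removes `t ≤ -δ`. The second removes `t ≥ 2`, beyond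
  -- the range where `G` represents the tail; on `[2^{1-κ}, 2)` the function `G` vanishes by itself.
  set χ : ℝ → ℝ := fun t =>
    Real.smoothTransition ((t + δ) / δ) * Real.smoothTransition (2 - t) * G t with hχ
  have hfar : ∀ t, (2 : ℝ) ^ (1 - κ) ≤ t →
      ∀ m : ℤ, (if κ < m then Ψ ((2 : ℝ) ^ m * t) else 0) = 0 := by
    intro t ht m
    split_ifs with hm
    · refine h.eq_zero fun hI => absurd hI.2 (not_lt.2 ?_)
      calc (2 : ℝ) = (2 : ℝ) ^ κ * (2 : ℝ) ^ (1 - κ) := by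
            rw [← Real.rpow_add (by norm_num)]; simp
        _ ≤ (2 : ℝ) ^ (m : ℝ) * t := by
            gcongr
            norm_num
        _ = (2 : ℝ) ^ m * t := by rw [Real.rpow_intCast]
    · rfl
  have hnear : ∀ t, 0 < t → t < 2 →
      HasSum (fun m : ℤ => if κ < m then Ψ ((2 : ℝ) ^ m * t) else 0) (G t) := by
    intro t ht ht2
    have h1 : HasSum (fun m : ℤ => if κ < m then 0 else Ψ ((2 : ℝ) ^ m * t))
        (∑ m ∈ Finset.Icc (-1 : ℤ) ⌊κ⌋, Ψ ((2 : ℝ) ^ m * t)) := by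
      have h2 : HasSum (fun m : ℤ => if κ < m then 0 else Ψ ((2 : ℝ) ^ m * t))
          (∑ m ∈ Finset.Icc (-1 : ℤ) ⌊κ⌋, if κ < m then 0 else Ψ ((2 : ℝ) ^ m * t)) :=
        hasSum_sum_of_ne_finset_zero (fun m hm => by
          split_ifs with hmκ
          · rfl
          · rw [not_lt, ← Int.le_floor] at hmκ
            have hm1 : m ≤ -2 := by
              by_contra h3
              exact hm (Finset.mem_Icc.2 ⟨by omega, hmκ⟩)
            refine h.eq_zero fun hI => absurd hI.1 (not_lt.2 ?_)
            have h3 : (2 : ℝ) ^ m ≤ (2 : ℝ) ^ (-2 : ℤ) := zpow_le_zpow_right₀ (by norm_num) hm1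
            norm_num at h3
            nlinarith)
      rwa [Finset.sum_congr rfl fun m hm =>
        if_neg (not_lt.2 (Int.le_floor.1 (Finset.mem_Icc.1 hm).2))] at h2
    refine ((h.sum_eq_one t ht).sub h1).congr_fun fun m => ?_
    split_ifs <;> simp
  have hright : ∀ t, (2 : ℝ) ^ (1 - κ) ≤ t → χ t = 0 := by
    intro t ht
    rcases lt_or_ge t 2 with h2 | h2
    · have ht0 : 0 < t := lt_of_lt_of_le (by positivity) ht
      have h3 := hnear t ht0 h2
      simp only [hfar t ht] at h3
      simp only [hχ, h3.unique hasSum_zero, mul_zero]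
    · simp [hχ, Real.smoothTransition.zero_of_nonpos (show 2 - t ≤ 0 by linarith)]
  have hleft : ∀ t, t ≤ -δ → χ t = 0 := by
    intro t ht
    have : (t + δ) / δ ≤ 0 := div_nonpos_of_nonpos_of_nonneg (by linarith) hδ.le
    simp [hχ, Real.smoothTransition.zero_of_nonpos this]
  have hout : ∀ t, t ∉ Set.Ioo (-δ) ((2 : ℝ) ^ (1 - κ)) → χ t = 0 := by
    intro t ht
    by_cases h1 : t ≤ -δ
    · exact hleft t h1
    · refine hright t ?_
      by_contra h2
      exact ht ⟨not_le.1 h1, not_le.1 h2⟩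
  refine ⟨χ, ?_, ?_, hout, ?_⟩
  · have hs : ContDiff ℝ ∞ Real.smoothTransition := Real.smoothTransition.contDiff
    have hΨ := h.smooth
    refine ((hs.comp (by fun_prop)).mul (hs.comp (by fun_prop))).mul
      (contDiff_const.sub (ContDiff.sum fun m _ => hΨ.comp (by fun_prop)))
  · exact HasCompactSupport.intro (isCompact_Icc (a := -δ) (b := (2 : ℝ) ^ (1 - κ)))
      fun t ht => hout t fun h1 => ht ⟨h1.1.le, h1.2.le⟩
  · intro t ht
    rcases le_total ((2 : ℝ) ^ (1 - κ)) t with h1 | h1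
    · rw [hright t h1]
      simp only [hfar t h1]
      exact hasSum_zero
    · have e : χ t = G t := by
        simp only [hχ]
        rw [Real.smoothTransition.one_of_one_le (by rw [le_div_iff₀ hδ]; linarith),
          Real.smoothTransition.one_of_one_le (by linarith)]
        ring
      rw [e]
      exact hnear t ht (by linarith)

/-- Sum over `k` first and put `m = k - j`: since `2ᵏy = 2ᵐ(2ʲy)`, the inner sum is the tail
evaluated at `2ʲy`. -/
theorem hasSum_indexX {Ψ χ : ℝ → ℝ} (h : IsDyadicCutoff Ψ) {κ : ℝ}
    (hχ : ∀ t, 0 < t → HasSum (fun m : ℤ => if κ < m then Ψ ((2 : ℝ) ^ m * t) else 0) (χ t))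
    (x : ℝ) {y : ℝ} (hy : 0 < y) : ∃ W : ℝ,
      HasSum ((indexX κ).indicator fun p => Ψ ((2 : ℝ) ^ p.1 * x) * Ψ ((2 : ℝ) ^ p.2 * y)) W ∧
      HasSum (fun j : ℤ => Ψ ((2 : ℝ) ^ j * x) * χ ((2 : ℝ) ^ j * y)) W := by
  classical
  obtain ⟨F, -, hF⟩ := h.exists_finset x
  obtain ⟨F', -, hF'⟩ := h.exists_finset y
  set g : ℤ × ℤ → ℝ :=
    (indexX κ).indicator fun p => Ψ ((2 : ℝ) ^ p.1 * x) * Ψ ((2 : ℝ) ^ p.2 * y) with hg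
  have hgs : HasSum g (∑ p ∈ F ×ˢ F', g p) := by
    refine hasSum_sum_of_ne_finset_zero fun p hp => ?_
    by_contra h0
    have h1 : Ψ ((2 : ℝ) ^ p.1 * x) * Ψ ((2 : ℝ) ^ p.2 * y) ≠ 0 := fun h2 => h0 (by
      rw [hg, Set.indicator_apply]; split_ifs <;> simp [h2])
    exact hp (Finset.mem_product.2 ⟨hF _ (left_ne_zero_of_mul h1), hF' _ (right_ne_zero_of_mul h1)⟩)
  refine ⟨_, hgs, hgs.prod_fiberwise fun j => ?_⟩
  have h1 := (hχ ((2 : ℝ) ^ j * y) (by positivity)).mul_left (Ψ ((2 : ℝ) ^ j * x))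
  rw [← (Equiv.subRight j).hasSum_iff] at h1
  refine h1.congr_fun fun k => ?_
  simp only [hg, Set.indicator_apply, indexX, Set.mem_ofPred_eq, Function.comp_apply,
    Equiv.subRight_apply, Int.cast_sub]
  have e : ((j : ℝ) < k - κ) ↔ (κ < (k : ℝ) - j) := by constructor <;> intro <;> linarith
  simp only [e]
  split_ifs
  · rw [← mul_assoc, ← zpow_add₀ (by norm_num), sub_add_cancel]
  · simp

theorem hasSum_indexY {Ψ χ : ℝ → ℝ} (h : IsDyadicCutoff Ψ) {κ : ℝ}
    (hχ : ∀ t, 0 < t → HasSum (fun m : ℤ => if κ < m then Ψ ((2 : ℝ) ^ m * t) else 0) (χ t))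
    {x : ℝ} (hx : 0 < x) (y : ℝ) : ∃ W : ℝ,
      HasSum ((indexY κ).indicator fun p => Ψ ((2 : ℝ) ^ p.1 * x) * Ψ ((2 : ℝ) ^ p.2 * y)) W ∧
      HasSum (fun k : ℤ => χ ((2 : ℝ) ^ k * x) * Ψ ((2 : ℝ) ^ k * y)) W := by
  classical
  obtain ⟨W, h1, h2⟩ := hasSum_indexX h hχ y hx
  refine ⟨W, ?_, by simpa only [mul_comm] using h2⟩
  rw [← (Equiv.prodComm ℤ ℤ).hasSum_iff]
  refine h1.congr_fun fun p => ?_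
  simp only [Set.indicator_apply, Function.comp_apply, indexX, indexY, Set.mem_ofPred_eq,
    Equiv.prodComm_apply, Prod.fst_swap, Prod.snd_swap]
  have e : ((p.1 : ℝ) < p.2 - κ) ↔ ((p.2 : ℝ) > p.1 + κ) := by constructor <;> intro <;> linarith
  simp only [e]
  split_ifs
  · ring
  · rfl

/-- At most `3 · 3` pairs contribute at a given point. The bound is uniform over finite sets of
pairs, as absolute convergence of the sum of pieces requires. -/
theorem sum_dyadic_le {Ψ : ℝ → ℝ} (h : IsDyadicCutoff Ψ) {M : ℝ} (hM : ∀ t, |Ψ t| ≤ M) (x y : ℝ)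
    {T : Set (ℤ × ℤ)} (s : Finset T) :
    ∑ p ∈ s, |Ψ ((2 : ℝ) ^ p.1.1 * x) * Ψ ((2 : ℝ) ^ p.1.2 * y)| ≤ 9 * M ^ 2 := by
  obtain ⟨F, cF, hF⟩ := h.exists_finset x
  obtain ⟨F', cF', hF'⟩ := h.exists_finset y
  have hM0 : 0 ≤ M := (abs_nonneg _).trans (hM 0)
  set g : ℤ × ℤ → ℝ := fun p => |Ψ ((2 : ℝ) ^ p.1 * x) * Ψ ((2 : ℝ) ^ p.2 * y)| with hg
  have hgs : HasSum g (∑ p ∈ F ×ˢ F', g p) := by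
    refine hasSum_sum_of_ne_finset_zero fun p hp => ?_
    by_contra h0
    have h1 : Ψ ((2 : ℝ) ^ p.1 * x) * Ψ ((2 : ℝ) ^ p.2 * y) ≠ 0 :=
        fun h2 => h0 (by simp only [hg, h2, abs_zero])
    exact hp (Finset.mem_product.2 ⟨hF _ (left_ne_zero_of_mul h1), hF' _ (right_ne_zero_of_mul h1)⟩)
  have h1 := sum_le_hasSum (s.map (Function.Embedding.subtype _)) (fun p _ => abs_nonneg _) hgs
  rw [Finset.sum_map] at h1
  refine h1.trans ?_
  calc ∑ p ∈ F ×ˢ F', g p ≤ ∑ _p ∈ F ×ˢ F', M ^ 2 := by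
        refine Finset.sum_le_sum fun p _ => ?_
        rw [hg]
        simp only
        rw [abs_mul, sq]
        exact mul_le_mul (hM _) (hM _) (abs_nonneg _) hM0
    _ = 9 * M ^ 2 := by
        rw [Finset.sum_const, Finset.card_product, cF, cF', nsmul_eq_mul]
        norm_num

/-! ### Counting the scales. -/

/-- The relevant dyadic scales lie between `λ^{-1/n}` and `1`; there are `O(log λ)` of them. -/
theorem exists_scales {C₁ R : ℝ} (hC₁ : 1 ≤ C₁) (hR : 1 ≤ R) {n : ℕ} (hn : 1 ≤ n) :
    ∃ C : ℝ, 0 < C ∧ ∀ lam : ℝ, 2 ≤ lam → ∃ F : Finset ℤ, (F.card : ℝ) ≤ C * Real.log lam ∧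
      ∀ j : ℤ, j ∈ F ↔ (2 : ℝ) ^ j ≤ C₁ * lam ^ (1 / (n : ℝ)) ∧ ((2 : ℝ) ^ j)⁻¹ ≤ R := by
  have hl2 : 0 < Real.log 2 := Real.log_pos (by norm_num)
  have lC : 0 ≤ Real.log C₁ := Real.log_nonneg hC₁
  have lR : 0 ≤ Real.log R := Real.log_nonneg hR
  -- The number of scales is at most `u + log λ / log 2`, and `λ ≥ 2` absorbs `u` into a multiple of
  -- `log λ`.
  set u := (Real.log C₁ + Real.log R) / Real.log 2 + 1 with hu
  have hu0 : 0 < u := by positivity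
  refine ⟨u / Real.log 2 + 1 / Real.log 2, by positivity, fun lam hlam => ?_⟩
  have hlam0 : 0 < lam := by linarith
  have hll : Real.log 2 ≤ Real.log lam := Real.log_le_log (by norm_num) hlam
  have hn' : (1 : ℝ) ≤ n := by exact_mod_cast hn
  refine ⟨Finset.Icc ⌈-Real.log R / Real.log 2⌉
    ⌊(Real.log C₁ + 1 / n * Real.log lam) / Real.log 2⌋, ?_, fun j => ?_⟩
  · rw [Int.card_Icc]
    have h1 : (⌊(Real.log C₁ + 1 / n * Real.log lam) / Real.log 2⌋ : ℝ) ≤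
        (Real.log C₁ + 1 / n * Real.log lam) / Real.log 2 := Int.floor_le _
    have h2 : -Real.log R / Real.log 2 ≤ (⌈-Real.log R / Real.log 2⌉ : ℝ) := Int.le_ceil _
    have h3 : 1 / (n : ℝ) * Real.log lam ≤ Real.log lam :=
      mul_le_of_le_one_left (by linarith) ((div_le_one (by linarith)).2 hn')
    have h4 : (Real.log C₁ + 1 / n * Real.log lam) / Real.log 2 ≤
        (Real.log C₁ + Real.log lam) / Real.log 2 := by gcongr
    have h5 : u ≤ u / Real.log 2 * Real.log lam := by
      rw [div_mul_eq_mul_div, le_div_iff₀ hl2]; gcongr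
    have h6 : (Real.log C₁ + Real.log lam) / Real.log 2 - -Real.log R / Real.log 2 + 1 =
        u + 1 / Real.log 2 * Real.log lam := by rw [hu]; field_simp; ring
    have h7 : 0 ≤ 1 / Real.log 2 * Real.log lam := by
      have : 0 ≤ Real.log lam := by linarith
      positivity
    set z := ⌊(Real.log C₁ + 1 / n * Real.log lam) / Real.log 2⌋ + 1 -
      ⌈-Real.log R / Real.log 2⌉ with hz
    have h8 : (z : ℝ) ≤ (u / Real.log 2 + 1 / Real.log 2) * Real.log lam := by
      rw [hz]
      push_cast
      rw [add_mul]
      linarith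
    rcases le_total 0 z with h9 | h9
    · calc ((z.toNat : ℕ) : ℝ) = ((z.toNat : ℤ) : ℝ) := by norm_cast
        _ = (z : ℝ) := by rw [Int.toNat_of_nonneg h9]
        _ ≤ _ := h8
    · rw [Int.toNat_of_nonpos h9]
      have : 0 ≤ Real.log lam := by linarith
      simp only [Nat.cast_zero]
      positivity
  · rw [Finset.mem_Icc, and_comm, Int.le_floor, Int.ceil_le, le_div_iff₀ hl2, div_le_iff₀ hl2]
    have hp : (0 : ℝ) < 2 ^ j := by positivity
    have hL : 0 < lam ^ (1 / (n : ℝ)) := by positivity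
    refine and_congr ?_ ?_
    · rw [← Real.log_le_log_iff hp (by positivity), Real.log_zpow,
        Real.log_mul (by positivity) hL.ne', Real.log_rpow hlam0]
    · rw [← Real.log_le_log_iff (inv_pos.2 hp) (by linarith : 0 < R), Real.log_inv, Real.log_zpow]
      constructor <;> intro <;> linarith

/-! ### The amplitude of the damped kernel. -/

noncomputable section

/-- The nonoscillating factor of the damped kernel. -/
def amplitude (N : ℕ) (b : ℕ → ℝ) (K : ℝ × ℝ → ℂ) (φ : ℝ → ℝ) (ψ : ℝ × ℝ → ℂ) (Λ : ℝ) (z : ℂ)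
    (x y : ℝ) : ℂ :=
  K (x, y) * ((|formDeriv N b 0 x y| : ℝ) : ℂ) ^ z * ((1 - φ ((x - y) * Λ) : ℝ) : ℂ) * ψ (x, y)

/-- The oscillating factor of the damped kernel. -/
def phaseFactor (N : ℕ) (a : ℕ → ℝ) (lam x y : ℝ) : ℂ :=
  Complex.exp (Complex.I * ((lam * phaseDeriv N a 0 x y : ℝ) : ℂ))

end

theorem norm_phaseFactor (N : ℕ) (a : ℕ → ℝ) (lam x y : ℝ) : ‖phaseFactor N a lam x y‖ = 1 := by
  rw [phaseFactor, mul_comm Complex.I, Complex.norm_exp_ofReal_mul_I]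

theorem measurable_phaseFactor (N : ℕ) (a : ℕ → ℝ) (lam : ℝ) :
    Measurable (Function.uncurry (phaseFactor N a lam)) := by
  have : Continuous fun p : ℝ × ℝ => phaseDeriv N a 0 p.1 p.2 := by
    unfold phaseDeriv; fun_prop
  unfold phaseFactor
  exact Continuous.measurable (by fun_prop)

theorem continuous_formDeriv (N : ℕ) (b : ℕ → ℝ) (i : ℕ) :
    Continuous fun p : ℝ × ℝ => formDeriv N b i p.1 p.2 := by
  unfold formDeriv; fun_prop

theorem pieceKernel_eq (N : ℕ) (a : ℕ → ℝ) (K : ℝ × ℝ → ℂ) (φ Ψ : ℝ → ℝ) (ψ : ℝ × ℝ → ℂ)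
    (lam : ℝ) (z : ℂ) (j k : ℤ) (x y : ℝ) :
    pieceKernel (N + 2) a K φ Ψ ψ lam z j k x y =
      phaseFactor N a lam x y *
        amplitude N (hessCoeff N a) K φ ψ (lam ^ (1 / ((N + 2 : ℕ) : ℝ))) z x y *
        ((Ψ ((2 : ℝ) ^ j * x) * Ψ ((2 : ℝ) ^ k * y) : ℝ) : ℂ) := by
  unfold pieceKernel phaseFactor amplitude
  rw [mixedHessian_phase, phase_eq_phaseDeriv]
  ring

/-- Each of the four factors is controlled at scale `r`, and three products contribute `64 = 4³`.
The constant is fixed before the form, `K`, `μ`, `Λ`, `A` and `r` are. -/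
theorem exists_amplitude_controlledOn {z : ℂ} (hz : z.re = 1 / 2) {φ : ℝ → ℝ} {ψ : ℝ × ℝ → ℂ}
    (hφ : IsDiagonalCutoff φ) (hψ : ContDiff ℝ ∞ ψ) (hψs : HasCompactSupport ψ)
    {c₀ c C R : ℝ} (hc₀ : 0 < c₀) (hc₀1 : c₀ ≤ 1) (hc : 0 < c) (hC : 0 < C) (hR : 1 ≤ R) :
    ∃ B₀ : ℝ, 0 ≤ B₀ ∧ ∀ (N : ℕ) (b : ℕ → ℝ) (K : ℝ × ℝ → ℂ) (E μ Λ A r x : ℝ) (J : Set ℝ),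
      0 < μ → μ < 1 → IsSingularKernel K E μ → 0 < Λ → 0 < A → 0 < r → r ≤ R →
      (∀ y ∈ J, c₀ * r ≤ |x - y|) →
      (∀ y ∈ J, c * A ≤ |formDeriv N b 0 x y| ∧ ∀ i ≤ 2, |formDeriv N b i x y| ≤ C * A / r ^ i) →
      ControlledOn J (B₀ * (E * √A * r ^ (-μ))) r (amplitude N b K φ ψ Λ z x) := by
  obtain ⟨M, hM0, hM⟩ := exists_deriv_bound hφ.smooth hφ.hasCompactSupport
  obtain ⟨M', hM'0, hM'⟩ := exists_controlledOn_snd hψ hψs hR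
  set T := (1 + ‖z‖ * (C / c + (C / c) ^ 2) + ‖z‖ ^ 2 * (C / c) ^ 2) * √C with hT
  have hT0 : 0 ≤ T := by positivity
  refine ⟨64 * (1 / c₀) ^ 3 * T * ((1 + M) / c₀ ^ 2) * M', by positivity, ?_⟩
  intro N b K E μ Λ A r x J hμ hμ1 hK hΛ hA hr hrR hJ hF
  have hE := hK.const_nonneg
  have h1 := hK.controlledOn hμ hμ1 hr hc₀ hc₀1 hJ
  have h2 := controlledOn_abs_cpow hz hc hC hA hr (hasDerivAt_formDeriv N b 0 x)
    (hasDerivAt_formDeriv N b 1 x)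
    (continuous_iff_continuousAt.2 fun y => (hasDerivAt_formDeriv N b 2 x y).continuousAt)
    (fun y hy => (hF y hy).1) (fun y hy => by simpa using (hF y hy).2 0 (by norm_num))
    (fun y hy => by simpa using (hF y hy).2 1 (by norm_num))
    (fun y hy => by simpa using (hF y hy).2 2 (by norm_num))
  have h3 := hφ.controlledOn hr hc₀ hc₀1 hΛ hM0 hM hJ
  have h := (((h1.mul hr (by positivity) h2).mul hr (by positivity) h3).mul hr (by positivity)
    (hM' x r J hr hrR))
  refine h.mono hr (le_of_eq ?_)
  rw [← hT]
  ring

/-- On the diagonal `K` may take arbitrary values, but there `1 - φ(0) = 0`; so `K` may be replaced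
by zero on it. -/
theorem measurable_amplitude (N : ℕ) (b : ℕ → ℝ) {K : ℝ × ℝ → ℂ} {E μ : ℝ}
    (hK : IsSingularKernel K E μ) {φ : ℝ → ℝ} (hφ : IsDiagonalCutoff φ) {ψ : ℝ × ℝ → ℂ}
    (hψ : ContDiff ℝ ∞ ψ) (Λ : ℝ) (z : ℂ) :
    Measurable (Function.uncurry (amplitude N b K φ ψ Λ z)) := by
  classical
  have hopen : IsOpen {p : ℝ × ℝ | p.1 ≠ p.2} := isOpen_ne_fun continuous_fst continuous_snd
  have hKm : Measurable ({p : ℝ × ℝ | p.1 ≠ p.2}.indicator K) := by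
    rw [← Set.piecewise_eq_indicator]
    exact hK.contDiffOn.continuousOn.measurable_piecewise continuousOn_const hopen.measurableSet
  have e : Function.uncurry (amplitude N b K φ ψ Λ z) = fun p : ℝ × ℝ =>
      {p : ℝ × ℝ | p.1 ≠ p.2}.indicator K p * ((|formDeriv N b 0 p.1 p.2| : ℝ) : ℂ) ^ z *
        ((1 - φ ((p.1 - p.2) * Λ) : ℝ) : ℂ) * ψ p := by
    ext ⟨x, y⟩
    simp only [Function.uncurry_apply_pair, amplitude]
    by_cases hxy : x = y
    · have : φ 0 = 1 := hφ.eq_one 0 (by norm_num)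
      simp [hxy, this]
    · rw [Set.indicator_of_mem (show (x, y) ∈ {p : ℝ × ℝ | p.1 ≠ p.2} from hxy)]
  rw [e]
  have hc := continuous_formDeriv N b 0
  have hφc := hφ.smooth.continuous
  have hH : Measurable fun p : ℝ × ℝ => ((|formDeriv N b 0 p.1 p.2| : ℝ) : ℂ) :=
    Continuous.measurable (by fun_prop)
  have hf : Measurable fun p : ℝ × ℝ => ((1 - φ ((p.1 - p.2) * Λ) : ℝ) : ℂ) :=
    Continuous.measurable (by fun_prop)
  exact ((hKm.mul (hH.pow_const z)).mul hf).mul hψ.continuous.measurable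

/-- Where `1 - φ` is nonzero, `|x - y| ≥ 1/(2Λ)` and `K` is bounded, while `|H|^{1/2}|ψ|` is
continuous with compact support. The bound is not uniform in `λ` and serves only to justify
integrability and exchanges of sum and integral. -/
theorem exists_amplitude_bound (N : ℕ) (b : ℕ → ℝ) {K : ℝ × ℝ → ℂ} {E μ : ℝ} (hμ : 0 < μ)
    (hK : IsSingularKernel K E μ) {φ : ℝ → ℝ} (hφ : IsDiagonalCutoff φ) {ψ : ℝ × ℝ → ℂ}
    (hψ : ContDiff ℝ ∞ ψ) (hψs : HasCompactSupport ψ) {Λ : ℝ} (hΛ : 0 < Λ) {z : ℂ}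
    (hz : z.re = 1 / 2) : ∃ G : ℝ, ∀ x y, ‖amplitude N b K φ ψ Λ z x y‖ ≤ G := by
  have hE := hK.const_nonneg
  have hz0 : z ≠ 0 := fun h => by simp [h] at hz
  obtain ⟨M, hM0, hM⟩ := exists_deriv_bound hφ.smooth hφ.hasCompactSupport
  have hc := continuous_formDeriv N b 0
  obtain ⟨T, hT⟩ := (hψs.mul_left (f := fun p : ℝ × ℝ =>
    ((√|formDeriv N b 0 p.1 p.2| : ℝ) : ℂ))).exists_bound_of_continuous
      (by have := hψ.continuous; fun_prop)
  have hT0 : 0 ≤ T := (norm_nonneg _).trans (hT 0)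
  refine ⟨E * (1 / (2 * Λ)) ^ (-μ) * (1 + M) * T, fun x y => ?_⟩
  have hHz : ‖((|formDeriv N b 0 x y| : ℝ) : ℂ) ^ z‖ = √|formDeriv N b 0 x y| := by
    rcases (abs_nonneg (formDeriv N b 0 x y)).eq_or_lt with h0 | h0
    -- On the zero set of the Hessian, `0 ^ z = 0` because `z ≠ 0`.
    · rw [← h0]; simp [hz0]
    · rw [Complex.norm_cpow_eq_rpow_re_of_pos h0, hz, Real.sqrt_eq_rpow]
  have hTxy := hT (x, y)
  simp only [Pi.mul_apply, norm_mul, Complex.norm_real, Real.norm_eq_abs,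
    abs_of_nonneg (Real.sqrt_nonneg _)] at hTxy
  rw [amplitude, norm_mul, norm_mul, norm_mul, hHz, Complex.norm_real, Real.norm_eq_abs]
  by_cases hsmall : |(x - y) * Λ| ≤ 1 / 2
  · rw [hφ.eq_one _ hsmall]
    simp only [sub_self, abs_zero, mul_zero, zero_mul]
    positivity
  · rw [not_le, abs_mul, abs_of_pos hΛ] at hsmall
    have hd : 1 / (2 * Λ) ≤ |x - y| := by
      rw [div_le_iff₀ (by positivity)]; linarith
    have hd0 : 0 < |x - y| := lt_of_lt_of_le (by positivity) hd
    have hxy : x ≠ y := sub_ne_zero.1 (abs_pos.1 hd0)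
    have hKxy : ‖K (x, y)‖ ≤ E * (1 / (2 * Λ)) ^ (-μ) := by
      have := hK.bound 0 (by norm_num) x y hxy
      simp only [iteratedDeriv_zero, Nat.cast_zero, sub_zero] at this
      exact this.trans (mul_le_mul_of_nonneg_left
        (Real.rpow_le_rpow_of_nonpos (by positivity) hd (by linarith)) hE)
    have h1 : |1 - φ ((x - y) * Λ)| ≤ 1 + M := by
      refine (abs_sub _ _).trans ?_
      simpa using (hM ((x - y) * Λ)).1
    calc ‖K (x, y)‖ * √|formDeriv N b 0 x y| * |1 - φ ((x - y) * Λ)| * ‖ψ (x, y)‖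
        = ‖K (x, y)‖ * |1 - φ ((x - y) * Λ)| * (√|formDeriv N b 0 x y| * ‖ψ (x, y)‖) := by ring
      _ ≤ E * (1 / (2 * Λ)) ^ (-μ) * (1 + M) * T := by gcongr

theorem exists_support_radius {ψ : ℝ × ℝ → ℂ} (hψs : HasCompactSupport ψ) :
    ∃ R : ℝ, 1 ≤ R ∧ ∀ x y, ψ (x, y) ≠ 0 → |x| ≤ R ∧ |y| ≤ R := by
  obtain ⟨R, hR⟩ := hψs.isBounded.exists_norm_le
  refine ⟨max R 1, le_max_right _ _, fun x y h => ?_⟩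
  have h1 := hR (x, y) (subset_tsupport ψ h)
  rw [Prod.norm_def, max_le_iff] at h1
  exact ⟨h1.1.trans (le_max_left _ _), h1.2.trans (le_max_left _ _)⟩

/-! ### Convergence and exchange of sum and integral. -/

/-- A bounded kernel with bounded support in `y` is integrable against `L²` functions. -/
theorem integrable_mul_of_memLp {u f : ℝ → ℂ} {G R : ℝ} (hu : Measurable u)
    (hG : ∀ y, ‖u y‖ ≤ G) (hR : ∀ y, R < |y| → u y = 0) (hf : MemLp f 2 volume) :
    Integrable (fun y => u y * f y) volume := by
  have : IsFiniteMeasure (volume.restrict (Set.Icc (-R) R)) := ⟨by simp⟩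
  have h1 : IntegrableOn f (Set.Icc (-R) R) := (hf.restrict _).integrable (by norm_num)
  have h2 : IntegrableOn (fun y => u y * f y) (Set.Icc (-R) R) :=
    h1.bdd_mul hu.aestronglyMeasurable (Filter.Eventually.of_forall hG)
  refine (integrableOn_iff_integrable_of_support_subset fun y hy => ?_).1 h2
  by_contra h3
  refine hy ?_
  simp only
  rw [hR y, zero_mul]
  by_contra h4
  exact h3 (abs_le.1 (not_lt.1 h4))

/-- Summation of the dyadic pieces under the integral sign. -/
theorem hasSum_integral_dyadic {Ψ : ℝ → ℝ} (hΨ : IsDyadicCutoff Ψ) (T : Set (ℤ × ℤ))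
    {u f : ℝ → ℂ} {G R : ℝ} (hu : Measurable u) (hG : ∀ y, ‖u y‖ ≤ G)
    (hR : ∀ y, R < |y| → u y = 0) (hf : MemLp f 2 volume) (x : ℝ) :
    (∀ p : ℤ × ℤ, Integrable (fun y =>
      u y * ((Ψ ((2 : ℝ) ^ p.1 * x) * Ψ ((2 : ℝ) ^ p.2 * y) : ℝ) : ℂ) * f y) volume) ∧
    HasSum (fun p : T => ∫ y,
      u y * ((Ψ ((2 : ℝ) ^ p.1.1 * x) * Ψ ((2 : ℝ) ^ p.1.2 * y) : ℝ) : ℂ) * f y)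
      (∫ y, u y * ((∑' p : T, Ψ ((2 : ℝ) ^ p.1.1 * x) * Ψ ((2 : ℝ) ^ p.1.2 * y) : ℝ) : ℂ) *
        f y) := by
  obtain ⟨M, hM0, hM⟩ := exists_deriv_bound hΨ.smooth hΨ.hasCompactSupport
  have hΨc := hΨ.smooth.continuous
  have hG0 : 0 ≤ G := (norm_nonneg _).trans (hG 0)
  have hint : ∀ p : ℤ × ℤ, Integrable (fun y =>
      u y * ((Ψ ((2 : ℝ) ^ p.1 * x) * Ψ ((2 : ℝ) ^ p.2 * y) : ℝ) : ℂ) * f y) volume := by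
    intro p
    refine integrable_mul_of_memLp (G := G * (M * M)) (R := R) ?_ (fun y => ?_) (fun y hy => ?_) hf
    · exact hu.mul (Continuous.measurable (by fun_prop))
    · rw [norm_mul, Complex.norm_real, Real.norm_eq_abs, abs_mul]
      have h1 := (hM ((2 : ℝ) ^ p.1 * x)).1
      have h2 := (hM ((2 : ℝ) ^ p.2 * y)).1
      have h3 := hG y
      gcongr
    · rw [hR y hy, zero_mul]
  refine ⟨hint, ?_⟩
  have hbase : Integrable (fun y => u y * f y) volume := integrable_mul_of_memLp hu hG hR hf
  -- The finite overlap of the cut-offs bounds all partial sums by `9M²` times the integral of the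
  -- common factor.
  have hsum : Summable fun p : T => ∫ y,
      ‖u y * ((Ψ ((2 : ℝ) ^ p.1.1 * x) * Ψ ((2 : ℝ) ^ p.1.2 * y) : ℝ) : ℂ) * f y‖ := by
    refine summable_of_sum_le (c := ∫ y, 9 * M ^ 2 * ‖u y * f y‖)
      (fun p => integral_nonneg fun y => norm_nonneg _) fun s => ?_
    rw [← integral_finsetSum _ fun p _ => (hint p.1).norm]
    refine integral_mono (integrable_finsetSum _ fun p _ => (hint p.1).norm)
      (hbase.norm.const_mul _) fun y => ?_
    simp only [norm_mul, Complex.norm_real, Real.norm_eq_abs]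
    have h1 := sum_dyadic_le hΨ (fun t => (hM t).1) x y s
    calc _ = (∑ p ∈ s, |Ψ ((2 : ℝ) ^ p.1.1 * x) * Ψ ((2 : ℝ) ^ p.1.2 * y)|) * (‖u y‖ * ‖f y‖) := by
          rw [Finset.sum_mul]
          exact Finset.sum_congr rfl fun p _ => by rw [abs_mul]; ring
      _ ≤ _ := by gcongr
  have h := hasSum_integral_of_summable_integral_norm (fun p : T => hint p.1) hsum
  simp only [tsum_mul_right, tsum_mul_left, ← Complex.ofReal_tsum] at h
  exact h

/-! ### The damped operator at one scale and the range of scales. -/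

/-- The operator norm at a single dyadic scale. -/
theorem exists_scale_bound (N : ℕ) {z : ℂ} (hz : z.re = 1 / 2) {φ : ℝ → ℝ} {ψ : ℝ × ℝ → ℂ}
    (hφ : IsDiagonalCutoff φ) (hψ : ContDiff ℝ ∞ ψ) (hψs : HasCompactSupport ψ)
    {c₀ c C R M : ℝ} (hc₀ : 0 < c₀) (hc₀1 : c₀ ≤ 1) (hc : 0 < c) (hC : 0 < C) (hR : 1 ≤ R)
    (hM : 0 ≤ M) :
    ∃ D : ℝ, 0 ≤ D ∧ ∀ (a : ℕ → ℝ) (K : ℝ × ℝ → ℂ) (E μ Λ lam A r i₀ i₁ j₀ j₁ : ℝ) (U V : ℝ → ℝ),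
      0 < μ → μ < 1 → IsSingularKernel K E μ → 0 < Λ → 0 < lam → 0 < A → 0 < r → r ≤ R →
      j₀ ≤ j₁ → j₁ - j₀ ≤ 4 * r →
      FormControlled N (hessCoeff N a) (Set.Icc i₀ i₁) (Set.Icc j₀ j₁) c C A r →
      (∀ x ∈ Set.Icc i₀ i₁, ∀ y ∈ Set.Icc j₀ j₁, c₀ * r ≤ |x - y|) →
      Measurable U → Measurable V → (∀ x, |U x| ≤ M) → (∀ x ∉ Set.Icc i₀ i₁, U x = 0) →
      ControlledOn (Set.Icc j₀ j₁) M r (fun y => (V y : ℂ)) → (∀ y ∉ Set.Ioo j₀ j₁, V y = 0) →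
      ∀ f : ℝ → ℂ, MemLp f 2 volume →
        MemLp (fun x => ∫ y, phaseFactor N a lam x y *
          ((U x : ℂ) * ((V y : ℂ) * amplitude N (hessCoeff N a) K φ ψ Λ z x y)) * f y) 2 volume ∧
        eLpNorm (fun x => ∫ y, phaseFactor N a lam x y *
          ((U x : ℂ) * ((V y : ℂ) * amplitude N (hessCoeff N a) K φ ψ Λ z x y)) * f y) 2 volume ≤
          ENNReal.ofReal (D * (E * r ^ (-μ) / √lam)) * eLpNorm f 2 volume := by
  obtain ⟨B₀, hB₀, hamp⟩ := exists_amplitude_controlledOn hz hφ hψ hψs hc₀ hc₀1 hc hC hR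
  obtain ⟨K₀, hK₀, hop⟩ := exists_oscillatory_operator_bound N hc hC
  refine ⟨K₀ * (M * (4 * M * B₀)), by positivity, ?_⟩
  intro a K E μ Λ lam A r i₀ i₁ j₀ j₁ U V hμ hμ1 hK hΛ hlam hA hr hrR hj hjr hF hdist hUm hVm hUM
    hU0 hVc hV0 f hf
  have hE := hK.const_nonneg
  have h := hop a A r lam (M * (4 * M * (B₀ * (E * √A * r ^ (-μ))))) i₀ i₁ j₀ j₁
    (fun x y => (U x : ℂ) * ((V y : ℂ) * amplitude N (hessCoeff N a) K φ ψ Λ z x y)) hA hr hlam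
    (by positivity) hj hjr hF ?_ ?_ ?_ ?_ f hf
  · refine ⟨h.1, h.2.trans (le_of_eq ?_)⟩
    congr 2
    -- The damping pays off here: the `√A` in the size of the amplitude cancels the `√A` lost in the
    -- operator estimate.
    rw [Real.sqrt_mul hlam.le]
    have : √A ≠ 0 := (Real.sqrt_pos.2 hA).ne'
    field_simp
  · refine Measurable.mul (Complex.measurable_ofReal.comp (hUm.comp measurable_fst)) ?_
    exact (Complex.measurable_ofReal.comp (hVm.comp measurable_snd)).mul
      (measurable_amplitude N _ hK hφ hψ Λ z)
  · intro x hx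
    have h1 := hamp N (hessCoeff N a) K E μ Λ A r x (Set.Icc j₀ j₁) hμ hμ1 hK hΛ hA hr hrR
      (hdist x hx) (hF x hx)
    refine ((hVc.mul hr hM h1).const_mul (U x : ℂ)).mono hr ?_
    rw [Complex.norm_real, Real.norm_eq_abs]
    exact mul_le_mul_of_nonneg_right (hUM x) (by positivity)
  · intro x _ y hy
    simp [hV0 y hy]
  · intro x hx y
    simp [hU0 x hx]

theorem memLp_sum_and_eLpNorm_le {ι : Type*} (F : Finset ι) {g : ι → ℝ → ℂ} {D : ℝ}
    {T : ENNReal} (hg : ∀ j ∈ F, MemLp (g j) 2 volume ∧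
      eLpNorm (g j) 2 volume ≤ ENNReal.ofReal D * T) :
    MemLp (fun x => ∑ j ∈ F, g j x) 2 volume ∧
      eLpNorm (fun x => ∑ j ∈ F, g j x) 2 volume ≤ ENNReal.ofReal (F.card * D) * T := by
  refine ⟨memLp_finsetSum F fun j hj => (hg j hj).1, ?_⟩
  have e : (fun x => ∑ j ∈ F, g j x) = ∑ j ∈ F, g j := by ext x; simp
  rw [e]
  refine (eLpNorm_sum_le (fun j hj => (hg j hj).1.1) (by norm_num)).trans ?_
  refine (Finset.sum_le_sum fun j hj => (hg j hj).2).trans (le_of_eq ?_)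
  rw [Finset.sum_const, nsmul_eq_mul, ENNReal.ofReal_mul (by positivity), ENNReal.ofReal_natCast,
    mul_assoc]

/-- For `r = 2⁻ʲ` one has `r^{-μ} = 2^{jμ}`, and `C₁^μ ≤ C₁` keeps the constant independent of `μ`.
-/
theorem scale_rpow_le {C₁ μ lam : ℝ} {n : ℕ} {j : ℤ} (hC₁ : 1 ≤ C₁) (hμ : 0 < μ) (hμ1 : μ < 1)
    (hlam : 0 < lam) (hj : (2 : ℝ) ^ j ≤ C₁ * lam ^ (1 / (n : ℝ))) :
    (((2 : ℝ) ^ j)⁻¹) ^ (-μ) / √lam ≤ C₁ * lam ^ (μ / (n : ℝ) - 1 / 2) := by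
  have hp : (0 : ℝ) < 2 ^ j := by positivity
  rw [Real.rpow_neg (by positivity), Real.inv_rpow hp.le, inv_inv, Real.rpow_sub hlam,
    ← Real.sqrt_eq_rpow, ← mul_div_assoc]
  gcongr
  calc ((2 : ℝ) ^ j) ^ μ ≤ (C₁ * lam ^ (1 / (n : ℝ))) ^ μ := by gcongr
    _ = C₁ ^ μ * lam ^ (μ / (n : ℝ)) := by
      rw [Real.mul_rpow (by linarith) (by positivity), ← Real.rpow_mul hlam.le]
      congr 2
      ring
    _ ≤ C₁ * lam ^ (μ / (n : ℝ)) := by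
      gcongr
      exact Real.rpow_le_self_of_one_le hC₁ hμ1.le

/-- The amplitude vanishes at the scales below the width of the diagonal cut-off. -/
theorem scale_le_of_amplitude_ne_zero {N : ℕ} {b : ℕ → ℝ} {K : ℝ × ℝ → ℂ} {φ : ℝ → ℝ}
    (hφ : IsDiagonalCutoff φ) {ψ : ℝ × ℝ → ℂ} {Λ x y : ℝ} (hΛ : 0 < Λ) {z : ℂ} {j : ℤ}
    (h : amplitude N b K φ ψ Λ z x y ≠ 0) (hxy : |x - y| ≤ 4 * ((2 : ℝ) ^ j)⁻¹) :
    (2 : ℝ) ^ j ≤ 8 * Λ := by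
  by_contra hlt
  rw [not_le] at hlt
  refine h ?_
  have hp : (0 : ℝ) < 2 ^ j := by positivity
  -- The constant 8 is chosen for this: `4r · Λ < 4r · 2ʲ/8 = 1/2`, where `φ = 1`.
  have h1 : |(x - y) * Λ| ≤ 1 / 2 := by
    rw [abs_mul, abs_of_pos hΛ]
    calc |x - y| * Λ ≤ 4 * ((2 : ℝ) ^ j)⁻¹ * (2 ^ j / 8) := by gcongr; linarith
      _ = 1 / 2 := by field_simp; norm_num
  simp [amplitude, hφ.eq_one _ h1]

/-- Convergence of the sum of the pieces, and its value. -/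
theorem hasSum_piece (N : ℕ) (a : ℕ → ℝ) {K : ℝ × ℝ → ℂ} {E μ : ℝ} (hμ : 0 < μ)
    (hK : IsSingularKernel K E μ) {φ Ψ : ℝ → ℝ} (hφ : IsDiagonalCutoff φ) (hΨ : IsDyadicCutoff Ψ)
    {ψ : ℝ × ℝ → ℂ} (hψ : ContDiff ℝ ∞ ψ) (hψs : HasCompactSupport ψ) {lam : ℝ} (hlam : 0 < lam)
    {z : ℂ} (hz : z.re = 1 / 2) (T : Set (ℤ × ℤ)) {f : ℝ → ℂ} (hf : MemLp f 2 volume) :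
    (∀ (j k : ℤ) (x : ℝ), Integrable
      (fun y => pieceKernel (N + 2) a K φ Ψ ψ lam z j k x y * f y) volume) ∧
    (∀ x, HasSum (fun p : T => piece (N + 2) a K φ Ψ ψ lam z p.1.1 p.1.2 f x)
      (∫ y, phaseFactor N a lam x y *
        amplitude N (hessCoeff N a) K φ ψ (lam ^ (1 / ((N + 2 : ℕ) : ℝ))) z x y *
        ((∑' p : T, Ψ ((2 : ℝ) ^ p.1.1 * x) * Ψ ((2 : ℝ) ^ p.1.2 * y) : ℝ) : ℂ) * f y)) ∧
    ∀ (x M : ℝ) (w : ℝ → ℂ), Measurable w → (∀ y, ‖w y‖ ≤ M) → Integrable (fun y =>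
      phaseFactor N a lam x y * (w y *
        amplitude N (hessCoeff N a) K φ ψ (lam ^ (1 / ((N + 2 : ℕ) : ℝ))) z x y) * f y) volume := by
  set Λ := lam ^ (1 / ((N + 2 : ℕ) : ℝ)) with hΛ
  have hΛ0 : 0 < Λ := by positivity
  obtain ⟨G, hG⟩ := exists_amplitude_bound N (hessCoeff N a) hμ hK hφ hψ hψs hΛ0 hz
  obtain ⟨R, -, hR⟩ := exists_support_radius hψs
  have hu : ∀ x, Measurable fun y =>
      phaseFactor N a lam x y * amplitude N (hessCoeff N a) K φ ψ Λ z x y := fun x =>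
    (measurable_phaseFactor N a lam).of_uncurry_left.mul
      (measurable_amplitude N (hessCoeff N a) hK hφ hψ Λ z).of_uncurry_left
  have hb : ∀ x y, ‖phaseFactor N a lam x y * amplitude N (hessCoeff N a) K φ ψ Λ z x y‖ ≤ G :=
    fun x y => by rw [norm_mul, norm_phaseFactor, one_mul]; exact hG x y
  have hsupp : ∀ x y, R < |y| →
      phaseFactor N a lam x y * amplitude N (hessCoeff N a) K φ ψ Λ z x y = 0 := by
    intro x y hy
    have : ψ (x, y) = 0 := by
      by_contra h
      exact absurd (hR x y h).2 (not_le.2 hy)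
    simp [amplitude, this]
  refine ⟨?_, ?_, ?_⟩
  · intro j k x
    simp only [pieceKernel_eq]
    have := (hasSum_integral_dyadic hΨ T (hu x) (hb x) (hsupp x) hf x).1 (j, k)
    exact this
  · intro x
    simp only [piece, pieceKernel_eq]
    exact (hasSum_integral_dyadic hΨ T (hu x) (hb x) (hsupp x) hf x).2
  · intro x M w hw hM
    have e : ∀ y, phaseFactor N a lam x y * (w y * amplitude N (hessCoeff N a) K φ ψ Λ z x y) =
        w y * (phaseFactor N a lam x y * amplitude N (hessCoeff N a) K φ ψ Λ z x y) := fun y => by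
      ring
    have hM0 : 0 ≤ M := (norm_nonneg _).trans (hM 0)
    simp only [e]
    have hm : Measurable fun y => w y *
        (phaseFactor N a lam x y * amplitude N (hessCoeff N a) K φ ψ Λ z x y) := hw.mul (hu x)
    refine integrable_mul_of_memLp (G := M * G) (R := R) hm ?_ ?_ hf
    · intro y
      rw [norm_mul]
      exact mul_le_mul (hM y) (hb x y) (norm_nonneg _) hM0
    · intro y hy
      rw [hsupp x y hy, mul_zero]

/-- A sum over the dyadic scales reduces to the scales on which the amplitude is present. -/
theorem mul_tsum_eq_sum_mul {T : Set (ℤ × ℤ)} {g : ℤ × ℤ → ℝ} {h : ℤ → ℝ} {W : ℝ} {A : ℂ}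
    (h1 : HasSum (T.indicator g) W) (h2 : HasSum h W) {F : Finset ℤ}
    (hF : ∀ j ∉ F, h j ≠ 0 → A = 0) :
    A * ((∑' p : T, g p : ℝ) : ℂ) = ∑ j ∈ F, (h j : ℂ) * A := by
  have e1 : ∑' p : T, g p = W := by
    rw [← hasSum_subtype_iff_indicator] at h1
    exact h1.tsum_eq
  rw [e1]
  have h3 : HasSum (fun j => (h j : ℂ) * A) ((W : ℂ) * A) :=
    ((Complex.hasSum_ofReal (L := .unconditional ℤ)).2 h2).mul_right A
  have h4 : HasSum (fun j => (h j : ℂ) * A) (∑ j ∈ F, (h j : ℂ) * A) :=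
    hasSum_sum_of_ne_finset_zero fun j hj => by
      by_cases h0 : h j = 0
      · simp [h0]
      · simp [hF j hj h0]
  rw [mul_comm, h3.unique h4]

theorem mul_mem_Ioo_iff_of_inv {s r t c d : ℝ} (hr : 0 < r) (hs : s * r = 1) :
    s * t ∈ Set.Ioo c d ↔ t ∈ Set.Ioo (c * r) (d * r) := by
  have hs0 : 0 < s := by
    by_contra h
    nlinarith
  have e : t = s * t * r := by rw [mul_right_comm, hs, one_mul]
  constructor
  · intro h
    rw [e]
    exact ⟨by have := h.1; gcongr, by have := h.2; gcongr⟩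
  · intro h
    rw [e] at h
    exact ⟨lt_of_mul_lt_mul_right h.1 hr.le, lt_of_mul_lt_mul_right h.2 hr.le⟩

theorem card_mul_scale_le {Cs D C₁ E L X Y : ℝ} {k : ℕ} (hk : (k : ℝ) ≤ Cs * L) (hL : 0 ≤ L)
    (hCs : 0 < Cs) (hD : 0 ≤ D) (hE : 0 ≤ E) (hY : 0 ≤ Y) (hC₁ : 0 ≤ C₁) (hX : X ≤ C₁ * Y) :
    (k : ℝ) * (D * (E * X)) ≤ (Cs * (D * (|E| * C₁)) + 1) * Y * L := by
  rw [abs_of_nonneg hE]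
  calc (k : ℝ) * (D * (E * X)) ≤ (Cs * L) * (D * (E * (C₁ * Y))) := by
        rcases le_total 0 X with h | h
        · gcongr
        · refine le_trans (mul_nonpos_of_nonneg_of_nonpos (by positivity) ?_) (by positivity)
          exact mul_nonpos_of_nonneg_of_nonpos hD (mul_nonpos_of_nonneg_of_nonpos hE h)
    _ ≤ (Cs * L) * (D * (E * (C₁ * Y))) + Y * L := le_add_of_nonneg_right (by positivity)
    _ = _ := by ring

/-! ### Summation over the scales for `T_X` and `T_Y`. -/

/-- After summation over `k`, scale `j` is an operator with cut-off `Ψ(2ʲx)` in `x` and `χ(2ʲy)` in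
`y`. The delicate point is `y = 0`: the merged cut-off must be smooth in `y` across it, although the
original sum lives on `y > 0`. -/
theorem exists_dampedX_bound (N : ℕ) (E : ℝ) {κ : ℝ} (hκ : 2 < κ) {z : ℂ} (hz : z.re = 1 / 2)
    {φ Ψ : ℝ → ℝ} {ψ : ℝ × ℝ → ℂ} (hφ : IsDiagonalCutoff φ) (hΨ : IsDyadicCutoff Ψ)
    (hψ : ContDiff ℝ ∞ ψ) (hψs : HasCompactSupport ψ) :
    ∃ C : ℝ, 0 < C ∧ ∀ a : ℕ → ℝ, hessCoeff N a 0 ≠ 0 →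
      IsDominating (formDeriv N (hessCoeff N a) 0) κ →
      ∀ (μ : ℝ) (K : ℝ × ℝ → ℂ), 0 < μ → μ < 1 → IsSingularKernel K E μ →
      ∀ lam : ℝ, 2 ≤ lam → ∀ f : ℝ → ℂ, MemLp f 2 volume →
        MemLp (dampedX (N + 2) a K φ Ψ ψ lam κ z f) 2 volume ∧
        eLpNorm (dampedX (N + 2) a K φ Ψ ψ lam κ z f) 2 volume ≤
          ENNReal.ofReal (C * lam ^ (μ / ((N + 2 : ℕ) : ℝ) - 1 / 2) * Real.log lam) *
            eLpNorm f 2 volume := by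
  obtain ⟨c, C, δ, hc, hC, hδ, hδ1, hform⟩ := IsDominating.exists_formControlled_right N hκ
  obtain ⟨χ, hχs, hχc, hχ0, hχsum⟩ := hΨ.exists_tail hκ hδ
  obtain ⟨R, hR1, hR⟩ := exists_support_radius hψs
  obtain ⟨M₁, hM₁0, hM₁⟩ := exists_deriv_bound hΨ.smooth hΨ.hasCompactSupport
  obtain ⟨M₂, hM₂0, hM₂⟩ := exists_deriv_bound hχs hχc
  set M := max M₁ M₂ with hM
  have hM0 : 0 ≤ M := hM₁0.trans (le_max_left _ _)
  have hθ : (2 : ℝ) ^ (1 - κ) < 1 / 2 := by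
    calc (2 : ℝ) ^ (1 - κ) < (2 : ℝ) ^ (-1 : ℝ) :=
          Real.rpow_lt_rpow_of_exponent_lt (by norm_num) (by linarith)
      _ = 1 / 2 := by rw [Real.rpow_neg_one]; norm_num
  have hθ0 : 0 < (2 : ℝ) ^ (1 - κ) := by positivity
  set θ := (2 : ℝ) ^ (1 - κ) with hθdef
  -- From `x ≥ r/2` and `y ≤ θr` the distance to the diagonal is at least `(1/2 - θ)r`, positive
  -- since `κ > 2`. From `r/2 < x ≤ R` comes `r ≤ 2R`.
  obtain ⟨D, hD0, hD⟩ := exists_scale_bound N hz hφ hψ hψs (c₀ := 1 / 2 - θ) (c := c) (C := C)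
    (R := 2 * R) (M := M) (by linarith) (by linarith) hc hC (by linarith) hM0
  obtain ⟨Cs, hCs0, hCs⟩ := exists_scales (C₁ := 8) (R := 2 * R) (by norm_num) (by linarith)
    (n := N + 2) (by omega)
  -- The constant is chosen before any kernel is given, when the sign of `E` is not yet known; hence
  -- `|E|`. The `+ 1` makes it positive.
  refine ⟨Cs * (D * (|E| * 8)) + 1, by positivity, ?_⟩
  intro a ha hdom μ K hμ hμ1 hK lam hlam f hf
  have hlam0 : 0 < lam := by linarith
  have hE := hK.const_nonneg
  obtain ⟨F, hFcard, hF⟩ := hCs lam hlam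
  set Λ := lam ^ (1 / ((N + 2 : ℕ) : ℝ)) with hΛ
  have hΛ0 : 0 < Λ := by positivity
  -- The sharp restriction to `y > 0` is put on `f`, where it costs no norm. The kernel is then free
  -- to keep the smooth extension `χ` on the negative side.
  set f₁ := (Set.Ioi (0 : ℝ)).indicator f with hf₁
  have hf₁2 : MemLp f₁ 2 volume := hf.indicator measurableSet_Ioi
  obtain ⟨-, hsum, -⟩ := hasSum_piece N a hμ hK hφ hΨ hψ hψs hlam0 hz (indexX κ) hf
  obtain ⟨-, -, hint⟩ := hasSum_piece N a hμ hK hφ hΨ hψ hψs hlam0 hz (indexX κ) hf₁2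
  have hpt : ∀ x y, phaseFactor N a lam x y * amplitude N (hessCoeff N a) K φ ψ Λ z x y *
      ((∑' p : indexX κ, Ψ ((2 : ℝ) ^ p.1.1 * x) * Ψ ((2 : ℝ) ^ p.1.2 * y) : ℝ) : ℂ) * f y =
      ∑ j ∈ F, phaseFactor N a lam x y * (((Ψ ((2 : ℝ) ^ j * x) : ℝ) : ℂ) *
        (((χ ((2 : ℝ) ^ j * y) : ℝ) : ℂ) * amplitude N (hessCoeff N a) K φ ψ Λ z x y)) * f₁ y := by
    intro x y
    rcases le_or_gt y 0 with hy | hy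
    · have h0 : ∀ k : ℤ, Ψ ((2 : ℝ) ^ k * y) = 0 := fun k => hΨ.eq_zero fun h => by
        have : (0 : ℝ) < 2 ^ k := by positivity
        nlinarith [h.1]
      simp [h0, hf₁, Set.indicator_of_notMem (show y ∉ Set.Ioi (0 : ℝ) from not_lt.2 hy)]
    · rw [hf₁, Set.indicator_of_mem (show y ∈ Set.Ioi (0 : ℝ) from hy)]
      obtain ⟨W, h1, h2⟩ := hasSum_indexX hΨ hχsum x hy
      have := mul_tsum_eq_sum_mul (A := amplitude N (hessCoeff N a) K φ ψ Λ z x y) h1 h2 (F := F)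
        fun j hj h3 => by
          by_contra h4
          refine hj ((hF j).2 ?_)
          have hp : (0 : ℝ) < 2 ^ j := by positivity
          have hrs : (2 : ℝ) ^ j * ((2 : ℝ) ^ j)⁻¹ = 1 := mul_inv_cancel₀ hp.ne'
          have hr : 0 < ((2 : ℝ) ^ j)⁻¹ := by positivity
          have hx1 : (2 : ℝ) ^ j * x ∈ Set.Ioo (1 / 2 : ℝ) 2 := by
            by_contra h5
            exact left_ne_zero_of_mul h3 (hΨ.eq_zero h5)
          have hy1 : (2 : ℝ) ^ j * y ∈ Set.Ioo (-δ) θ := by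
            by_contra h5
            exact right_ne_zero_of_mul h3 (hχ0 _ h5)
          rw [mul_mem_Ioo_iff_of_inv hr hrs] at hx1 hy1
          have hψ0 : ψ (x, y) ≠ 0 := fun h5 => h4 (by simp [amplitude, h5])
          constructor
          · refine scale_le_of_amplitude_ne_zero hφ hΛ0 h4 (abs_le.2 ⟨?_, ?_⟩)
            · nlinarith [hx1.1, hy1.2]
            · nlinarith [hx1.2, hy1.1]
          · have := (le_abs_self x).trans (hR x y hψ0).1
            linarith [hx1.1]
      rw [mul_assoc (phaseFactor N a lam x y), this, Finset.mul_sum, Finset.sum_mul]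
      refine Finset.sum_congr rfl fun j _ => ?_
      push_cast
      ring
  set g : ℤ → ℝ → ℂ := fun j x => ∫ y,
      phaseFactor N a lam x y * (((Ψ ((2 : ℝ) ^ j * x) : ℝ) : ℂ) *
        (((χ ((2 : ℝ) ^ j * y) : ℝ) : ℂ) *
          amplitude N (hessCoeff N a) K φ ψ Λ z x y)) * f₁ y with hg
  have heq : dampedX (N + 2) a K φ Ψ ψ lam κ z f = fun x => ∑ j ∈ F, g j x := by
    ext x
    simp only [hg]
    rw [dampedX, (hsum x).tsum_eq, ← integral_finsetSum]
    · exact integral_congr_ae (Filter.Eventually.of_forall fun y => hpt x y)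
    · intro j _
      have hχcont := hχs.continuous
      have := hint x (M * M) (fun y => ((Ψ ((2 : ℝ) ^ j * x) : ℝ) : ℂ) *
        ((χ ((2 : ℝ) ^ j * y) : ℝ) : ℂ)) (Continuous.measurable (by fun_prop)) fun y => by
          rw [norm_mul, Complex.norm_real, Complex.norm_real, Real.norm_eq_abs, Real.norm_eq_abs]
          exact mul_le_mul ((hM₁ _).1.trans (le_max_left _ _)) ((hM₂ _).1.trans (le_max_right _ _))
            (abs_nonneg _) hM0
      simpa only [mul_assoc] using this
  rw [heq]
  have hlog : 0 ≤ Real.log lam := Real.log_nonneg (by linarith)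
  have hscale : ∀ j ∈ F, MemLp (g j) 2 volume ∧ eLpNorm (g j) 2 volume ≤
      ENNReal.ofReal (D * (E * (8 * lam ^ (μ / ((N + 2 : ℕ) : ℝ) - 1 / 2)))) *
        eLpNorm f₁ 2 volume := by
    intro j hj
    have hp : (0 : ℝ) < 2 ^ j := by positivity
    have hrs : (2 : ℝ) ^ j * ((2 : ℝ) ^ j)⁻¹ = 1 := mul_inv_cancel₀ hp.ne'
    set r := ((2 : ℝ) ^ j)⁻¹ with hr
    have hr0 : 0 < r := by positivity
    have hΨcont := hΨ.smooth.continuous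
    have hχcont := hχs.continuous
    have hb := hD a K E μ Λ lam (|hessCoeff N a 0| * r ^ N) r (r / 2) (2 * r) (-δ * r) (θ * r)
      (fun x => Ψ ((2 : ℝ) ^ j * x)) (fun y => χ ((2 : ℝ) ^ j * y)) hμ hμ1 hK hΛ0 hlam0
      (by positivity) hr0 ((hF j).1 hj).2 (by nlinarith) (by nlinarith)
      (hform _ hdom r hr0)
      (fun x hx y hy => le_trans (by nlinarith [hx.1, hy.2]) (le_abs_self _))
      (Continuous.measurable (by fun_prop)) (Continuous.measurable (by fun_prop))
      (fun x => (hM₁ _).1.trans (le_max_left _ _))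
      (fun x hx => hΨ.eq_zero fun h => hx (by
        rw [mul_mem_Ioo_iff_of_inv hr0 hrs] at h
        exact ⟨by linarith [h.1], h.2.le⟩))
      ((controlledOn_comp_mul hχs hr0 hrs hM₂ _).mono hr0 (le_max_right _ _))
      (fun y hy => hχ0 _ fun h => hy ((mul_mem_Ioo_iff_of_inv hr0 hrs).1 h)) f₁ hf₁2
    refine ⟨hb.1, hb.2.trans (mul_le_mul' (ENNReal.ofReal_le_ofReal ?_) le_rfl)⟩
    have := scale_rpow_le (n := N + 2) (by norm_num) hμ hμ1 hlam0 ((hF j).1 hj).1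
    rw [mul_div_assoc]
    gcongr
  obtain ⟨h1, h2⟩ := memLp_sum_and_eLpNorm_le F hscale
  refine ⟨h1, h2.trans (mul_le_mul' (ENNReal.ofReal_le_ofReal ?_)
    (eLpNorm_indicator_le f))⟩
  exact card_mul_scale_le hFcard hlog hCs0 hD0 hE (by positivity) (by norm_num) le_rfl

/-- Now `y ∼ r` carries the smooth cut-off `Ψ` and `x` the merged one. Since nothing is integrated
by parts in `x`, the jump at `x = 0` needs no smoothing and `f` need not be restricted. -/
theorem exists_dampedY_bound (N : ℕ) (E : ℝ) {κ : ℝ} (hκ : 2 < κ) {z : ℂ} (hz : z.re = 1 / 2)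
    {φ Ψ : ℝ → ℝ} {ψ : ℝ × ℝ → ℂ} (hφ : IsDiagonalCutoff φ) (hΨ : IsDyadicCutoff Ψ)
    (hψ : ContDiff ℝ ∞ ψ) (hψs : HasCompactSupport ψ) :
    ∃ C : ℝ, 0 < C ∧ ∀ a : ℕ → ℝ, hessCoeff N a N ≠ 0 →
      IsDominating (formDeriv N (hessCoeff N a) 0) κ →
      ∀ (μ : ℝ) (K : ℝ × ℝ → ℂ), 0 < μ → μ < 1 → IsSingularKernel K E μ →
      ∀ lam : ℝ, 2 ≤ lam → ∀ f : ℝ → ℂ, MemLp f 2 volume →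
        MemLp (dampedY (N + 2) a K φ Ψ ψ lam κ z f) 2 volume ∧
        eLpNorm (dampedY (N + 2) a K φ Ψ ψ lam κ z f) 2 volume ≤
          ENNReal.ofReal (C * lam ^ (μ / ((N + 2 : ℕ) : ℝ) - 1 / 2) * Real.log lam) *
            eLpNorm f 2 volume := by
  obtain ⟨c, C, hc, hC, hform⟩ := IsDominating.exists_formControlled_left N hκ
  -- The width 1 of the extension is immaterial: its negative part is cut off in `U` below.
  obtain ⟨χ, hχs, hχc, hχ0, hχsum⟩ := hΨ.exists_tail hκ one_pos
  obtain ⟨R, hR1, hR⟩ := exists_support_radius hψs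
  obtain ⟨M₁, hM₁0, hM₁⟩ := exists_deriv_bound hΨ.smooth hΨ.hasCompactSupport
  obtain ⟨M₂, hM₂0, hM₂⟩ := exists_deriv_bound hχs hχc
  set M := max M₁ M₂ with hM
  have hM0 : 0 ≤ M := hM₁0.trans (le_max_left _ _)
  have hθ : (2 : ℝ) ^ (1 - κ) < 1 / 2 := by
    calc (2 : ℝ) ^ (1 - κ) < (2 : ℝ) ^ (-1 : ℝ) :=
          Real.rpow_lt_rpow_of_exponent_lt (by norm_num) (by linarith)
      _ = 1 / 2 := by rw [Real.rpow_neg_one]; norm_num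
  have hθ0 : 0 < (2 : ℝ) ^ (1 - κ) := by positivity
  set θ := (2 : ℝ) ^ (1 - κ) with hθdef
  obtain ⟨D, hD0, hD⟩ := exists_scale_bound N hz hφ hψ hψs (c₀ := 1 / 2 - θ) (c := c) (C := C)
    (R := 2 * R) (M := M) (by linarith) (by linarith) hc hC (by linarith) hM0
  obtain ⟨Cs, hCs0, hCs⟩ := exists_scales (C₁ := 8) (R := 2 * R) (by norm_num) (by linarith)
    (n := N + 2) (by omega)
  refine ⟨Cs * (D * (|E| * 8)) + 1, by positivity, ?_⟩
  intro a ha hdom μ K hμ hμ1 hK lam hlam f hf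
  have hlam0 : 0 < lam := by linarith
  have hE := hK.const_nonneg
  obtain ⟨F, hFcard, hF⟩ := hCs lam hlam
  set Λ := lam ^ (1 / ((N + 2 : ℕ) : ℝ)) with hΛ
  have hΛ0 : 0 < Λ := by positivity
  obtain ⟨-, hsum, hint⟩ := hasSum_piece N a hμ hK hφ hΨ hψ hψs hlam0 hz (indexY κ) hf
  -- In `x` only measurability and boundedness of the cut-off are required, so it may be truncated
  -- sharply to `x > 0`.
  set U : ℤ → ℝ → ℝ := fun k => (Set.Ioi (0 : ℝ)).indicator fun x => χ ((2 : ℝ) ^ k * x) with hU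
  have hUM : ∀ k x, |U k x| ≤ M := by
    intro k x
    simp only [hU, Set.indicator_apply]
    split_ifs
    · exact (hM₂ _).1.trans (le_max_right _ _)
    · simpa using hM0
  have hpt : ∀ x y, phaseFactor N a lam x y * amplitude N (hessCoeff N a) K φ ψ Λ z x y *
      ((∑' p : indexY κ, Ψ ((2 : ℝ) ^ p.1.1 * x) * Ψ ((2 : ℝ) ^ p.1.2 * y) : ℝ) : ℂ) * f y =
      ∑ j ∈ F, phaseFactor N a lam x y * (((U j x : ℝ) : ℂ) *
        (((Ψ ((2 : ℝ) ^ j * y) : ℝ) : ℂ) * amplitude N (hessCoeff N a) K φ ψ Λ z x y)) * f y := by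
    intro x y
    rcases le_or_gt x 0 with hx | hx
    · have h0 : ∀ k : ℤ, Ψ ((2 : ℝ) ^ k * x) = 0 := fun k => hΨ.eq_zero fun h => by
        have : (0 : ℝ) < 2 ^ k := by positivity
        nlinarith [h.1]
      simp [h0, hU, Set.indicator_of_notMem (show x ∉ Set.Ioi (0 : ℝ) from not_lt.2 hx)]
    · simp only [hU, Set.indicator_of_mem (show x ∈ Set.Ioi (0 : ℝ) from hx)]
      obtain ⟨W, h1, h2⟩ := hasSum_indexY hΨ hχsum hx y
      have := mul_tsum_eq_sum_mul (A := amplitude N (hessCoeff N a) K φ ψ Λ z x y) h1 h2 (F := F)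
        fun j hj h3 => by
          by_contra h4
          refine hj ((hF j).2 ?_)
          have hp : (0 : ℝ) < 2 ^ j := by positivity
          have hrs : (2 : ℝ) ^ j * ((2 : ℝ) ^ j)⁻¹ = 1 := mul_inv_cancel₀ hp.ne'
          have hr : 0 < ((2 : ℝ) ^ j)⁻¹ := by positivity
          have hy1 : (2 : ℝ) ^ j * y ∈ Set.Ioo (1 / 2 : ℝ) 2 := by
            by_contra h5
            exact right_ne_zero_of_mul h3 (hΨ.eq_zero h5)
          have hx1 : (2 : ℝ) ^ j * x ∈ Set.Ioo (-1) θ := by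
            by_contra h5
            exact left_ne_zero_of_mul h3 (hχ0 _ h5)
          rw [mul_mem_Ioo_iff_of_inv hr hrs] at hx1 hy1
          have hψ0 : ψ (x, y) ≠ 0 := fun h5 => h4 (by simp [amplitude, h5])
          constructor
          · refine scale_le_of_amplitude_ne_zero hφ hΛ0 h4 (abs_le.2 ⟨?_, ?_⟩)
            · nlinarith [hy1.2]
            · nlinarith [hx1.2, hy1.1]
          · have := (le_abs_self y).trans (hR x y hψ0).2
            linarith [hy1.1]
      rw [mul_assoc (phaseFactor N a lam x y), this, Finset.mul_sum, Finset.sum_mul]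
      refine Finset.sum_congr rfl fun j _ => ?_
      push_cast
      ring
  set g : ℤ → ℝ → ℂ := fun j x => ∫ y,
      phaseFactor N a lam x y * (((U j x : ℝ) : ℂ) *
        (((Ψ ((2 : ℝ) ^ j * y) : ℝ) : ℂ) *
          amplitude N (hessCoeff N a) K φ ψ Λ z x y)) * f y with hg
  have heq : dampedY (N + 2) a K φ Ψ ψ lam κ z f = fun x => ∑ j ∈ F, g j x := by
    ext x
    simp only [hg]
    rw [dampedY, (hsum x).tsum_eq, ← integral_finsetSum]
    · exact integral_congr_ae (Filter.Eventually.of_forall fun y => hpt x y)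
    · intro j _
      have hΨcont := hΨ.smooth.continuous
      have := hint x (M * M) (fun y => ((U j x : ℝ) : ℂ) * ((Ψ ((2 : ℝ) ^ j * y) : ℝ) : ℂ))
        (Continuous.measurable (by fun_prop)) fun y => by
          rw [norm_mul, Complex.norm_real, Complex.norm_real, Real.norm_eq_abs, Real.norm_eq_abs]
          exact mul_le_mul (hUM j x) ((hM₁ _).1.trans (le_max_left _ _)) (abs_nonneg _) hM0
      simpa only [mul_assoc] using this
  rw [heq]
  have hlog : 0 ≤ Real.log lam := Real.log_nonneg (by linarith)
  have hscale : ∀ j ∈ F, MemLp (g j) 2 volume ∧ eLpNorm (g j) 2 volume ≤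
      ENNReal.ofReal (D * (E * (8 * lam ^ (μ / ((N + 2 : ℕ) : ℝ) - 1 / 2)))) *
        eLpNorm f 2 volume := by
    intro j hj
    have hp : (0 : ℝ) < 2 ^ j := by positivity
    have hrs : (2 : ℝ) ^ j * ((2 : ℝ) ^ j)⁻¹ = 1 := mul_inv_cancel₀ hp.ne'
    set r := ((2 : ℝ) ^ j)⁻¹ with hr
    have hr0 : 0 < r := by positivity
    have hΨcont := hΨ.smooth.continuous
    have hχcont := hχs.continuous
    have hUm : Measurable (U j) :=
      (Continuous.measurable (by fun_prop : Continuous fun x => χ ((2 : ℝ) ^ j * x))).indicator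
        measurableSet_Ioi
    have hb := hD a K E μ Λ lam (|hessCoeff N a N| * r ^ N) r 0 (θ * r) (r / 2) (2 * r)
      (U j) (fun y => Ψ ((2 : ℝ) ^ j * y)) hμ hμ1 hK hΛ0 hlam0
      (by positivity) hr0 ((hF j).1 hj).2 (by linarith) (by linarith)
      (hform _ hdom r hr0)
      (fun x hx y hy => le_trans (by nlinarith [hx.2, hy.1]) (neg_le_abs _))
      hUm (Continuous.measurable (by fun_prop)) (hUM j)
      (fun x hx => by
        simp only [hU, Set.indicator_apply]
        split_ifs with hx0
        · refine hχ0 _ fun h => hx ?_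
          rw [mul_mem_Ioo_iff_of_inv hr0 hrs] at h
          exact ⟨le_of_lt hx0, h.2.le⟩
        · rfl)
      ((controlledOn_comp_mul hΨ.smooth hr0 hrs hM₁ _).mono hr0 (le_max_left _ _))
      (fun y hy => hΨ.eq_zero fun h => hy (by
        rw [mul_mem_Ioo_iff_of_inv hr0 hrs] at h
        exact ⟨by linarith [h.1], h.2⟩)) f hf
    refine ⟨hb.1, hb.2.trans (mul_le_mul' (ENNReal.ofReal_le_ofReal ?_) le_rfl)⟩
    have := scale_rpow_le (n := N + 2) (by norm_num) hμ hμ1 hlam0 ((hF j).1 hj).1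
    rw [mul_div_assoc]
    gcongr
  obtain ⟨h1, h2⟩ := memLp_sum_and_eLpNorm_le F hscale
  refine ⟨h1, h2.trans (mul_le_mul' (ENNReal.ofReal_le_ofReal ?_) le_rfl)⟩
  exact card_mul_scale_le hFcard hlog hCs0 hD0 hE (by positivity) (by norm_num) le_rfl

/-! ### The main theorem. -/

theorem theorem7p2 :
    -- every admissible phase has admissible separation constants: all sufficiently large ones
    (∀ (n : ℕ) (a : ℕ → ℝ), 2 ≤ n → HasHessianForm (mixedHessian (phase n a)) →
      ∃ κ₀ : ℝ, ∀ κ : ℝ, κ₀ ≤ κ → IsDominating (mixedHessian (phase n a)) κ) ∧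
    -- the damped estimates; the constant depends only on what is quantified before it
    (∀ (n : ℕ) (E κ : ℝ) (z : ℂ) (φ Ψ : ℝ → ℝ) (ψ : ℝ × ℝ → ℂ),
      2 ≤ n → z.re = 1 / 2 → IsDiagonalCutoff φ → IsDyadicCutoff Ψ →
      ContDiff ℝ ∞ ψ → HasCompactSupport ψ →
      ∃ C : ℝ, 0 < C ∧
        ∀ a : ℕ → ℝ, HasHessianForm (mixedHessian (phase n a)) →
          IsDominating (mixedHessian (phase n a)) κ →
        ∀ (μ : ℝ) (K : ℝ × ℝ → ℂ), 0 < μ → μ < 1 → IsSingularKernel K E μ →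
        ∀ lam : ℝ, 2 ≤ lam → ∀ f : ℝ → ℂ, MemLp f 2 volume →
          (∀ (j k : ℤ) (x : ℝ),
            Integrable (fun y => pieceKernel n a K φ Ψ ψ lam z j k x y * f y) volume) ∧
          ((∀ x : ℝ, Summable fun p : indexY κ => piece n a K φ Ψ ψ lam z p.1.1 p.1.2 f x) ∧
            MemLp (dampedY n a K φ Ψ ψ lam κ z f) 2 volume ∧
            eLpNorm (dampedY n a K φ Ψ ψ lam κ z f) 2 volume ≤
              ENNReal.ofReal (C * lam ^ (μ / (n : ℝ) - 1 / 2) * Real.log lam) *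
                eLpNorm f 2 volume) ∧
          ((∀ x : ℝ, Summable fun p : indexX κ => piece n a K φ Ψ ψ lam z p.1.1 p.1.2 f x) ∧
            MemLp (dampedX n a K φ Ψ ψ lam κ z f) 2 volume ∧
            eLpNorm (dampedX n a K φ Ψ ψ lam κ z f) 2 volume ≤
              ENNReal.ofReal (C * lam ^ (μ / (n : ℝ) - 1 / 2) * Real.log lam) *
                eLpNorm f 2 volume)) := by
  constructor
  · intro n a hn hH
    obtain ⟨N, rfl⟩ := Nat.exists_eq_add_of_le' hn
    rw [show mixedHessian (phase (N + 2) a) = formDeriv N (hessCoeff N a) 0 from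
      funext₂ (mixedHessian_phase N a)] at hH ⊢
    exact exists_isDominating hH.coeff_ne_zero.1 hH.coeff_ne_zero.2
  · intro n E κ z φ Ψ ψ hn hz hφ hΨ hψ hψs
    obtain ⟨N, rfl⟩ := Nat.exists_eq_add_of_le' hn
    by_cases hκ : 2 < κ
    swap
    -- For `κ ≤ 2` there is no admissible phase, so any constant will do.
    · exact ⟨1, one_pos, fun a _ h => absurd h.1 hκ⟩
    obtain ⟨C₁, hC₁, hX⟩ := exists_dampedX_bound N E hκ hz hφ hΨ hψ hψs
    obtain ⟨C₂, hC₂, hY⟩ := exists_dampedY_bound N E hκ hz hφ hΨ hψ hψs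
    refine ⟨max C₁ C₂, lt_max_of_lt_left hC₁, ?_⟩
    intro a hH hdom μ K hμ hμ1 hK lam hlam f hf
    rw [show mixedHessian (phase (N + 2) a) = formDeriv N (hessCoeff N a) 0 from
      funext₂ (mixedHessian_phase N a)] at hH hdom
    have hlam0 : 0 < lam := by linarith
    have hlog : 0 ≤ Real.log lam := Real.log_nonneg (by linarith)
    obtain ⟨hi, hsY, -⟩ := hasSum_piece N a hμ hK hφ hΨ hψ hψs hlam0 hz (indexY κ) hf
    obtain ⟨-, hsX, -⟩ := hasSum_piece N a hμ hK hφ hΨ hψ hψs hlam0 hz (indexX κ) hf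
    obtain ⟨mX, bX⟩ := hX a hH.coeff_ne_zero.1 hdom μ K hμ hμ1 hK lam hlam f hf
    obtain ⟨mY, bY⟩ := hY a hH.coeff_ne_zero.2 hdom μ K hμ hμ1 hK lam hlam f hf
    refine ⟨hi, ⟨fun x => (hsY x).summable, mY, bY.trans ?_⟩,
      ⟨fun x => (hsX x).summable, mX, bX.trans ?_⟩⟩
    · gcongr
      exact le_max_right _ _
    · gcongr
      exact le_max_left _ _
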